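/- **Setting.** Fix $\alpha\in(0,1)$, $\beta\in(0,1-\alpha)$, $s>0$, $1\le p<\infty$, $1\le q\le\infty$, $L>0$ and an integer $r>s$. For a null set $\mathcal P_0(\epsilon_0)$ and alternatives $\mathcal P_1(\epsilon_1)$ of distributions on a common sample space, let $R_*(\epsilon_0,\epsilon_1)=\inf_\psi\sup_{P\in\mathcal P_1(\epsilon_1)}P(\psi=0)$, the infimum being over measurable tests $\psi$ with values in $\{0,1\}$ and $\sup_{P\in\mathcal P_0(\epsilon_0)}P(\psi=1)\le\alpha$. The critical separation $\epsilon_1^*(\epsilon_0)$ is defined by $$\epsilon_1^*(\epsilon_0)-\epsilon_0=\inf\{\epsilon_1-\epsilon_0:\ \epsilon_1\ge\epsilon_0,\ R_*(\epsilon_0,\epsilon_1)<\beta\}.$$ * *Gaussian sequence model.* $\epsilon_1^*(\epsilon_0,\mathrm{GS}_d)$ is the critical separation for testing $\|v\|_p\le\epsilon_0$ against $\|v\|_p\ge\epsilon_1$ from $X\sim N(v,\sigma^2I_d)$, $v\in\mathbb R^d$. * *Gaussian white noise model.* $\epsilon_1^*(\epsilon_0,\mathrm{GW})$ is the critical separation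 for testing $\|f\|_p\le\epsilon_0$ against "$\|f\|_p\ge\epsilon_1$ and $\|f\|_{s,p,q}\le L$", $f\in L_2[0,1]$, from a path of $dX(t)=f(t)\,dt+\sigma\,dW(t)$, $t\in[0,1]$, $X(0)=0$, with $W$ a Brownian motion. Here $\|f\|_p$ is the $L_p[0,1]$ norm and $\|f\|_{s,p,q}=\|f\|_p+\big[\int_0^\infty (w(u)/u^s)^q\,\frac{du}{u}\big]^{1/q}$ for $q<\infty$, $\|f\|_{s,p,\infty}=\|f\|_p+\sup_{0<u<1}w(u)/u^s$, where $w(u)$ is the $L_p[0,1-ru]$ norm of $t\mapsto\sum_{k=0}^r\binom rk(-1)^kf(t+ku)$ (zero if $ru>1$). Write $a\asymp_C b$ for $a\le Cb$ and $b\le Ca$. "Constants" may depend on $\alpha,\beta,s,p,q,r,L$ and on the quantities indicated, but not on $\sigma,\epsilon_0,\tilde\epsilon_0,d$. **Theorem.** 1. There is a constant $A\ge1$ such that for all $\sigma\in(0,1]$ and $\epsilon_0\in[0,L]$ there is an integer $d\ge1$ with $d^{-s}\asymp_A\epsilon_1^*(\tilde\epsilon_0,\mathrm{GS}_d)\,d^{1/2-1/p}$,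 where $\tilde\epsilon_0=\epsilon_0d^{1/p-1/2}$. 2. For all $A\ge1$ and $K\ge0$ there are constants $C\ge1$ and $\sigma_0>0$ (depending also on $A,K$) such that the following holds for all $\sigma\in(0,1]$, $\epsilon_0,\tilde\epsilon_0\ge0$ and integers $d\ge1$ with $$\tilde\epsilon_0\asymp_A\epsilon_0\,d^{1/p-1/2},\qquad d^{-s}\asymp_A\epsilon_1^*(\tilde\epsilon_0,\mathrm{GS}_d)\,d^{1/2-1/p}.$$ First, $\epsilon_1^*(\epsilon_0,\mathrm{GW})\asymp_C\epsilon_1^*(\tilde\epsilon_0,\mathrm{GS}_d)\,d^{1/2-1/p}$. Secondly, if moreover $\sigma\le\sigma_0$ and the tolerance is moderate, in the sense that $\tilde\epsilon_0\le K\,(\epsilon_1^*(\tilde\epsilon_0,\mathrm{GS}_d)-\tilde\epsilon_0)$, then $$\epsilon_1^*(\epsilon_0,\mathrm{GW})-\epsilon_0\ \asymp_C\ \big(\epsilon_1^*(\tilde\epsilon_0,\mathrm{GS}_d)-\tilde\epsilon_0\big)\,d^{1/2-1/p}.$$ -/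

import Mathlib

open MeasureTheory ProbabilityTheory Set
open scoped ENNReal NNReal

namespace TolerantTesting

noncomputable section

/-! ### Minimax framework -/

section Minimax

variable {𝒳 : Type*} [MeasurableSpace 𝒳]

/-- Largest probability of rejecting over a set of distributions. A test is a measurable map into
`Bool`; the value `true` (one) rejects the null, the value `false` (zero) retains it. -/
def typeIError (P₀ : Set (Measure 𝒳)) (ψ : 𝒳 → Bool) : ℝ≥0∞ :=
  ⨆ P ∈ P₀, P {x | ψ x = true}

/-- The valid tests: measurable tests whose type-I error is at most `α` on the null set. -/
def validTests (α : ℝ) (P₀ : Set (Measure 𝒳)) : Set (𝒳 → Bool) :=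
  {ψ | Measurable ψ ∧ typeIError P₀ ψ ≤ ENNReal.ofReal α}

/-- The risk of a test: its largest type-II error on the alternative set. -/
def risk (P₁ : Set (Measure 𝒳)) (ψ : 𝒳 → Bool) : ℝ≥0∞ :=
  ⨆ P ∈ P₁, P {x | ψ x = false}

/-- The minimax risk over all valid tests. -/
def minimaxRisk (α : ℝ) (P₀ P₁ : Set (Measure 𝒳)) : ℝ≥0∞ :=
  ⨅ ψ ∈ validTests α P₀, risk P₁ ψ

/-- The critical separation `ε₁*(ε₀)`, defined by
`ε₁*(ε₀) - ε₀ = inf {ε₁ - ε₀ : ε₁ ≥ ε₀, minimax risk < β}`, for a null set `null ε₀` and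
alternative sets `alt ε₁`. -/
def criticalSeparation (α β : ℝ) (null alt : ℝ → Set (Measure 𝒳)) (ε₀ : ℝ) : ℝ :=
  ε₀ + sInf {δ : ℝ | ∃ ε₁ : ℝ, ε₀ ≤ ε₁ ∧
    minimaxRisk α (null ε₀) (alt ε₁) < ENNReal.ofReal β ∧ δ = ε₁ - ε₀}

end Minimax

/-! ### The Gaussian sequence model -/

/-- The `ℓ_p` norm on `ℝ^d`, for real `p ≥ 1`. -/
def lpNorm (p : ℝ) {d : ℕ} (v : Fin d → ℝ) : ℝ :=
  (∑ i, |v i| ^ p) ^ (1 / p)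

/-- The distribution `N(v, σ² I_d)`. -/
def gaussianSequence {d : ℕ} (σ : ℝ) (v : Fin d → ℝ) : Measure (Fin d → ℝ) :=
  Measure.pi fun i => gaussianReal (v i) ⟨σ ^ 2, sq_nonneg σ⟩

def gsNull (p : ℝ) (d : ℕ) (σ ε₀ : ℝ) : Set (Measure (Fin d → ℝ)) :=
  {P | ∃ v : Fin d → ℝ, lpNorm p v ≤ ε₀ ∧ P = gaussianSequence σ v}

def gsAlt (p : ℝ) (d : ℕ) (σ ε₁ : ℝ) : Set (Measure (Fin d → ℝ)) :=
  {P | ∃ v : Fin d → ℝ, ε₁ ≤ lpNorm p v ∧ P = gaussianSequence σ v}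

/-- Critical separation `ε₁*(ε₀, GS)` of the `d`-dimensional Gaussian sequence model with noise
level `σ` under the `ℓ_p` norm. -/
def gsCritical (α β p : ℝ) (d : ℕ) (σ ε₀ : ℝ) : ℝ :=
  criticalSeparation α β (gsNull p d σ) (gsAlt p d σ) ε₀

/-! ### Besov norm on `[0,1]` -/

/-- The `L_p[0,1]` norm. Only the values of `f` on `[0,1]` matter. -/
def unitLpNorm (p : ℝ) (f : ℝ → ℝ) : ℝ≥0∞ :=
  eLpNorm f (ENNReal.ofReal p) (volume.restrict (Icc 0 1))

/-- The `r`-th difference `∑_k C(r,k) (-1)^k f(t + k u)` of `f` with step `u`. -/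
def rthDiff (r : ℕ) (f : ℝ → ℝ) (u t : ℝ) : ℝ :=
  ∑ k ∈ Finset.range (r + 1), (r.choose k : ℝ) * (-1) ^ k * f (t + k * u)

/-- The `L_p[0, 1 - r u]` norm of the `r`-th difference of `f` with step `u`
(zero if `r u > 1`, the interval being empty). -/
def diffNorm (r : ℕ) (p : ℝ) (f : ℝ → ℝ) (u : ℝ) : ℝ≥0∞ :=
  eLpNorm (rthDiff r f u) (ENNReal.ofReal p) (volume.restrict (Icc 0 (1 - r * u)))

open Classical in
/-- The Besov norm `‖f‖_{s,p,q}` on `[0,1]`, through differences of order `r`. -/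
def besovNorm (r : ℕ) (s p : ℝ) (q : ℝ≥0∞) (f : ℝ → ℝ) : ℝ≥0∞ :=
  unitLpNorm p f +
    if q = ∞ then ⨆ u ∈ Ioo (0 : ℝ) 1, diffNorm r p f u / ENNReal.ofReal (u ^ s)
    else (∫⁻ u in Ioi (0 : ℝ),
      (diffNorm r p f u / ENNReal.ofReal (u ^ s)) ^ q.toReal / ENNReal.ofReal u) ^ (1 / q.toReal)

/-! ### The Gaussian white noise model -/

section WhiteNoise

variable {Ω : Type*} [MeasurableSpace Ω]

/-- The observed path `X(t) = ∫₀ᵗ f(u) du + σ W(t)`, `t ∈ [0,1]`, that is,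
`dX(t) = f(t) dt + σ dW(t)` with `X(0) = 0`. -/
def whiteNoisePath (W : ℝ≥0 → Ω → ℝ) (σ : ℝ) (f : ℝ → ℝ) (ω : Ω) (t : Icc (0 : ℝ) 1) : ℝ :=
  (∫ u in (0 : ℝ)..t, f u) + σ * W ⟨t, t.2.1⟩ ω

/-- The law `P_f` of the observed path, on path space with the σ-algebra generated by the
coordinates. -/
def whiteNoiseLaw (P : Measure Ω) (W : ℝ≥0 → Ω → ℝ) (σ : ℝ) (f : ℝ → ℝ) :
    Measure (Icc (0 : ℝ) 1 → ℝ) :=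
  P.map (whiteNoisePath W σ f)

def gwNull (P : Measure Ω) (W : ℝ≥0 → Ω → ℝ) (p σ ε₀ : ℝ) :
    Set (Measure (Icc (0 : ℝ) 1 → ℝ)) :=
  {Q | ∃ f : ℝ → ℝ, MemLp f 2 (volume.restrict (Icc 0 1)) ∧
    unitLpNorm p f ≤ ENNReal.ofReal ε₀ ∧ Q = whiteNoiseLaw P W σ f}

def gwAlt (P : Measure Ω) (W : ℝ≥0 → Ω → ℝ) (r : ℕ) (s p : ℝ) (q : ℝ≥0∞) (L σ ε₁ : ℝ) :
    Set (Measure (Icc (0 : ℝ) 1 → ℝ)) :=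
  {Q | ∃ f : ℝ → ℝ, MemLp f 2 (volume.restrict (Icc 0 1)) ∧
    ENNReal.ofReal ε₁ ≤ unitLpNorm p f ∧ besovNorm r s p q f ≤ ENNReal.ofReal L ∧
    Q = whiteNoiseLaw P W σ f}

/-- Critical separation `ε₁*(ε₀, GW)` of the Gaussian white noise model driven by `W` with noise
level `σ`, for the null `‖f‖_p ≤ ε₀` and the alternative `‖f‖_p ≥ ε₁`, `‖f‖_{s,p,q} ≤ L`. -/
def gwCritical (P : Measure Ω) (W : ℝ≥0 → Ω → ℝ) (α β : ℝ) (r : ℕ) (s p : ℝ) (q : ℝ≥0∞)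
    (L σ ε₀ : ℝ) : ℝ :=
  criticalSeparation α β (gwNull P W p σ) (gwAlt P W r s p q L σ) ε₀

end WhiteNoise

/-- `a ≍ b` with constant `C`. -/
def EquivUpTo (C a b : ℝ) : Prop :=
  a ≤ C * b ∧ b ≤ C * a

end

end TolerantTesting

/-! Both critical separations are read as statements about the existence of randomised tests
(`HasTest`), and tests are carried from one model to the other. Passing between minimax risks and
tests costs only constants in the error levels. These are recovered by scaling: one observation of
N(v, σ²I) can be split, with auxiliary noise, into n independent observations of N(v/√n, σ²I), so a
test for the radii (a, b) yields a test for (√n a, √n b) with errors of order 1/n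
(`HasTest.gaussianSequence_amplify`). Small errors are thus bought by a constant factor in both
radii. The same device changes the dimension by a constant factor (`exists_hasTest_block`) and
extends a test against a shell b ≤ ‖v‖ < 2b to the whole exterior, by treating dyadic shells
separately with geometrically decreasing errors (`exists_hasTest_shell`).

From sequence to white noise: the normalised increments of the path over md cells form a Gaussian
sequence whose mean is the vector of cell means of f. Their rescaled ℓ_p norm is at most 2‖f‖_p, and
on a Besov ball, for a suitable fixed m, it bounds ‖f‖_p from above up to a multiple of d^{-s}
(`exists_le_lpNorm_cellMean`). As d^{-s} is comparable to the rescaled separation, this gives the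
upper bound on the white noise separation (`exists_gwCritical_le`).

From white noise to sequence: v is used as the coefficient vector of d orthonormal disjoint bumps,
and a white noise path is generated from the observation by adding the part of a Brownian motion
orthogonal to the bumps (`exists_kernel_gaussianSequence_whiteNoiseLaw`). The Besov norm of such a
function is of order d^s times its L_p norm, so membership in the ball caps ‖v‖; this is why only
shells can be treated directly. The result is `exists_le_gwCritical`.

For moderate tolerance the comparison must concern the differences. Another component ρw, supported
away from the bumps, carries most of the null norm. Since p-th powers of norms of disjointly
supported functions add, the white noise radii ε₀, ε₁ become sequence radii ρ₀, ρ₁ with ρ₁^p - ρ₀^p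
= ε₁^p - ε₀^p, and ρ₀ can be tuned so that the final sequence null is exactly the prescribed one. If
ε₁ - ε₀ were a tiny fraction of the separation, ρ₁ would be too close to ρ₀ and the test would beat
the sequence separation (`exists_mul_le_gwCritical_sub`). Small noise is needed to make d large,
hence ρw small enough for the Besov ball.

The balancing dimension is found among powers of two: the rescaled separation grows at most by a
constant when the dimension doubles, and it stays bounded away from zero for fixed σ whereas d^{-s}
tends to zero (`exists_equivUpTo_gsCritical`). -/

namespace TolerantTesting

/-! ### Randomised tests -/

section Tests

variable {Θ Θ' 𝒳 𝒳' Z : Type*} [MeasurableSpace 𝒳] [MeasurableSpace 𝒳'] [MeasurableSpace Z]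

/-- There is a randomised test of `N₀` against `N₁` in the statistical model `M` with type-I error
at most `a` and type-II error at most `b`. -/
def HasTest (M : Θ → Measure 𝒳) (N₀ N₁ : Θ → Prop) (a b : ℝ≥0∞) : Prop :=
  ∃ φ : 𝒳 → ℝ≥0∞, Measurable φ ∧ (∀ x, φ x ≤ 1) ∧ (∀ θ, N₀ θ → ∫⁻ x, φ x ∂M θ ≤ a) ∧
    ∀ θ, N₁ θ → ∫⁻ x, (1 - φ x) ∂M θ ≤ b

theorem HasTest.mono {M : Θ → Measure 𝒳} {N₀ N₁ N₀' N₁' : Θ → Prop} {a b a' b' : ℝ≥0∞}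
    (h : HasTest M N₀ N₁ a b) (h₀ : ∀ θ, N₀' θ → N₀ θ) (h₁ : ∀ θ, N₁' θ → N₁ θ)
    (ha : a ≤ a') (hb : b ≤ b') : HasTest M N₀' N₁' a' b' := by
  obtain ⟨φ, hm, hle, hφ₀, hφ₁⟩ := h
  exact ⟨φ, hm, hle, fun θ hθ => (hφ₀ θ (h₀ θ hθ)).trans ha,
    fun θ hθ => (hφ₁ θ (h₁ θ hθ)).trans hb⟩

/-- Reject as soon as one of the tests rejects: type-I errors add up, while the type-II error is
governed by the single test designed for the alternative at hand, so `b` does not grow with the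
number of tests. -/
theorem HasTest.union {ι : Type*} [Countable ι] {M : Θ → Measure 𝒳} {N₀ N₁ : ι → Θ → Prop}
    {a : ι → ℝ≥0∞} {b : ℝ≥0∞} (h : ∀ k, HasTest M (N₀ k) (N₁ k) (a k) b) :
    HasTest M (fun θ => ∀ k, N₀ k θ) (fun θ => ∃ k, N₁ k θ) (∑' k, a k) b := by
  choose φ hm hle hφ₀ hφ₁ using h
  refine ⟨fun x => ⨆ k, φ k x, Measurable.iSup hm, fun x => iSup_le fun k => hle k x,
    fun θ hθ => ?_, fun θ ⟨k, hk⟩ => ?_⟩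
  · calc ∫⁻ x, ⨆ k, φ k x ∂M θ ≤ ∫⁻ x, ∑' k, φ k x ∂M θ :=
          lintegral_mono fun x => iSup_le fun k => ENNReal.le_tsum k
      _ = ∑' k, ∫⁻ x, φ k x ∂M θ := lintegral_tsum fun k => (hm k).aemeasurable
      _ ≤ ∑' k, a k := ENNReal.tsum_le_tsum fun k => hφ₀ k θ (hθ k)
  · exact (lintegral_mono fun x => tsub_le_tsub_left (le_iSup (fun k => φ k x) k) 1).trans
      (hφ₁ k θ hk)

/-- A test in the model `M'` is turned into a test in the model `M`, if the observations of `M'`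
can be generated from those of `M` and an independent random element. -/
theorem HasTest.transport {M : Θ → Measure 𝒳} {M' : Θ' → Measure 𝒳'} {ζ : Measure Z}
    [IsProbabilityMeasure ζ] {κ : 𝒳 × Z → 𝒳'} (hκ : Measurable κ)
    {N₀ N₁ : Θ → Prop} {N₀' N₁' : Θ' → Prop} {a b : ℝ≥0∞} (h : HasTest M' N₀' N₁' a b)
    (T : Θ → Θ') (h₀ : ∀ θ, N₀ θ → N₀' (T θ)) (h₁ : ∀ θ, N₁ θ → N₁' (T θ))
    (hM : ∀ θ, N₀ θ ∨ N₁ θ → ((M θ).prod ζ).map κ = M' (T θ)) : HasTest M N₀ N₁ a b := by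
  obtain ⟨φ, hm, hle, hφ₀, hφ₁⟩ := h
  have hmc : Measurable fun p => φ (κ p) := hm.comp hκ
  have key : ∀ (F : 𝒳' → ℝ≥0∞), Measurable F → ∀ θ, N₀ θ ∨ N₁ θ →
      ∫⁻ x, ∫⁻ z, F (κ (x, z)) ∂ζ ∂M θ = ∫⁻ y, F y ∂M' (T θ) := by
    intro F hF θ hθ
    rw [← hM θ hθ, lintegral_map hF hκ, lintegral_prod (fun p => F (κ p)) (hF.comp hκ).aemeasurable]
  -- The auxiliary randomness is averaged out, which is why tests take values in [0,1] rather than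
  -- in {0,1}.
  refine ⟨fun x => ∫⁻ z, φ (κ (x, z)) ∂ζ, hmc.lintegral_prod_right', fun x => ?_,
    fun θ hθ => ?_, fun θ hθ => ?_⟩
  · calc ∫⁻ z, φ (κ (x, z)) ∂ζ ≤ ∫⁻ _, 1 ∂ζ := lintegral_mono fun z => hle _
      _ = 1 := by simp
  · rw [key φ hm θ (Or.inl hθ)]
    exact hφ₀ _ (h₀ θ hθ)
  · refine le_trans ?_ (hφ₁ _ (h₁ θ hθ))
    rw [← key (fun y => 1 - φ y) (measurable_const.sub hm) θ (Or.inr hθ)]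
    refine lintegral_mono fun x => ?_
    have hx : Measurable fun z => φ (κ (x, z)) := hmc.comp measurable_prodMk_left
    rw [tsub_le_iff_right]
    change 1 ≤ _ + ∫⁻ z, φ (κ (x, z)) ∂ζ
    rw [← lintegral_add_right _ hx]
    calc (1 : ℝ≥0∞) = ∫⁻ _, 1 ∂ζ := by simp
      _ ≤ _ := lintegral_mono fun z => le_tsub_add

/-- The deterministic case of `HasTest.transport`. -/
theorem HasTest.comap {M : Θ → Measure 𝒳} {M' : Θ' → Measure 𝒳'} {κ : 𝒳 → 𝒳'}
    (hκ : Measurable κ) {N₀ N₁ : Θ → Prop} {N₀' N₁' : Θ' → Prop} {a b : ℝ≥0∞}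
    (h : HasTest M' N₀' N₁' a b) (T : Θ → Θ') (h₀ : ∀ θ, N₀ θ → N₀' (T θ))
    (h₁ : ∀ θ, N₁ θ → N₁' (T θ)) (hM : ∀ θ, N₀ θ ∨ N₁ θ → (M θ).map κ = M' (T θ)) :
    HasTest M N₀ N₁ a b := by
  obtain ⟨φ, hm, hle, hφ₀, hφ₁⟩ := h
  refine ⟨fun x => φ (κ x), hm.comp hκ, fun x => hle _, fun θ hθ => ?_, fun θ hθ => ?_⟩
  · rw [← lintegral_map hm hκ, hM θ (Or.inl hθ)]
    exact hφ₀ _ (h₀ θ hθ)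
  · rw [← lintegral_map (f := fun y => 1 - φ y) (measurable_const.sub hm) hκ, hM θ (Or.inr hθ)]
    exact hφ₁ _ (h₁ θ hθ)

/-- Chebyshev's inequality for the mean of independent bounded variables. -/
theorem measure_pi_deviation_le (μ : Measure 𝒳) [IsProbabilityMeasure μ] {g : 𝒳 → ℝ}
    (hg : Measurable g) (h0 : ∀ x, 0 ≤ g x) (h1 : ∀ x, g x ≤ 1) {n : ℕ} (hn : 0 < n) {γ : ℝ}
    (hγ : 0 < γ) :
    (Measure.pi fun _ : Fin n => μ) {y | n * γ ≤ |∑ k, g (y k) - n * ∫ x, g x ∂μ|} ≤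
      ENNReal.ofReal (1 / (n * γ ^ 2)) := by
  have hL : MemLp g 2 μ := MemLp.of_bound hg.aestronglyMeasurable 1
    (ae_of_all _ fun x => by rw [Real.norm_eq_abs, abs_of_nonneg (h0 x)]; exact h1 x)
  have hn' : (0 : ℝ) < n := by exact_mod_cast hn
  have hLi : ∀ k : Fin n, MemLp (fun y : Fin n → 𝒳 => g (y k)) 2 (Measure.pi fun _ => μ) :=
    fun k => hL.comp_measurePreserving (measurePreserving_eval (fun _ : Fin n => μ) k)
  have hS : MemLp (∑ k, fun y : Fin n → 𝒳 => g (y k)) 2 (Measure.pi fun _ => μ) :=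
    memLp_finsetSum' _ fun k _ => hLi k
  have hE : ∫ y, (∑ k, fun y : Fin n → 𝒳 => g (y k)) y ∂(Measure.pi fun _ : Fin n => μ)
      = n * ∫ x, g x ∂μ := by
    simp only [Finset.sum_apply]
    rw [integral_finsetSum _ fun k _ => (hLi k).integrable one_le_two]
    have : ∀ k : Fin n, ∫ y, g (y k) ∂(Measure.pi fun _ : Fin n => μ) = ∫ x, g x ∂μ := fun k => by
      have h := (measurePreserving_eval (fun _ : Fin n => μ) k).map_eq
      conv_rhs => rw [← h]
      rw [integral_map (measurable_pi_apply k).aemeasurable hg.aestronglyMeasurable]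
    simp [this]
  have hV : Var[∑ k, fun y : Fin n → 𝒳 => g (y k); Measure.pi fun _ : Fin n => μ] ≤ n := by
    rw [variance_sum_pi (X := fun _ : Fin n => g) fun _ => hL]
    have : Var[g; μ] ≤ 1 := (variance_le_sq_of_bounded (a := 0) (b := 1)
      (ae_of_all _ fun x => ⟨h0 x, h1 x⟩) hg.aemeasurable).trans (by norm_num)
    calc ∑ _k : Fin n, Var[g; μ] ≤ ∑ _k : Fin n, (1 : ℝ) := Finset.sum_le_sum fun _ _ => this
      _ = n := by simp
  have h := meas_ge_le_variance_div_sq hS (mul_pos hn' hγ)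
  rw [hE] at h
  simp only [Finset.sum_apply] at h
  refine h.trans (ENNReal.ofReal_le_ofReal ?_)
  calc _ ≤ (n : ℝ) / (n * γ) ^ 2 := by gcongr
    _ = 1 / (n * γ ^ 2) := by field_simp

/-- A test with errors `α`, `β`, `α + β < 1`, has errors of order `1 / n` when it is repeated on
`n` independent observations. -/
theorem HasTest.amplify {M : Θ → Measure 𝒳} (hM : ∀ θ, IsProbabilityMeasure (M θ))
    {N₀ N₁ : Θ → Prop} {α β γ : ℝ} (hα : 0 ≤ α) (hβ : 0 ≤ β) (hγ : 0 < γ)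
    (hαβ : α + β + 2 * γ ≤ 1) (h : HasTest M N₀ N₁ (ENNReal.ofReal α) (ENNReal.ofReal β))
    {n : ℕ} (hn : 0 < n) :
    HasTest (fun θ => Measure.pi fun _ : Fin n => M θ) N₀ N₁ (ENNReal.ofReal (1 / (n * γ ^ 2)))
      (ENNReal.ofReal (1 / (n * γ ^ 2))) := by
  classical
  obtain ⟨φ, hm, hle, hφ₀, hφ₁⟩ := h
  have hn' : (0 : ℝ) < n := by exact_mod_cast hn
  set g : 𝒳 → ℝ := fun x => (φ x).toReal with hgdef
  have hg : Measurable g := hm.ennreal_toReal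
  have h0 : ∀ x, 0 ≤ g x := fun x => ENNReal.toReal_nonneg
  have h1 : ∀ x, g x ≤ 1 := fun x => ENNReal.toReal_le_of_le_ofReal one_pos.le (by simpa using hle x)
  have hgi : ∀ θ, Integrable g (M θ) := fun θ => by
    have := hM θ
    exact Integrable.of_bound hg.aestronglyMeasurable 1
      (ae_of_all _ fun x => by rw [Real.norm_eq_abs, abs_of_nonneg (h0 x)]; exact h1 x)
  have hφg : ∀ x, φ x = ENNReal.ofReal (g x) := fun x =>
    (ENNReal.ofReal_toReal ((hle x).trans_lt ENNReal.one_lt_top).ne).symm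
  have hE0 : ∀ θ, N₀ θ → ∫ x, g x ∂M θ ≤ α := fun θ hθ => by
    have := hφ₀ θ hθ
    simp only [hφg] at this
    rw [← ofReal_integral_eq_lintegral_ofReal (hgi θ) (ae_of_all _ h0)] at this
    exact (ENNReal.ofReal_le_ofReal_iff hα).1 this
  have hE1 : ∀ θ, N₁ θ → 1 - β ≤ ∫ x, g x ∂M θ := fun θ hθ => by
    have := hM θ
    have h' := hφ₁ θ hθ
    have e : ∀ x, 1 - φ x = ENNReal.ofReal (1 - g x) := fun x => by
      rw [hφg, ENNReal.ofReal_sub _ (h0 x), ENNReal.ofReal_one]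
    simp only [e] at h'
    rw [← ofReal_integral_eq_lintegral_ofReal (f := fun x => 1 - g x)
      ((integrable_const _).sub (hgi θ)) (ae_of_all _ fun x => sub_nonneg.2 (h1 x)), ENNReal.ofReal_le_ofReal_iff hβ,
      integral_sub (integrable_const _) (hgi θ)] at h'
    simp at h'
    linarith
  -- Reject when the average of g exceeds α + γ. The expectation of g is at most α under the null
  -- and at least 1 - β ≥ α + 2γ under the alternative, so either error forces a deviation of at
  -- least γ.
  set S : Set (Fin n → 𝒳) := {y | n * (α + γ) ≤ ∑ k, g (y k)} with hS
  have hSm : MeasurableSet S := measurableSet_le measurable_const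
    (Finset.measurable_sum _ fun k _ => hg.comp (measurable_pi_apply k))
  refine ⟨S.indicator 1, measurable_one.indicator hSm, fun x => ?_, fun θ hθ => ?_,
    fun θ hθ => ?_⟩
  · exact indicator_le_self' (fun _ _ => zero_le) x
  · have := hM θ
    rw [lintegral_indicator_one hSm]
    refine le_trans (measure_mono fun y hy => ?_) (measure_pi_deviation_le (M θ) hg h0 h1 hn hγ)
    have hy' : n * (α + γ) ≤ ∑ k, g (y k) := hy
    change n * γ ≤ |∑ k, g (y k) - n * ∫ x, g x ∂M θ|
    refine le_trans ?_ (le_abs_self _)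
    have := mul_le_mul_of_nonneg_left (hE0 θ hθ) hn'.le
    linarith
  · have := hM θ
    have e : ∀ y, 1 - S.indicator (1 : (Fin n → 𝒳) → ℝ≥0∞) y = Sᶜ.indicator 1 y := fun y => by
      by_cases hy : y ∈ S <;> simp [hy]
    simp only [e]
    rw [lintegral_indicator_one hSm.compl]
    refine le_trans (measure_mono fun y hy => ?_) (measure_pi_deviation_le (M θ) hg h0 h1 hn hγ)
    have hy' : ∑ k, g (y k) < n * (α + γ) := not_le.1 hy
    change n * γ ≤ |∑ k, g (y k) - n * ∫ x, g x ∂M θ|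
    refine le_trans ?_ (neg_le_abs _)
    have h2 := mul_le_mul_of_nonneg_left (hE1 θ hθ) hn'.le
    have h3 := mul_le_mul_of_nonneg_left hαβ hn'.le
    linarith

theorem HasTest.of_minimaxRisk_lt {M : Θ → Measure 𝒳} {P₀ P₁ : Set (Measure 𝒳)} {α β : ℝ}
    {N₀ N₁ : Θ → Prop} (h₀ : ∀ θ, N₀ θ → M θ ∈ P₀) (h₁ : ∀ θ, N₁ θ → M θ ∈ P₁)
    (h : minimaxRisk α P₀ P₁ < ENNReal.ofReal β) :
    HasTest M N₀ N₁ (ENNReal.ofReal α) (ENNReal.ofReal β) := by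
  classical
  obtain ⟨ψ, hψ⟩ := iInf_lt_iff.1 h
  obtain ⟨⟨hm, hα⟩, hβ⟩ := iInf_lt_iff.1 hψ
  have hS : MeasurableSet {x | ψ x = true} := hm (measurableSet_singleton true)
  refine ⟨{x | ψ x = true}.indicator 1, measurable_one.indicator hS, fun x =>
    indicator_le_self' (fun _ _ => zero_le) x, fun θ hθ => ?_, fun θ hθ => ?_⟩
  · rw [lintegral_indicator_one hS]
    exact (le_iSup₂ (f := fun P (_ : P ∈ P₀) => P {x | ψ x = true}) (M θ) (h₀ θ hθ)).trans hα
  · have e : ∀ y, 1 - {x | ψ x = true}.indicator (1 : 𝒳 → ℝ≥0∞) y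
        = {x | ψ x = false}.indicator 1 y := fun y => by
      by_cases hy : ψ y = true <;> simp [hy]
    simp only [e]
    have hS' : MeasurableSet {x | ψ x = false} := hm (measurableSet_singleton false)
    rw [lintegral_indicator_one hS']
    exact (le_iSup₂ (f := fun P (_ : P ∈ P₁) => P {x | ψ x = false}) (M θ) (h₁ θ hθ)).trans hβ.le

/-- A randomised test with small errors yields a nonrandomised one. -/
theorem HasTest.minimaxRisk_lt {M : Θ → Measure 𝒳} {P₀ P₁ : Set (Measure 𝒳)} {α β : ℝ}
    {N₀ N₁ : Θ → Prop} (h₀ : ∀ P ∈ P₀, ∃ θ, N₀ θ ∧ P = M θ) (h₁ : ∀ P ∈ P₁, ∃ θ, N₁ θ ∧ P = M θ)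
    (hβ : 0 < β)
    (h : HasTest M N₀ N₁ (ENNReal.ofReal (α / 2)) (ENNReal.ofReal (β / 4))) :
    minimaxRisk α P₀ P₁ < ENNReal.ofReal β := by
  classical
  obtain ⟨φ, hm, hle, hφ₀, hφ₁⟩ := h
  have two : ∀ c : ℝ, 2 * ENNReal.ofReal c = ENNReal.ofReal (2 * c) := fun c => by
    rw [ENNReal.ofReal_mul zero_le_two]; simp
  -- Rounding φ at 1/2 costs a factor 2 by Markov's inequality. Hence α/2 is needed for size α, and
  -- β/4 leaves β/2, strictly below β.
  have markov : ∀ (P : Measure 𝒳) (F : 𝒳 → ℝ≥0∞), Measurable F →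
      P {x | 2⁻¹ ≤ F x} ≤ 2 * ∫⁻ x, F x ∂P := fun P F hF => by
    have h := mul_meas_ge_le_lintegral (μ := P) hF 2⁻¹
    calc P {x | 2⁻¹ ≤ F x} = 2 * (2⁻¹ * P {x | 2⁻¹ ≤ F x}) := by
          rw [← mul_assoc, ENNReal.mul_inv_cancel (by simp) (by simp), one_mul]
      _ ≤ _ := by gcongr
  have hle' : minimaxRisk α P₀ P₁ ≤ ENNReal.ofReal (β / 2) := by
    have hS : MeasurableSet {x | 2⁻¹ ≤ φ x} := measurableSet_le measurable_const hm
    refine iInf₂_le_of_le (fun x => decide (2⁻¹ ≤ φ x)) ⟨?_, ?_⟩ ?_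
    · refine measurable_to_bool ?_
      convert hS using 1
      ext x
      simp
    · refine iSup₂_le fun P hP => ?_
      obtain ⟨θ, hθ, rfl⟩ := h₀ P hP
      calc _ ≤ (M θ) {x | 2⁻¹ ≤ φ x} := measure_mono fun x hx => by simpa using hx
        _ ≤ 2 * ENNReal.ofReal (α / 2) := (markov _ φ hm).trans (by gcongr; exact hφ₀ θ hθ)
        _ = ENNReal.ofReal α := by rw [two]; congr 1; ring
    · refine iSup₂_le fun P hP => ?_
      obtain ⟨θ, hθ, rfl⟩ := h₁ P hP
      calc _ ≤ (M θ) {x | 2⁻¹ ≤ 1 - φ x} := measure_mono fun x hx => by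
              have hx' : φ x < 2⁻¹ := by simpa using hx
              change 2⁻¹ ≤ 1 - φ x
              rw [← ENNReal.one_sub_inv_two]
              exact tsub_le_tsub_left hx'.le 1
        _ ≤ 2 * ENNReal.ofReal (β / 4) :=
            (markov _ _ (measurable_const.sub hm)).trans (by gcongr; exact hφ₁ θ hθ)
        _ = ENNReal.ofReal (β / 2) := by rw [two]; congr 1; ring
  exact hle'.trans_lt ((ENNReal.ofReal_lt_ofReal_iff hβ).2 (by linarith))

end Tests

/-! ### Critical separations as thresholds -/

section CriticalSeparation

variable {𝒳 : Type*} [MeasurableSpace 𝒳] {α β : ℝ} {null alt : ℝ → Set (Measure 𝒳)} {ε₀ ε₁ : ℝ}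

theorem le_criticalSeparation : ε₀ ≤ criticalSeparation α β null alt ε₀ := by
  refine le_add_of_nonneg_right (Real.sInf_nonneg ?_)
  rintro δ ⟨ε₁, h, -, rfl⟩
  linarith

theorem criticalSeparation_le (h : ε₀ ≤ ε₁)
    (hr : minimaxRisk α (null ε₀) (alt ε₁) < ENNReal.ofReal β) :
    criticalSeparation α β null alt ε₀ ≤ ε₁ := by
  rw [criticalSeparation, ← le_sub_iff_add_le']
  refine csInf_le ⟨0, ?_⟩ ⟨ε₁, h, hr, rfl⟩
  rintro δ ⟨ε, h, -, rfl⟩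
  linarith

/-- The hypothesis `hne` cannot be dropped: the real infimum of the empty set is 0 by convention,
and a critical separation equal to ε₀ would then say nothing about tests. -/
theorem minimaxRisk_lt_of_criticalSeparation_lt (hanti : ∀ ε ε', ε ≤ ε' → alt ε' ⊆ alt ε)
    (hne : ∃ ε, ε₀ ≤ ε ∧ minimaxRisk α (null ε₀) (alt ε) < ENNReal.ofReal β)
    (h : criticalSeparation α β null alt ε₀ < ε₁) :
    minimaxRisk α (null ε₀) (alt ε₁) < ENNReal.ofReal β := by
  rw [criticalSeparation, ← lt_sub_iff_add_lt'] at h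
  obtain ⟨ε, hε, hr⟩ := hne
  obtain ⟨δ, ⟨ε', h', hr', rfl⟩, hlt⟩ := exists_lt_of_csInf_lt (by exact ⟨_, ε, hε, hr, rfl⟩) h
  refine lt_of_le_of_lt ?_ hr'
  refine iInf₂_mono fun ψ _ => ?_
  exact biSup_mono fun P hP => hanti ε' ε₁ (by linarith) hP

end CriticalSeparation

/-! ### Gaussian vectors -/

section GaussianVectors

variable {ι κ : Type*} [Fintype ι] [Fintype κ]

/-- The variance `σ²`. -/
noncomputable def sqVar (σ : ℝ) : ℝ≥0 := ⟨σ ^ 2, sq_nonneg σ⟩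

theorem coe_sqVar (σ : ℝ) : (sqVar σ : ℝ) = σ ^ 2 := rfl

/-- The distribution of a vector of independent Gaussian variables with mean `v`, variance `σ²`. -/
noncomputable def gaussianPi (σ : ℝ) (v : ι → ℝ) : Measure (ι → ℝ) :=
  Measure.pi fun i => gaussianReal (v i) (sqVar σ)

instance (σ : ℝ) (v : ι → ℝ) : IsProbabilityMeasure (gaussianPi σ v) := by
  unfold gaussianPi
  infer_instance

instance {d : ℕ} (σ : ℝ) (v : Fin d → ℝ) : IsProbabilityMeasure (gaussianSequence σ v) :=
  inferInstanceAs (IsProbabilityMeasure (gaussianPi σ v))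

theorem gaussianPi_eq_gaussianSequence {d : ℕ} (σ : ℝ) (v : Fin d → ℝ) :
    gaussianPi σ v = gaussianSequence σ v := rfl

theorem continuous_cexp_sum (c : ι → ℝ) :
    Continuous fun x : ι → ℝ => Complex.exp ((∑ i, c i * x i : ℝ) * Complex.I) := by
  fun_prop

theorem integral_cexp_gaussianPi (σ : ℝ) (v c : ι → ℝ) :
    ∫ x, Complex.exp ((∑ i, c i * x i : ℝ) * Complex.I) ∂gaussianPi σ v =
      Complex.exp ((∑ i, c i * v i : ℝ) * Complex.I - (σ ^ 2 / 2 * ∑ i, c i ^ 2 : ℝ)) := by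
  have h1 : ∀ x : ι → ℝ, Complex.exp ((∑ i, c i * x i : ℝ) * Complex.I) =
      ∏ i, Complex.exp (c i * x i * Complex.I) := fun x => by
    rw [← Complex.exp_sum]
    congr 1
    push_cast
    rw [Finset.sum_mul]
  simp_rw [h1]
  rw [gaussianPi, integral_fintype_prod_eq_prod (fun i (y : ℝ) => Complex.exp (c i * y * Complex.I))]
  have h2 : ∀ i, ∫ y : ℝ, Complex.exp (c i * y * Complex.I)
      ∂gaussianReal (v i) (sqVar σ) =
      Complex.exp (c i * v i * Complex.I - σ ^ 2 * c i ^ 2 / 2) := fun i => by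
    rw [← charFun_apply_real, charFun_gaussianReal]
    rw [coe_sqVar σ]
    push_cast
    rfl
  simp_rw [h2]
  rw [← Complex.exp_sum]
  congr 1
  push_cast
  rw [Finset.sum_sub_distrib, Finset.sum_mul, Finset.mul_sum]
  congr 1
  exact Finset.sum_congr rfl fun i _ => by ring

/-- Uniqueness of characteristic functions, in coordinates, so that it matches the explicit formula
`integral_cexp_gaussianPi`. All identities between Gaussian laws below are proved this way. -/
theorem ext_of_integral_cexp {μ ν : Measure (ι → ℝ)} [IsFiniteMeasure μ] [IsFiniteMeasure ν]
    (h : ∀ c : ι → ℝ, ∫ x, Complex.exp ((∑ i, c i * x i : ℝ) * Complex.I) ∂μ =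
      ∫ x, Complex.exp ((∑ i, c i * x i : ℝ) * Complex.I) ∂ν) : μ = ν := by
  classical
  refine Measure.ext_of_charFunDual (funext fun L => ?_)
  rw [charFunDual_apply, charFunDual_apply]
  have e : ∀ x : ι → ℝ, L x = ∑ i, L (Pi.single i 1) * x i := fun x => by
    conv_lhs => rw [pi_eq_sum_univ' x, map_sum]
    refine Finset.sum_congr rfl fun i _ => ?_
    rw [mul_comm, map_smul, smul_eq_mul]
  have h' := h fun i => L (Pi.single i 1)
  rw [integral_congr_ae (ae_of_all _ fun x => by rw [e x]),
    integral_congr_ae (g := fun x => Complex.exp (((∑ i, L (Pi.single i 1) * x i : ℝ) : ℂ)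
      * Complex.I)) (ae_of_all ν fun x => by rw [e x])]
  exact h'

/-- A Gaussian vector in the range of an isometry `U` is completed by independent noise
in the orthogonal complement. -/
theorem map_isometry_gaussianPi (σ : ℝ) {U : ι → κ → ℝ} [DecidableEq κ]
    (hU : ∀ a b, ∑ i, U i a * U i b = if a = b then 1 else 0) (v : κ → ℝ) :
    ((gaussianPi σ v).prod (gaussianPi σ (0 : ι → ℝ))).map
      (fun p i => ∑ a, U i a * p.1 a + (p.2 i - ∑ a, U i a * ∑ j, U j a * p.2 j)) =
      gaussianPi σ fun i => ∑ a, U i a * v a := by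
  have hmeas : Measurable fun (p : (κ → ℝ) × (ι → ℝ)) i =>
      ∑ a, U i a * p.1 a + (p.2 i - ∑ a, U i a * ∑ j, U j a * p.2 j) := by fun_prop
  have := Measure.isProbabilityMeasure_map (μ := (gaussianPi σ v).prod (gaussianPi σ (0 : ι → ℝ)))
    hmeas.aemeasurable
  refine ext_of_integral_cexp fun c => ?_
  rw [integral_map hmeas.aemeasurable (continuous_cexp_sum c).aestronglyMeasurable]
  -- With b = Uᵀc the exponent splits into b tested against the signal part and c - Ub tested
  -- against the noise. The variances recombine by Pythagoras, |b|² + |c - Ub|² = |c|².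
  set b : κ → ℝ := fun a => ∑ i, U i a * c i with hb
  have e1 : ∀ y : κ → ℝ, ∑ i, c i * ∑ a, U i a * y a = ∑ a, b a * y a := fun y => by
    simp_rw [Finset.mul_sum, hb, Finset.sum_mul]
    rw [Finset.sum_comm]
    exact Finset.sum_congr rfl fun a _ => Finset.sum_congr rfl fun i _ => by ring
  have e2 : ∀ z : ι → ℝ, ∑ i, c i * (z i - ∑ a, U i a * ∑ j, U j a * z j) =
      ∑ i, (c i - ∑ a, U i a * b a) * z i := fun z => by
    simp_rw [mul_sub, sub_mul, Finset.sum_sub_distrib]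
    rw [e1 fun a => ∑ j, U j a * z j]
    congr 1
    simp_rw [Finset.mul_sum, Finset.sum_mul]
    rw [Finset.sum_comm]
    exact Finset.sum_congr rfl fun a _ => Finset.sum_congr rfl fun i _ => by ring
  have e3 : ∀ p : (κ → ℝ) × (ι → ℝ), Complex.exp ((∑ i, c i *
      (∑ a, U i a * p.1 a + (p.2 i - ∑ a, U i a * ∑ j, U j a * p.2 j)) : ℝ) * Complex.I) =
      Complex.exp ((∑ a, b a * p.1 a : ℝ) * Complex.I) *
      Complex.exp ((∑ i, (c i - ∑ a, U i a * b a) * p.2 i : ℝ) * Complex.I) := fun p => by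
    rw [← Complex.exp_add, ← add_mul, ← Complex.ofReal_add]
    congr 3
    simp_rw [mul_add, Finset.sum_add_distrib]
    rw [e1, ← e2]
  simp_rw [e3]
  rw [integral_prod_mul (fun x : κ → ℝ => Complex.exp ((∑ a, b a * x a : ℝ) * Complex.I))
    (fun z : ι → ℝ => Complex.exp ((∑ i, (c i - ∑ a, U i a * b a) * z i : ℝ) * Complex.I)),
    integral_cexp_gaussianPi, integral_cexp_gaussianPi, integral_cexp_gaussianPi,
    ← Complex.exp_add]
  have e4 : ∑ i, (∑ a, U i a * b a) ^ 2 = ∑ a, b a ^ 2 := by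
    simp_rw [sq, Finset.sum_mul_sum]
    rw [Finset.sum_comm]
    refine Finset.sum_congr rfl fun a _ => ?_
    rw [Finset.sum_comm]
    have : ∀ a', ∑ i, U i a * b a * (U i a' * b a') = b a * b a' * if a = a' then 1 else 0 :=
      fun a' => by
        rw [← hU, Finset.mul_sum]
        exact Finset.sum_congr rfl fun i _ => by ring
    simp_rw [this]
    simp
  have e5 : ∑ i, c i * ∑ a, U i a * b a = ∑ a, b a ^ 2 := by
    rw [e1]
    simp [sq]
  have e6 : ∑ a, b a ^ 2 + ∑ i, (c i - ∑ a, U i a * b a) ^ 2 = ∑ i, c i ^ 2 := by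
    simp_rw [sub_sq, Finset.sum_add_distrib, Finset.sum_sub_distrib, mul_assoc, ← Finset.mul_sum]
    rw [e4, e5]
    ring
  congr 1
  rw [e1, ← e6]
  push_cast
  simp
  ring

theorem map_curry_gaussianPi {n d : ℕ} (σ : ℝ) (v : Fin n → Fin d → ℝ) :
    (gaussianPi σ fun q : Fin n × Fin d => v q.1 q.2).map (fun x k i => x (k, i)) =
      Measure.pi fun k => gaussianSequence σ (v k) := by
  have hu : Measurable fun (x : Fin n → Fin d → ℝ) (q : Fin n × Fin d) => x q.1 q.2 := by fun_prop
  have hc : Measurable fun (x : Fin n × Fin d → ℝ) k i => x (k, i) := by fun_prop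
  have := Measure.isProbabilityMeasure_map (μ := Measure.pi fun k => gaussianSequence σ (v k))
    hu.aemeasurable
  -- The inverse map is treated first, because the characteristic function argument applies to a
  -- single finite index set.
  have key : (Measure.pi fun k => gaussianSequence σ (v k)).map
      (fun x (q : Fin n × Fin d) => x q.1 q.2) = gaussianPi σ fun q => v q.1 q.2 := by
    refine ext_of_integral_cexp fun c => ?_
    rw [integral_map hu.aemeasurable (continuous_cexp_sum c).aestronglyMeasurable, integral_cexp_gaussianPi]
    have h1 : ∀ x : Fin n → Fin d → ℝ,
        Complex.exp ((∑ q : Fin n × Fin d, c q * x q.1 q.2 : ℝ) * Complex.I) =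
        ∏ k, Complex.exp ((∑ i, c (k, i) * x k i : ℝ) * Complex.I) := fun x => by
      rw [← Complex.exp_sum, Fintype.sum_prod_type]
      push_cast
      rw [Finset.sum_mul]
    simp_rw [h1]
    rw [integral_fintype_prod_eq_prod
      (fun k (y : Fin d → ℝ) => Complex.exp ((∑ i, c (k, i) * y i : ℝ) * Complex.I))]
    simp_rw [← gaussianPi_eq_gaussianSequence, integral_cexp_gaussianPi]
    rw [← Complex.exp_sum, Fintype.sum_prod_type, Fintype.sum_prod_type]
    congr 1
    push_cast
    rw [Finset.sum_sub_distrib, Finset.sum_mul, Finset.mul_sum]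
  rw [← key, Measure.map_map hc hu]
  exact Measure.map_id

theorem map_comp_gaussianPi (σ : ℝ) {e : κ → ι} (he : Function.Injective e) (v : ι → ℝ) :
    (gaussianPi σ v).map (fun x a => x (e a)) = gaussianPi σ fun a => v (e a) := by
  have hm : Measurable fun (x : ι → ℝ) a => x (e a) := by fun_prop
  have := Measure.isProbabilityMeasure_map (μ := gaussianPi σ v) hm.aemeasurable
  refine ext_of_integral_cexp fun c => ?_
  rw [integral_map hm.aemeasurable (continuous_cexp_sum c).aestronglyMeasurable]
  have h0 : ∀ i ∉ range e, Function.extend e c 0 i = 0 := fun i hi => by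
    rw [Function.extend_apply' _ _ _ hi]
    rfl
  have h1 : ∀ x : ι → ℝ, ∑ a, c a * x (e a) = ∑ i, Function.extend e c 0 i * x i := fun x =>
    Fintype.sum_of_injective e he _ _ (fun i hi => by rw [h0 i hi, zero_mul])
      fun a => by rw [he.extend_apply]
  have h2 : ∑ a, c a ^ 2 = ∑ i, Function.extend e c 0 i ^ 2 :=
    Fintype.sum_of_injective e he _ _ (fun i hi => by rw [h0 i hi]; simp)
      fun a => by rw [he.extend_apply]
  simp_rw [h1]
  rw [integral_cexp_gaussianPi, integral_cexp_gaussianPi, ← h1, h2]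

end GaussianVectors

/-! ### The `ℓ_p` norm -/

section LpNorm

variable {p : ℝ}

theorem lpNorm_nonneg (p : ℝ) {d : ℕ} (v : Fin d → ℝ) : 0 ≤ lpNorm p v :=
  Real.rpow_nonneg (Finset.sum_nonneg fun _ _ => Real.rpow_nonneg (abs_nonneg _) _) _

theorem lpNorm_rpow (hp : 1 ≤ p) {d : ℕ} (v : Fin d → ℝ) : lpNorm p v ^ p = ∑ i, |v i| ^ p := by
  have hp0 : p ≠ 0 := by linarith
  rw [lpNorm, ← Real.rpow_mul (Finset.sum_nonneg fun _ _ => Real.rpow_nonneg (abs_nonneg _) _),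
    one_div_mul_cancel hp0, Real.rpow_one]

theorem lpNorm_le_iff (hp : 1 ≤ p) {d : ℕ} (v : Fin d → ℝ) {c : ℝ} (hc : 0 ≤ c) :
    lpNorm p v ≤ c ↔ ∑ i, |v i| ^ p ≤ c ^ p := by
  rw [← lpNorm_rpow hp, Real.rpow_le_rpow_iff (lpNorm_nonneg p v) hc (by linarith)]

theorem lpNorm_smul (hp : 1 ≤ p) {d : ℕ} {c : ℝ} (hc : 0 ≤ c) (v : Fin d → ℝ) :
    lpNorm p (fun i => c * v i) = c * lpNorm p v := by
  have hp0 : p ≠ 0 := by linarith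
  simp_rw [lpNorm, abs_mul, abs_of_nonneg hc, Real.mul_rpow hc (abs_nonneg _)]
  rw [← Finset.mul_sum, Real.mul_rpow (Real.rpow_nonneg hc _)
    (Finset.sum_nonneg fun _ _ => Real.rpow_nonneg (abs_nonneg _) _), ← Real.rpow_mul hc,
    mul_one_div_cancel hp0, Real.rpow_one]

theorem lpNorm_add_le (hp : 1 ≤ p) {d : ℕ} (v w : Fin d → ℝ) :
    lpNorm p (fun i => v i + w i) ≤ lpNorm p v + lpNorm p w :=
  Real.Lp_add_le _ _ _ hp

theorem lpNorm_const (hp : 1 ≤ p) {d : ℕ} {c : ℝ} (hc : 0 ≤ c) :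
    lpNorm p (fun _ : Fin d => c) = (d : ℝ) ^ (1 / p) * c := by
  have hp0 : p ≠ 0 := by linarith
  simp only [lpNorm, abs_of_nonneg hc, Finset.sum_const, Finset.card_univ, Fintype.card_fin,
    nsmul_eq_mul]
  rw [Real.mul_rpow (Nat.cast_nonneg _) (Real.rpow_nonneg hc _), ← Real.rpow_mul hc,
    mul_one_div_cancel hp0, Real.rpow_one]

theorem lpNorm_zero (hp : 1 ≤ p) {d : ℕ} : lpNorm p (fun _ : Fin d => (0 : ℝ)) = 0 := by
  rw [lpNorm_const hp le_rfl, mul_zero]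

theorem lpNorm_le_of_abs_le (hp : 1 ≤ p) {d : ℕ} (hd : 1 ≤ d) {v : Fin d → ℝ} {c : ℝ} (hc : 0 ≤ c)
    (h : ∀ i, |v i| ≤ c) : lpNorm p v ≤ d * c := by
  have hd' : (1 : ℝ) ≤ d := by exact_mod_cast hd
  rw [lpNorm_le_iff hp v (by positivity)]
  calc ∑ i, |v i| ^ p ≤ ∑ _i : Fin d, c ^ p :=
        Finset.sum_le_sum fun i _ => Real.rpow_le_rpow (abs_nonneg _) (h i) (by linarith)
    _ = d * c ^ p := by simp
    _ ≤ (d : ℝ) ^ p * c ^ p := by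
        gcongr
        simpa using Real.rpow_le_rpow_of_exponent_le hd' hp
    _ = (d * c) ^ p := (Real.mul_rpow (by positivity) hc).symm

theorem lpNorm_comp_le (hp : 1 ≤ p) {d D : ℕ} {e : Fin d → Fin D} (he : Function.Injective e)
    (v : Fin D → ℝ) : lpNorm p (fun i => v (e i)) ≤ lpNorm p v := by
  classical
  rw [lpNorm_le_iff hp _ (lpNorm_nonneg p v), lpNorm_rpow hp]
  rw [← Finset.sum_image (f := fun j => |v j| ^ p) (s := Finset.univ) (g := e) he.injOn]
  exact Finset.sum_le_sum_of_subset_of_nonneg (Finset.subset_univ _)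
    fun _ _ _ => Real.rpow_nonneg (abs_nonneg _) _

/-- One of the `m` blocks of a vector carries the `m`-th part of its norm. -/
theorem exists_lpNorm_block_ge (hp : 1 ≤ p) {m d : ℕ} (hm : 1 ≤ m) (v : Fin (m * d) → ℝ) :
    ∃ j : Fin m, lpNorm p v ≤ m * lpNorm p fun i : Fin d => v (finProdFinEquiv (j, i)) := by
  have hm' : (1 : ℝ) ≤ m := by exact_mod_cast hm
  have : Nonempty (Fin m) := ⟨⟨0, hm⟩⟩
  obtain ⟨j, -, hj⟩ := Finset.exists_max_image Finset.univ
    (fun j : Fin m => lpNorm p fun i : Fin d => v (finProdFinEquiv (j, i))) Finset.univ_nonempty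
  refine ⟨j, ?_⟩
  set c := lpNorm p fun i : Fin d => v (finProdFinEquiv (j, i)) with hc
  have hc0 : 0 ≤ c := lpNorm_nonneg _ _
  rw [lpNorm_le_iff hp v (by positivity), ← finProdFinEquiv.sum_comp, Fintype.sum_prod_type]
  calc ∑ j : Fin m, ∑ i : Fin d, |v (finProdFinEquiv (j, i))| ^ p
      ≤ ∑ _j : Fin m, c ^ p := Finset.sum_le_sum fun k _ => by
        rw [← lpNorm_rpow hp fun i => v (finProdFinEquiv (k, i))]
        exact Real.rpow_le_rpow (lpNorm_nonneg _ _) (hj k (Finset.mem_univ _)) (by linarith)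
    _ = m * c ^ p := by simp
    _ ≤ (m : ℝ) ^ p * c ^ p := by
        gcongr
        simpa using Real.rpow_le_rpow_of_exponent_le hm' hp
    _ = (m * c) ^ p := (Real.mul_rpow (by positivity) hc0).symm

end LpNorm

/-! ### Tests in the Gaussian sequence model -/

section SequenceTests

variable {p α β σ : ℝ}

/-- The map v ↦ (v/√n, …, v/√n) is an isometry into n copies of ℝ^d. Filling up its orthogonal
complement with independent noise turns one observation with mean v into n independent ones with
mean v/√n, on which the amplified test is run. -/
theorem HasTest.gaussianSequence_amplify {d : ℕ} {γ : ℝ} {N₀ N₁ : (Fin d → ℝ) → Prop}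
    (hα : 0 ≤ α) (hβ : 0 ≤ β) (hγ : 0 < γ) (hαβ : α + β + 2 * γ ≤ 1)
    (h : HasTest (gaussianSequence σ) N₀ N₁ (ENNReal.ofReal α) (ENNReal.ofReal β))
    {n : ℕ} (hn : 0 < n) :
    HasTest (gaussianSequence σ) (fun v => N₀ fun i => (√n)⁻¹ * v i)
      (fun v => N₁ fun i => (√n)⁻¹ * v i) (ENNReal.ofReal (1 / (n * γ ^ 2)))
      (ENNReal.ofReal (1 / (n * γ ^ 2))) := by
  have hn' : (0 : ℝ) < n := by exact_mod_cast hn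
  have hamp := h.amplify (fun v => inferInstance) hα hβ hγ hαβ hn
  set U : Fin n × Fin d → Fin d → ℝ := fun q a => if q.2 = a then (√n)⁻¹ else 0 with hUdef
  have hU : ∀ a b, ∑ q, U q a * U q b = if a = b then 1 else 0 := fun a b => by
    simp only [hUdef, Fintype.sum_prod_type, mul_ite, ite_mul, zero_mul, mul_zero]
    by_cases hab : a = b
    · subst hab
      simp [← mul_inv, Real.mul_self_sqrt hn'.le, hn'.ne']
    · simp [hab, eq_comm]
  have hmeas : Measurable fun (x : (Fin d → ℝ) × (Fin n × Fin d → ℝ)) q =>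
      ∑ a, U q a * x.1 a + (x.2 q - ∑ a, U q a * ∑ j, U j a * x.2 j) := by fun_prop
  have hc : Measurable fun (x : Fin n × Fin d → ℝ) k i => x (k, i) := by fun_prop
  refine hamp.transport (ζ := gaussianPi σ (0 : Fin n × Fin d → ℝ)) (hc.comp hmeas)
    (fun v i => (√n)⁻¹ * v i) (fun v hv => hv) (fun v hv => hv) fun v _ => ?_
  rw [← Measure.map_map hc hmeas, ← gaussianPi_eq_gaussianSequence,
    map_isometry_gaussianPi σ hU v, ← map_curry_gaussianPi]
  congr 2
  ext q
  simp [hUdef]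

/-- A test of `‖v‖ ≤ a` against `‖v‖ ≥ b` in dimension `d` yields one with smaller errors in
dimension `m d`, with the separation inflated by a constant. -/
theorem exists_hasTest_block (hp : 1 ≤ p) (hα : 0 < α) (hβ : 0 < β) (hαβ : β < 1 - α) {m : ℕ}
    (hm : 1 ≤ m) (R : ℝ) : ∃ C : ℝ, 1 ≤ C ∧ ∀ (d : ℕ) (σ a b : ℝ), 0 ≤ a → 0 ≤ b →
      HasTest (gaussianSequence σ) (fun v : Fin d → ℝ => lpNorm p v ≤ a) (fun v => b ≤ lpNorm p v)
        (ENNReal.ofReal α) (ENNReal.ofReal β) →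
      HasTest (gaussianSequence σ) (fun v : Fin (m * d) → ℝ => lpNorm p v ≤ R * a)
        (fun v => C * b ≤ lpNorm p v) (ENNReal.ofReal (α / 2)) (ENNReal.ofReal (β / 4)) := by
  have hm' : (1 : ℝ) ≤ m := by exact_mod_cast hm
  set γ := (1 - α - β) / 2 with hγdef
  have hγ : 0 < γ := by rw [hγdef]; linarith
  set e := min (α / 2) (β / 4) with he
  have he0 : 0 < e := lt_min (by linarith) (by linarith)
  -- R² ≤ n makes the amplified null radius √n·a at least R·a, and n ≥ m/(eγ²) keeps the sum of the
  -- m block errors below e.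
  obtain ⟨n, hn⟩ := exists_nat_ge (max (max (R ^ 2) 1) (m / (e * γ ^ 2)))
  have hn1 : (1 : ℝ) ≤ n := ((le_max_right _ _).trans (le_max_left _ _)).trans hn
  have hn2 : R ^ 2 ≤ n := ((le_max_left _ _).trans (le_max_left _ _)).trans hn
  have hn3 : m / (e * γ ^ 2) ≤ n := (le_max_right _ _).trans hn
  have hn0 : 0 < n := by
    have : (0 : ℝ) < n := by linarith
    exact_mod_cast this
  have hs1 : 1 ≤ √n := Real.one_le_sqrt.2 hn1
  have hRs : R ≤ √n := Real.le_sqrt_of_sq_le hn2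
  have herr : m * (1 / (n * γ ^ 2)) ≤ e := by
    rw [div_le_iff₀ (by positivity)] at hn3
    rw [mul_one_div, div_le_iff₀ (by positivity)]
    linarith
  -- The factor √n comes from amplification, the factor m from passing to the block with the largest
  -- norm.
  refine ⟨m * √n, by nlinarith, fun d σ a b ha hb h => ?_⟩
  have hamp := h.gaussianSequence_amplify hα.le hβ.le hγ (by rw [hγdef]; linarith) hn0
  have hinj : ∀ j : Fin m, Function.Injective fun i : Fin d => finProdFinEquiv (j, i) :=
    fun j i i' hii => by simpa using hii
  have hblock : ∀ j : Fin m, HasTest (gaussianSequence σ)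
      (fun v : Fin (m * d) → ℝ => lpNorm p (fun i : Fin d => v (finProdFinEquiv (j, i))) ≤ √n * a)
      (fun v => √n * b ≤ lpNorm p fun i : Fin d => v (finProdFinEquiv (j, i)))
      (ENNReal.ofReal (1 / (n * γ ^ 2))) (ENNReal.ofReal (1 / (n * γ ^ 2))) := fun j => by
    have hs0 : 0 < √(n : ℝ) := by linarith
    refine hamp.comap (κ := fun x i => x (finProdFinEquiv (j, i))) (by fun_prop)
      (fun v i => v (finProdFinEquiv (j, i))) (fun v hv => ?_) (fun v hv => ?_) fun v _ => ?_
    · rw [lpNorm_smul hp (by positivity), inv_mul_le_iff₀ hs0]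
      exact hv
    · rw [lpNorm_smul hp (by positivity), le_inv_mul_iff₀ hs0]
      exact hv
    · exact map_comp_gaussianPi σ (hinj j) v
  refine (HasTest.union hblock).mono (fun v hv j => ?_) (fun v hv => ?_) ?_ ?_
  · exact (lpNorm_comp_le hp (hinj j) v).trans (hv.trans (by gcongr))
  · obtain ⟨j, hj⟩ := exists_lpNorm_block_ge hp hm v
    refine ⟨j, ?_⟩
    have h1 : m * (√n * b) ≤ m * lpNorm p fun i : Fin d => v (finProdFinEquiv (j, i)) := by
      rw [← mul_assoc]
      exact hv.trans hj
    exact le_of_mul_le_mul_left h1 (by linarith)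
  · rw [tsum_fintype]
    simp only [Finset.sum_const, Finset.card_univ, Fintype.card_fin, nsmul_eq_mul]
    rw [← ENNReal.ofReal_natCast, ← ENNReal.ofReal_mul (by positivity)]
    exact ENNReal.ofReal_le_ofReal (herr.trans (min_le_left _ _))
  · refine ENNReal.ofReal_le_ofReal (le_trans ?_ (herr.trans (min_le_right _ _)))
    have : 0 ≤ 1 / (n * γ ^ 2) := by positivity
    nlinarith

/-- A test against a shell `b ≤ ‖v‖ < 2 b` yields a test against the exterior of a ball. -/
theorem exists_hasTest_shell (hp : 1 ≤ p) (hα : 0 < α) (hβ : 0 < β) (hαβ : β < 1 - α) :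
    ∃ k₁ : ℕ, ∀ k₀, k₁ ≤ k₀ → ∀ (d : ℕ) (σ a b : ℝ), 0 ≤ a → 0 < b →
      HasTest (gaussianSequence σ) (fun v : Fin d → ℝ => lpNorm p v ≤ a)
        (fun v => b ≤ lpNorm p v ∧ lpNorm p v < 2 * b) (ENNReal.ofReal α) (ENNReal.ofReal β) →
      HasTest (gaussianSequence σ) (fun v : Fin d → ℝ => lpNorm p v ≤ 2 ^ k₀ * a)
        (fun v => 2 ^ k₀ * b ≤ lpNorm p v) (ENNReal.ofReal (α / 2)) (ENNReal.ofReal (β / 4)) := by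
  set γ := (1 - α - β) / 2 with hγdef
  have hγ : 0 < γ := by rw [hγdef]; linarith
  set e := min (α / 2) (β / 4) with he
  have he0 : 0 < e := lt_min (by linarith) (by linarith)
  -- The errors of the shells will sum to 2/(4^{k₀}γ²), which this choice keeps below e.
  obtain ⟨k₁, hk₁⟩ := pow_unbounded_of_one_lt (2 / (e * γ ^ 2)) (by norm_num : (1 : ℝ) < 4)
  refine ⟨k₁, fun k₀ hk d σ a b ha hb h => ?_⟩
  have herr : 1 / (4 ^ k₀ * γ ^ 2) * 2 ≤ e := by
    have h1 : 2 / (e * γ ^ 2) ≤ 4 ^ k₀ :=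
      hk₁.le.trans (pow_le_pow_right₀ (by norm_num) hk)
    rw [div_le_iff₀ (by positivity)] at h1
    rw [one_div_mul_eq_div, div_le_iff₀ (by positivity)]
    linarith
  -- Amplification with n = 4^{k₀+j} multiplies all radii by 2^{k₀+j}, so the images of the shell
  -- tile the exterior of the ball of radius 2^{k₀}b, and the null balls all contain the one for j =
  -- 0. The errors decrease like 4^{-j}; the weaker 2^{-j} is enough to sum.
  have hshell : ∀ j : ℕ, HasTest (gaussianSequence σ)
      (fun v : Fin d → ℝ => lpNorm p v ≤ 2 ^ (k₀ + j) * a)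
      (fun v => 2 ^ (k₀ + j) * b ≤ lpNorm p v ∧ lpNorm p v < 2 ^ (k₀ + j) * (2 * b))
      (ENNReal.ofReal (1 / (4 ^ k₀ * γ ^ 2) * (1 / 2) ^ j))
      (ENNReal.ofReal (1 / (4 ^ k₀ * γ ^ 2))) := fun j => by
    have hamp := h.gaussianSequence_amplify hα.le hβ.le hγ (by rw [hγdef]; linarith)
      (n := 4 ^ (k₀ + j)) (by positivity)
    have hs : √((4 ^ (k₀ + j) : ℕ) : ℝ) = 2 ^ (k₀ + j) := by
      push_cast
      rw [show (4 : ℝ) = 2 ^ 2 by norm_num, ← pow_mul, mul_comm, pow_mul]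
      exact Real.sqrt_sq (by positivity)
    rw [hs] at hamp
    have h2 : (0 : ℝ) < 2 ^ (k₀ + j) := by positivity
    refine hamp.mono (fun v hv => ?_) (fun v hv => ?_) (ENNReal.ofReal_le_ofReal ?_)
      (ENNReal.ofReal_le_ofReal ?_)
    · rw [lpNorm_smul hp (by positivity), inv_mul_le_iff₀ h2]
      exact hv
    · rw [lpNorm_smul hp (by positivity), le_inv_mul_iff₀ h2, inv_mul_lt_iff₀ h2]
      exact hv
    · push_cast
      rw [pow_add, one_div_pow, one_div_mul_one_div]
      refine one_div_le_one_div_of_le (by positivity) ?_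
      have : (2 : ℝ) ^ j ≤ 4 ^ j := pow_le_pow_left₀ (by norm_num) (by norm_num) _
      have h4 : (0 : ℝ) < 4 ^ k₀ * γ ^ 2 := by positivity
      nlinarith
    · push_cast
      refine one_div_le_one_div_of_le (by positivity) ?_
      gcongr
      · norm_num
      · omega
  refine (HasTest.union hshell).mono (fun v hv j => ?_) (fun v hv => ?_) ?_
    (ENNReal.ofReal_le_ofReal ?_)
  · refine hv.trans ?_
    gcongr
    · norm_num
    · omega
  · have h2 : (0 : ℝ) < 2 ^ k₀ * b := by positivity
    obtain ⟨j, hj, hj'⟩ := exists_nat_pow_near (x := lpNorm p v / (2 ^ k₀ * b)) (y := 2)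
      ((one_le_div h2).2 hv) (by norm_num)
    rw [le_div_iff₀ h2] at hj
    rw [div_lt_iff₀ h2] at hj'
    refine ⟨j, ?_, ?_⟩
    · rw [pow_add]
      linarith
    · rw [pow_add]
      rw [pow_succ] at hj'
      linarith
  · have hsum : Summable fun j : ℕ => 1 / (4 ^ k₀ * γ ^ 2) * (1 / 2 : ℝ) ^ j :=
      summable_geometric_two.mul_left _
    rw [← ENNReal.ofReal_tsum_of_nonneg (fun j => by positivity) hsum, tsum_mul_left,
      tsum_geometric_two]
    exact ENNReal.ofReal_le_ofReal (herr.trans (min_le_left _ _))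
  · refine le_trans ?_ (herr.trans (min_le_right _ _))
    have : 0 ≤ 1 / (4 ^ k₀ * γ ^ 2) := by positivity
    linarith

/-- In a fixed dimension a separation of order `σ` suffices. -/
theorem hasTest_gaussianSequence (hp : 1 ≤ p) {d : ℕ} (hd : 1 ≤ d) {η : ℝ} (hη : 0 < η) (hσ : 0 < σ)
    (a : ℝ) :
    HasTest (gaussianSequence σ) (fun v : Fin d → ℝ => lpNorm p v ≤ a)
      (fun v => a + 2 * (d * (√(d / η) * σ)) ≤ lpNorm p v) (ENNReal.ofReal η)
      (ENNReal.ofReal η) := by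
  classical
  have hd' : (1 : ℝ) ≤ d := by exact_mod_cast hd
  have hd0 : (0 : ℝ) < d := by linarith
  set t := √(d / η) * σ with ht
  have ht0 : 0 < t := by positivity
  -- At this t Chebyshev's inequality gives probability η/d to a deviation of one coordinate, and η
  -- after the union bound. Off that event the norms of x and v differ by less than d·t, and the
  -- test compares ‖x‖ with a + d·t.
  have ht2 : t ^ 2 = d / η * σ ^ 2 := by rw [ht, mul_pow, Real.sq_sqrt (by positivity)]
  have hdev : ∀ v : Fin d → ℝ, gaussianSequence σ v {x | ∃ i, t ≤ |x i - v i|} ≤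
      ENNReal.ofReal η := fun v => by
    have h1 : ∀ i, gaussianSequence σ v {x | t ≤ |x i - v i|} ≤ ENNReal.ofReal (η / d) := fun i => by
      have hm := measurePreserving_eval (fun i => gaussianReal (v i) (sqVar σ)) i
      have h2 := meas_ge_le_variance_div_sq (μ := gaussianReal (v i) (sqVar σ)) (X := id)
        (memLp_id_gaussianReal' 2 (by simp)) ht0
      rw [variance_id_gaussianReal, coe_sqVar, ht2] at h2
      simp only [id_eq, integral_id_gaussianReal] at h2
      rw [← hm.measure_preimage (measurableSet_le measurable_const
        (by fun_prop)).nullMeasurableSet] at h2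
      refine h2.trans (ENNReal.ofReal_le_ofReal (le_of_eq ?_))
      field_simp
    calc gaussianSequence σ v {x | ∃ i, t ≤ |x i - v i|}
        ≤ ∑ i, gaussianSequence σ v {x | t ≤ |x i - v i|} := by
          refine le_trans (measure_mono ?_) (measure_iUnion_fintype_le _ _)
          rintro x ⟨i, hi⟩
          exact mem_iUnion.2 ⟨i, hi⟩
      _ ≤ ∑ _i : Fin d, ENNReal.ofReal (η / d) := Finset.sum_le_sum fun i _ => h1 i
      _ = ENNReal.ofReal η := by
          simp only [Finset.sum_const, Finset.card_univ, Fintype.card_fin, nsmul_eq_mul]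
          rw [← ENNReal.ofReal_natCast, ← ENNReal.ofReal_mul hd0.le, mul_div_cancel₀ _ hd0.ne']
  have hcl : ∀ v x : Fin d → ℝ, (¬ ∃ i, t ≤ |x i - v i|) →
      lpNorm p x < lpNorm p v + d * t ∧ lpNorm p v < lpNorm p x + d * t := fun v x h => by
    push Not at h
    obtain ⟨i₀, -, hi₀⟩ := Finset.exists_max_image (Finset.univ : Finset (Fin d))
      (fun i => |x i - v i|) ⟨⟨0, hd⟩, Finset.mem_univ _⟩
    have h1 : lpNorm p (fun i => x i - v i) < d * t :=
      (lpNorm_le_of_abs_le hp hd (abs_nonneg (x i₀ - v i₀)) fun i =>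
        hi₀ i (Finset.mem_univ _)).trans_lt (mul_lt_mul_of_pos_left (h i₀) hd0)
    have h2 : lpNorm p (fun i => v i - x i) < d * t := by
      simp only [lpNorm] at h1 ⊢
      simp_rw [abs_sub_comm (v _) (x _)]
      exact h1
    have h3 := lpNorm_add_le hp v fun i => x i - v i
    have h4 := lpNorm_add_le hp x fun i => v i - x i
    simp only [add_sub_cancel] at h3 h4
    constructor <;> linarith
  have hcont : Continuous fun x : Fin d → ℝ => lpNorm p x := by
    unfold lpNorm
    refine Continuous.rpow_const (continuous_finsetSum _ fun i _ =>
      Continuous.rpow_const (by fun_prop) fun _ => Or.inr (by linarith)) fun _ => Or.inr ?_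
    positivity
  have hS : MeasurableSet {x : Fin d → ℝ | a + d * t ≤ lpNorm p x} :=
    measurableSet_le measurable_const hcont.measurable
  refine ⟨{x : Fin d → ℝ | a + d * t ≤ lpNorm p x}.indicator 1, measurable_one.indicator hS,
    fun x => indicator_le_self' (fun _ _ => zero_le) x, fun v hv => ?_, fun v hv => ?_⟩
  · rw [lintegral_indicator_one hS]
    refine le_trans (measure_mono fun x hx => ?_) (hdev v)
    by_contra hne
    have h1 : a + d * t ≤ lpNorm p x := hx
    have := (hcl v x hne).1
    linarith
  · have e : ∀ y, 1 - {x : Fin d → ℝ | a + d * t ≤ lpNorm p x}.indicator (1 : (Fin d → ℝ) → ℝ≥0∞) y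
        = {x : Fin d → ℝ | a + d * t ≤ lpNorm p x}ᶜ.indicator 1 y := fun y => by
      by_cases hy : y ∈ {x : Fin d → ℝ | a + d * t ≤ lpNorm p x} <;> simp [hy]
    simp only [e]
    rw [lintegral_indicator_one hS.compl]
    refine le_trans (measure_mono fun x hx => ?_) (hdev v)
    by_contra hne
    have h1 : lpNorm p x < a + d * t := not_le.1 hx
    have := (hcl v x hne).2
    linarith

/-- With L the likelihood ratio, the two integrals differ by the mean of (L - 1)g, at most that of
|L - 1| ≤ ε/2 + (L - 1)²/(2ε). The second moment of L - 1 is the χ²-divergence exp(η²/V) - 1. -/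
theorem integral_gaussianReal_le {V : ℝ≥0} (hV : V ≠ 0) {η ε : ℝ} (hε : 0 < ε) {g : ℝ → ℝ}
    (hg : Measurable g) (h0 : ∀ x, 0 ≤ g x) (h1 : ∀ x, g x ≤ 1) :
    ∫ x, g x ∂gaussianReal η V ≤ ∫ x, g x ∂gaussianReal 0 V + ε / 2 +
      (Real.exp (η ^ 2 / V) - 1) / (2 * ε) := by
  have hV' : (0 : ℝ) < V := by positivity
  set L : ℝ → ℝ := fun x => Real.exp (η / V * x) * Real.exp (-(η ^ 2 / (2 * V))) with hL
  have hpdf : ∀ x, gaussianPDFReal η V x = gaussianPDFReal 0 V x * L x := fun x => by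
    rw [hL, gaussianPDFReal_def, gaussianPDFReal_def]
    simp only
    rw [← Real.exp_add, mul_assoc _ (Real.exp _), ← Real.exp_add]
    congr 2
    field_simp
    ring
  have hLi : Integrable L (gaussianReal 0 V) := (integrable_exp_mul_gaussianReal _).mul_const _
  have hEL : ∀ t : ℝ, ∫ x, Real.exp (t * x) ∂gaussianReal 0 V = Real.exp (V * t ^ 2 / 2) := fun t => by
    have := congrFun (mgf_id_gaussianReal (μ := 0) (v := V)) t
    simpa [mgf] using this
  have hE1 : ∫ x, L x ∂gaussianReal 0 V = 1 := by
    rw [hL, integral_mul_const, hEL, ← Real.exp_add]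
    rw [Real.exp_eq_one_iff]
    field_simp
    ring
  have hL2 : ∀ x, L x ^ 2 = Real.exp (2 * η / V * x) * Real.exp (-(η ^ 2 / V)) := fun x => by
    rw [hL]
    simp only
    rw [← Real.exp_add, ← Real.exp_add, ← Real.exp_nat_mul]
    congr 1
    push_cast
    field_simp
  have hL2i : Integrable (fun x => L x ^ 2) (gaussianReal 0 V) := by
    simp_rw [hL2]
    exact (integrable_exp_mul_gaussianReal _).mul_const _
  have hE2 : ∫ x, L x ^ 2 ∂gaussianReal 0 V = Real.exp (η ^ 2 / V) := by
    simp_rw [hL2]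
    rw [integral_mul_const, hEL, ← Real.exp_add]
    congr 1
    field_simp
    ring
  have hgi : Integrable g (gaussianReal 0 V) := Integrable.of_bound hg.aestronglyMeasurable 1
    (ae_of_all _ fun x => by rw [Real.norm_eq_abs, abs_of_nonneg (h0 x)]; exact h1 x)
  have hLg : Integrable (fun x => L x * g x) (gaussianReal 0 V) :=
    hLi.mul_bdd hg.aestronglyMeasurable (c := 1)
      (ae_of_all _ fun x => by rw [Real.norm_eq_abs, abs_of_nonneg (h0 x)]; exact h1 x)
  have hEg : ∫ x, g x ∂gaussianReal η V = ∫ x, L x * g x ∂gaussianReal 0 V := by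
    rw [integral_gaussianReal_eq_integral_smul hV, integral_gaussianReal_eq_integral_smul hV]
    simp_rw [hpdf, smul_eq_mul, mul_assoc]
  rw [hEg]
  have hpt : ∀ x, L x * g x ≤ g x + (ε / 2 + (L x ^ 2 - 2 * L x + 1) / (2 * ε)) := fun x => by
    have h2 : g x * (L x - 1) ≤ |L x - 1| := by
      calc g x * (L x - 1) ≤ g x * |L x - 1| := mul_le_mul_of_nonneg_left (le_abs_self _) (h0 x)
        _ ≤ 1 * |L x - 1| := mul_le_mul_of_nonneg_right (h1 x) (abs_nonneg _)
        _ = _ := one_mul _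
    have h3 : |L x - 1| ≤ ε / 2 + (L x ^ 2 - 2 * L x + 1) / (2 * ε) := by
      have h4 : ε / 2 + (L x ^ 2 - 2 * L x + 1) / (2 * ε) - |L x - 1| =
          (|L x - 1| - ε) ^ 2 / (2 * ε) := by
        rw [show L x ^ 2 - 2 * L x + 1 = |L x - 1| ^ 2 by rw [sq_abs]; ring]
        field_simp
        ring
      have : 0 ≤ (|L x - 1| - ε) ^ 2 / (2 * ε) := by positivity
      linarith
    linarith
  have hi3 : Integrable (fun x => L x ^ 2 - 2 * L x + 1) (gaussianReal 0 V) :=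
    (hL2i.sub (hLi.const_mul 2)).add (integrable_const 1)
  have hE3 : ∫ x, (L x ^ 2 - 2 * L x + 1) ∂gaussianReal 0 V = Real.exp (η ^ 2 / V) - 1 := by
    rw [integral_add (f := fun x => L x ^ 2 - 2 * L x) (hL2i.sub (hLi.const_mul 2))
      (integrable_const 1), integral_sub hL2i (hLi.const_mul 2), integral_const_mul, hE1, hE2]
    simp
    ring
  have hi4 : Integrable (fun x => ε / 2 + (L x ^ 2 - 2 * L x + 1) / (2 * ε)) (gaussianReal 0 V) :=
    (integrable_const _).add (hi3.div_const _)
  calc ∫ x, L x * g x ∂gaussianReal 0 V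
      ≤ ∫ x, (g x + (ε / 2 + (L x ^ 2 - 2 * L x + 1) / (2 * ε))) ∂gaussianReal 0 V :=
        integral_mono hLg (hgi.add hi4) hpt
    _ = _ := by
        rw [integral_add hgi hi4, integral_add (integrable_const _) (hi3.div_const _),
          integral_div (2 * ε), hE3]
        simp
        ring

/-- The shift η is chosen so that exp(η²/σ²) = 1 + γ². The power then exceeds the size by at most γ,
less than the required 1 - α - β = 2γ. -/
theorem exists_not_hasTest_gaussianSequence_one (hα : 0 < α) (hβ : 0 < β) (hαβ : β < 1 - α)
    (hσ : 0 < σ) : ∃ η : ℝ, 0 < η ∧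
      ¬ HasTest (gaussianSequence σ) (fun v : Fin 1 → ℝ => v = fun _ => 0) (fun v => v = fun _ => η)
        (ENNReal.ofReal α) (ENNReal.ofReal β) := by
  set γ := (1 - α - β) / 2 with hγdef
  have hγ : 0 < γ := by rw [hγdef]; linarith
  have hV : sqVar σ ≠ 0 := by
    intro h
    have := congrArg NNReal.toReal h
    rw [coe_sqVar] at this
    simp at this
    exact hσ.ne' this
  set η := σ * √(Real.log (1 + γ ^ 2)) with hη
  have hlog : 0 < Real.log (1 + γ ^ 2) := Real.log_pos (by nlinarith)
  have hη0 : 0 < η := by positivity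
  refine ⟨η, hη0, ?_⟩
  rintro ⟨φ, hm, hle, hφ₀, hφ₁⟩
  have hc : Measurable fun (y : ℝ) (_ : Fin 1) => y := by fun_prop
  have hmap : ∀ y : ℝ, gaussianSequence σ (fun _ : Fin 1 => y) =
      (gaussianReal y (sqVar σ)).map fun y _ => y := fun y =>
    ((measurePreserving_funUnique (gaussianReal y (sqVar σ)) (Fin 1)).symm _).map_eq.symm
  set f : ℝ → ℝ≥0∞ := fun y => φ fun _ => y with hf
  have hfm : Measurable f := hm.comp hc
  have hfle : ∀ y, f y ≤ 1 := fun y => hle _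
  set g : ℝ → ℝ := fun y => (f y).toReal with hgdef
  have hg : Measurable g := hfm.ennreal_toReal
  have h0 : ∀ x, 0 ≤ g x := fun x => ENNReal.toReal_nonneg
  have h1 : ∀ x, g x ≤ 1 := fun x => ENNReal.toReal_le_of_le_ofReal one_pos.le (by simpa using hfle x)
  have hfg : ∀ x, f x = ENNReal.ofReal (g x) := fun x =>
    (ENNReal.ofReal_toReal ((hfle x).trans_lt ENNReal.one_lt_top).ne).symm
  have hgi : ∀ y, Integrable g (gaussianReal y (sqVar σ)) := fun y =>
    Integrable.of_bound hg.aestronglyMeasurable 1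
      (ae_of_all _ fun x => by rw [Real.norm_eq_abs, abs_of_nonneg (h0 x)]; exact h1 x)
  have hA : ∫ x, g x ∂gaussianReal 0 (sqVar σ) ≤ α := by
    have := hφ₀ _ rfl
    rw [hmap, lintegral_map hm hc] at this
    change ∫⁻ x, f x ∂_ ≤ _ at this
    simp_rw [hfg] at this
    rw [← ofReal_integral_eq_lintegral_ofReal (hgi 0) (ae_of_all _ h0)] at this
    exact (ENNReal.ofReal_le_ofReal_iff hα.le).1 this
  have hB : 1 - β ≤ ∫ x, g x ∂gaussianReal η (sqVar σ) := by
    have h' := hφ₁ _ rfl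
    rw [hmap, lintegral_map (f := fun y => 1 - φ y) (measurable_const.sub hm) hc] at h'
    change ∫⁻ x, (1 - f x) ∂_ ≤ _ at h'
    have e : ∀ x, 1 - f x = ENNReal.ofReal (1 - g x) := fun x => by
      rw [hfg, ENNReal.ofReal_sub _ (h0 x), ENNReal.ofReal_one]
    simp only [e] at h'
    rw [← ofReal_integral_eq_lintegral_ofReal (f := fun x => 1 - g x)
      ((integrable_const _).sub (hgi η)) (ae_of_all _ fun x => sub_nonneg.2 (h1 x)),
      ENNReal.ofReal_le_ofReal_iff hβ.le, integral_sub (integrable_const _) (hgi η)] at h'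
    simp at h'
    linarith
  have hC := integral_gaussianReal_le hV (η := η) hγ hg h0 h1
  have hexp : Real.exp (η ^ 2 / (sqVar σ : ℝ)) = 1 + γ ^ 2 := by
    rw [coe_sqVar, hη, mul_pow, Real.sq_sqrt hlog.le, mul_div_cancel_left₀ _ (by positivity),
      Real.exp_log (by positivity)]
  rw [hexp] at hC
  have : (1 + γ ^ 2 - 1) / (2 * γ) = γ / 2 := by field_simp; ring
  rw [this] at hC
  linarith

/-- The separation of a test, in the normalised `ℓ_p` norm, is bounded below in all dimensions. -/
theorem exists_le_of_hasTest (hp : 1 ≤ p) (hα : 0 < α) (hβ : 0 < β) (hαβ : β < 1 - α)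
    (hσ : 0 < σ) : ∃ η : ℝ, 0 < η ∧ ∀ (d : ℕ) (a b : ℝ), 1 ≤ d → 0 ≤ a →
      HasTest (gaussianSequence σ) (fun v : Fin d → ℝ => lpNorm p v ≤ a) (fun v => b ≤ lpNorm p v)
        (ENNReal.ofReal α) (ENNReal.ofReal β) → η ≤ b * (d : ℝ) ^ (1 / 2 - 1 / p) := by
  obtain ⟨η, hη, hno⟩ := exists_not_hasTest_gaussianSequence_one hα hβ hαβ hσ
  refine ⟨η, hη, fun d a b hd ha h => ?_⟩
  by_contra! hlt
  apply hno
  have hd' : (0 : ℝ) < d := by exact_mod_cast hd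
  -- The one-dimensional model is embedded along the unit vector (1, …, 1)/√d. The image of η has
  -- ℓ_p norm d^{1/p-1/2}η, which is η after normalisation, in every dimension.
  set U : Fin d → Fin 1 → ℝ := fun _ _ => (√d)⁻¹ with hUdef
  have hU : ∀ a b, ∑ q, U q a * U q b = if a = b then 1 else 0 := fun a b => by
    rw [Subsingleton.elim a b]
    simp [hUdef, ← mul_inv, Real.mul_self_sqrt hd'.le, hd'.ne']
  have hmeas : Measurable fun (x : (Fin 1 → ℝ) × (Fin d → ℝ)) q =>
      ∑ a, U q a * x.1 a + (x.2 q - ∑ a, U q a * ∑ j, U j a * x.2 j) := by fun_prop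
  refine h.transport (ζ := gaussianPi σ (0 : Fin d → ℝ)) hmeas (fun v _ => (√d)⁻¹ * v 0)
    (fun v hv => ?_) (fun v hv => ?_) fun v _ => ?_
  · subst hv
    simp only [mul_zero]
    rw [lpNorm_zero hp]
    exact ha
  · subst hv
    rw [lpNorm_const hp (by positivity)]
    have h1 : (d : ℝ) ^ (1 / p) * ((√d)⁻¹ * η) = η * (d : ℝ) ^ (-(1 / 2 - 1 / p)) := by
      rw [Real.sqrt_eq_rpow, ← Real.rpow_neg hd'.le, neg_sub, sub_eq_add_neg, Real.rpow_add hd']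
      ring
    rw [h1, Real.rpow_neg hd'.le, ← div_eq_mul_inv, le_div_iff₀ (by positivity)]
    exact hlt.le
  · rw [← gaussianPi_eq_gaussianSequence, map_isometry_gaussianPi σ hU v]
    simp [hUdef, gaussianPi_eq_gaussianSequence]

end SequenceTests

/-! ### The law of the white noise path -/

section WhiteNoiseLaw

open Filter Topology

variable {Ω : Type*} [MeasurableSpace Ω] {P : Measure Ω} {W : ℝ≥0 → Ω → ℝ}

/-- A Brownian motion may be replaced by a process with measurable marginals, without changing the
law of the white noise path. -/
theorem exists_measurable_whiteNoiseLaw_eq (hW : IsBrownianReal W P) :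
    ∃ W' : ℝ≥0 → Ω → ℝ, (∀ t, Measurable (W' t)) ∧ IsPreBrownianReal W' P ∧
      ∀ σ f, whiteNoiseLaw P W σ f = whiteNoiseLaw P W' σ f := by
  set M : ℝ≥0 → Ω → ℝ := fun q => (hW.aemeasurable q).mk (W q) with hM
  -- Rational times are countable, so almost surely W agrees with its measurable versions at all of
  -- them at once. Path continuity recovers every W(t) as a limit, and the limsup is measurable
  -- regardless. Agreement for all t simultaneously is needed, since the law is that of the whole
  -- path.
  set a : ℕ → ℝ≥0 → ℝ≥0 := fun n t => ⟨(⌊(t : ℝ) * n⌋₊ : ℝ) / n, by positivity⟩ with ha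
  have hlim : ∀ t, Tendsto (fun n => a n t) atTop (𝓝 t) := fun t => by
    rw [← NNReal.tendsto_coe]
    exact (tendsto_nat_floor_mul_div_atTop t.2).comp tendsto_natCast_atTop_atTop
  have hae : ∀ᵐ ω ∂P, ∀ k n : ℕ, W ⟨(k : ℝ) / n, by positivity⟩ ω = M ⟨(k : ℝ) / n, by positivity⟩ ω :=
    ae_all_iff.2 fun k => ae_all_iff.2 fun n => (hW.aemeasurable _).ae_eq_mk
  set W' : ℝ≥0 → Ω → ℝ := fun t ω => limsup (fun n => M (a n t) ω) atTop with hW'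
  have hm : ∀ t, Measurable (W' t) := fun t =>
    Measurable.limsup fun n => (hW.aemeasurable _).measurable_mk
  have heq : ∀ᵐ ω ∂P, ∀ t, W t ω = W' t ω := by
    filter_upwards [hae, hW.cont] with ω h1 h2 t
    have h3 : Tendsto (fun n => M (a n t) ω) atTop (𝓝 (W t ω)) := by
      have h4 := (h2.tendsto t).comp (hlim t)
      refine h4.congr fun n => ?_
      exact h1 _ n
    exact h3.limsup_eq.symm
  refine ⟨W', hm, hW.toIsPreBrownianReal.congr fun t => ?_, fun σ f => ?_⟩
  · filter_upwards [heq] with ω hω using hω t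
  · refine Measure.map_congr ?_
    filter_upwards [heq] with ω hω
    ext t
    exact congrArg (fun x => (∫ u in (0 : ℝ)..t, f u) + σ * x) (hω _)

/-- Lebesgue measure on `[0,1]`. -/
noncomputable abbrev unitVolume : Measure ℝ := volume.restrict (Icc 0 1)

/-- The indicator of `(0,t]` in `L₂[0,1]`. -/
noncomputable def ioIndicator (t : Icc (0 : ℝ) 1) : Lp ℝ 2 unitVolume :=
  indicatorConstLp 2 (measurableSet_Ioc : MeasurableSet (Ioc 0 (t : ℝ))) (measure_ne_top _ _) 1

theorem restrict_unitVolume_Ioc (t : Icc (0 : ℝ) 1) :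
    unitVolume.restrict (Ioc 0 (t : ℝ)) = volume.restrict (Ioc 0 (t : ℝ)) := by
  rw [unitVolume, Measure.restrict_restrict measurableSet_Ioc]
  congr 1
  exact inter_eq_left.2 fun x hx => ⟨hx.1.le, hx.2.trans t.2.2⟩

theorem inner_ioIndicator (t : Icc (0 : ℝ) 1) (f : Lp ℝ 2 unitVolume) :
    inner ℝ (ioIndicator t) f = ∫ u in (0 : ℝ)..t, f u := by
  rw [ioIndicator, L2.inner_indicatorConstLp_one, restrict_unitVolume_Ioc,
    intervalIntegral.integral_of_le t.2.1]

theorem inner_ioIndicator_ioIndicator (s t : Icc (0 : ℝ) 1) :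
    inner ℝ (ioIndicator s) (ioIndicator t) = min (s : ℝ) t := by
  rw [ioIndicator, ioIndicator, L2.real_inner_indicatorConstLp_one_indicatorConstLp_one,
    measureReal_def, unitVolume, Measure.restrict_apply (measurableSet_Ioc.inter measurableSet_Ioc)]
  have : Ioc 0 (s : ℝ) ∩ Ioc 0 (t : ℝ) ∩ Icc 0 1 = Ioc 0 (min (s : ℝ) t) := by
    ext x
    have := s.2.2
    simp only [mem_inter_iff, mem_Ioc, mem_Icc, le_min_iff]
    constructor
    · rintro ⟨⟨h1, h2⟩, -⟩
      exact ⟨h1.1, h1.2, h2.2⟩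
    · rintro ⟨h1, h2, h3⟩
      exact ⟨⟨⟨h1, h2⟩, h1, h3⟩, h1.le, by linarith⟩
  rw [this, Real.volume_Ioc, ENNReal.toReal_ofReal (by simp [s.2.1, t.2.1]), sub_zero]

/-- A function orthogonal to all these indicators has a vanishing primitive, hence vanishes almost
everywhere by Lebesgue's differentiation theorem. -/
theorem topologicalClosure_span_ioIndicator :
    (Submodule.span ℝ (range ioIndicator)).topologicalClosure = ⊤ := by
  rw [Submodule.topologicalClosure_eq_top_iff, Submodule.eq_bot_iff]
  intro h hh
  have h0 : ∀ t : Icc (0 : ℝ) 1, ∫ u in (0 : ℝ)..t, h u = 0 := fun t => by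
    rw [← inner_ioIndicator]
    exact hh _ (Submodule.subset_span ⟨t, rfl⟩)
  have hint : IntervalIntegrable h volume 0 1 := by
    rw [intervalIntegrable_iff_integrableOn_Icc_of_le zero_le_one]
    exact (Lp.memLp h).integrable one_le_two
  rw [Lp.eq_zero_iff_ae_eq_zero]
  have hd := hint.ae_hasDerivAt_integral
  change _ =ᵐ[volume.restrict (Icc 0 1)] _
  rw [← Measure.restrict_congr_set Ioo_ae_eq_Icc]
  refine (ae_restrict_iff' measurableSet_Ioo).2 ?_
  filter_upwards [hd] with x hx hx01
  rw [uIcc_of_le zero_le_one] at hx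
  have h1 := hx ⟨hx01.1.le, hx01.2.le⟩ 0 (by simp)
  have h2 : (fun x => ∫ t in (0 : ℝ)..x, h t) =ᶠ[𝓝 x] fun _ => 0 := by
    filter_upwards [Ioo_mem_nhds hx01.1 hx01.2] with y hy
    exact h0 ⟨y, hy.1.le, hy.2.le⟩
  exact h1.unique ((hasDerivAt_const x (0 : ℝ)).congr_of_eventuallyEq h2)

/-- Since |e^{ia} - e^{ib}| ≤ |a - b|, the L₁ distance bounds the difference, and the L₂ distance
bounds L₁ under a probability measure. This continuity extends the Gaussian characteristic function
to limits. -/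
theorem lipschitz_integral_cexp [IsProbabilityMeasure P] :
    LipschitzWith 1 fun y : Lp ℝ 2 P => ∫ ω, Complex.exp ((y ω : ℝ) * Complex.I) ∂P := by
  have hi : ∀ y : Lp ℝ 2 P, Integrable (fun ω => Complex.exp ((y ω : ℝ) * Complex.I)) P := fun y => by
    refine Integrable.of_bound ?_ 1 (ae_of_all _ fun ω => ?_)
    · exact (Continuous.comp_aestronglyMeasurable (g := fun x : ℝ => Complex.exp (x * Complex.I))
        (by fun_prop) (Lp.aestronglyMeasurable y))
    · rw [Complex.norm_exp_ofReal_mul_I]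
  refine LipschitzWith.of_dist_le_mul fun y y' => ?_
  rw [NNReal.coe_one, one_mul, dist_eq_norm, ← integral_sub (hi y) (hi y')]
  have hpt : ∀ a b : ℝ, ‖Complex.exp (a * Complex.I) - Complex.exp (b * Complex.I)‖ ≤ ‖a - b‖ :=
    fun a b => by
      have e : Complex.exp (a * Complex.I) - Complex.exp (b * Complex.I) =
          Complex.exp (b * Complex.I) * (Complex.exp (Complex.I * (a - b : ℝ)) - 1) := by
        rw [mul_sub, ← Complex.exp_add, mul_one]
        congr 2
        push_cast
        ring
      rw [e, norm_mul, Complex.norm_exp_ofReal_mul_I, one_mul]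
      exact Real.norm_exp_I_mul_ofReal_sub_one_le
  have hsub : Integrable (fun ω => ‖(y - y' : Lp ℝ 2 P) ω‖) P :=
    ((Lp.memLp (y - y')).integrable one_le_two).norm
  calc ‖∫ ω, (Complex.exp ((y ω : ℝ) * Complex.I) - Complex.exp ((y' ω : ℝ) * Complex.I)) ∂P‖
      ≤ ∫ ω, ‖(y - y' : Lp ℝ 2 P) ω‖ ∂P := by
        refine norm_integral_le_of_norm_le hsub ?_
        filter_upwards [Lp.coeFn_sub y y'] with ω hω
        rw [hω]
        exact hpt _ _
    _ = (eLpNorm (y - y' : Lp ℝ 2 P) 1 P).toReal := by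
        rw [eLpNorm_one_eq_lintegral_enorm, integral_norm_eq_lintegral_enorm
          (Lp.aestronglyMeasurable _)]
    _ ≤ (eLpNorm (y - y' : Lp ℝ 2 P) 2 P).toReal :=
        ENNReal.toReal_mono (Lp.eLpNorm_ne_top _)
          (eLpNorm_le_eLpNorm_of_exponent_le one_le_two (Lp.aestronglyMeasurable _))
    _ = dist y y' := by rw [dist_eq_norm, Lp.norm_def]

/-- The process `W` restricted to the time interval `[0,1]`. -/
def unitProcess (W : ℝ≥0 → Ω → ℝ) (t : Icc (0 : ℝ) 1) : Ω → ℝ := W ⟨t, t.2.1⟩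

theorem memLp_unitProcess (hW : IsPreBrownianReal W P) (t : Icc (0 : ℝ) 1) :
    MemLp (unitProcess W t) 2 P :=
  (hW.isGaussianProcess.hasGaussianLaw_eval _).memLp_two

/-- The closed subspace of `L₂[0,1] × L₂(P)` spanned by the pairs of the indicator of `(0,t]` and
`W(t)`; it is the graph of the Wiener integral. -/
noncomputable def wienerGraph (hW : IsPreBrownianReal W P) :
    Submodule ℝ (Lp ℝ 2 unitVolume × Lp ℝ 2 P) :=
  (Submodule.span ℝ (range fun t => (ioIndicator t, (memLp_unitProcess hW t).toLp))).topologicalClosure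

variable (hW : IsPreBrownianReal W P)

theorem integral_unitProcess (hW : IsPreBrownianReal W P) (t : Icc (0 : ℝ) 1) : ∫ ω, unitProcess W t ω ∂P = 0 :=
  hW.integral_eval _

theorem inner_unitProcess (s t : Icc (0 : ℝ) 1) :
    inner ℝ ((memLp_unitProcess hW s).toLp) ((memLp_unitProcess hW t).toLp) = min (s : ℝ) t := by
  have := hW.isGaussianProcess.isProbabilityMeasure
  have hcov : cov[unitProcess W s, unitProcess W t; P] =
      ((min ⟨s, s.2.1⟩ ⟨t, t.2.1⟩ : ℝ≥0) : ℝ) := hW.covariance_eval _ _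
  rw [covariance_eq_sub (memLp_unitProcess hW s) (memLp_unitProcess hW t),
    integral_unitProcess hW, integral_unitProcess hW, mul_zero, sub_zero] at hcov
  rw [L2.inner_def]
  have e : ((min ⟨s, s.2.1⟩ ⟨t, t.2.1⟩ : ℝ≥0) : ℝ) = min (s : ℝ) t := NNReal.coe_min _ _
  rw [← e, ← hcov]
  refine integral_congr_ae ?_
  filter_upwards [(memLp_unitProcess hW s).coeFn_toLp, (memLp_unitProcess hW t).coeFn_toLp]
    with ω h1 h2
  rw [h1, h2]
  simp [unitProcess, mul_comm]

/-- Itô's isometry: the indicators of (0,t] and the variables W(t) have the same Gram matrix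
min(s,t), and both sides are bilinear. -/
theorem inner_eq_inner_of_mem_span {z z' : Lp ℝ 2 unitVolume × Lp ℝ 2 P}
    (hz : z ∈ Submodule.span ℝ (range fun t => (ioIndicator t, (memLp_unitProcess hW t).toLp)))
    (hz' : z' ∈ Submodule.span ℝ
      (range fun t => (ioIndicator t, (memLp_unitProcess hW t).toLp))) :
    inner ℝ z.1 z'.1 = inner ℝ z.2 z'.2 := by
  induction hz, hz' using Submodule.span_induction₂ with
  | mem_mem x y hx hy =>
    obtain ⟨s, rfl⟩ := hx
    obtain ⟨t, rfl⟩ := hy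
    rw [inner_ioIndicator_ioIndicator, inner_unitProcess hW]
  | zero_left y hy => simp
  | zero_right x hx => simp
  | add_left x y z hx hy hz h1 h2 => simp [inner_add_left, h1, h2]
  | add_right x y z hx hy hz h1 h2 => simp [inner_add_right, h1, h2]
  | smul_left r x y hx hy h => simp [inner_smul_left, h]
  | smul_right r x y hx hy h => simp [inner_smul_right, h]

theorem norm_eq_norm_of_mem_span {z : Lp ℝ 2 unitVolume × Lp ℝ 2 P}
    (hz : z ∈ Submodule.span ℝ (range fun t => (ioIndicator t, (memLp_unitProcess hW t).toLp))) :
    ‖z.1‖ = ‖z.2‖ := by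
  rw [← sq_eq_sq₀ (norm_nonneg _) (norm_nonneg _), ← real_inner_self_eq_norm_sq,
    ← real_inner_self_eq_norm_sq, inner_eq_inner_of_mem_span hW hz hz]

/-- Every square integrable function has a Wiener integral. -/
theorem exists_mem_wienerGraph (h : Lp ℝ 2 unitVolume) :
    ∃ y : Lp ℝ 2 P, (h, y) ∈ wienerGraph hW := by
  set S := Submodule.span ℝ (range fun t => (ioIndicator t, (memLp_unitProcess hW t).toLp)) with hS
  have hfst : S.map (LinearMap.fst ℝ _ _) = Submodule.span ℝ (range ioIndicator) := by
    rw [hS, Submodule.map_span, ← range_comp]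
    rfl
  have hmem : h ∈ closure (Submodule.span ℝ (range ioIndicator) : Set (Lp ℝ 2 unitVolume)) := by
    rw [← Submodule.topologicalClosure_coe, topologicalClosure_span_ioIndicator]
    trivial
  obtain ⟨x, hx, hlim⟩ := mem_closure_iff_seq_limit.1 hmem
  have hex : ∀ n, ∃ z ∈ S, z.1 = x n := fun n => by
    have h1 : x n ∈ S.map (LinearMap.fst ℝ _ _) := by
      rw [hfst]
      exact hx n
    exact Submodule.mem_map.1 h1
  choose z hz hzx using hex
  -- By the isometry the second coordinates form a Cauchy sequence along with the first.
  have hc : CauchySeq fun n => (z n).2 := by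
    have h1 : CauchySeq x := hlim.cauchySeq
    rw [Metric.cauchySeq_iff'] at h1 ⊢
    intro ε hε
    obtain ⟨N, hN⟩ := h1 ε hε
    refine ⟨N, fun n hn => ?_⟩
    have h2 := norm_eq_norm_of_mem_span hW (S.sub_mem (hz n) (hz N))
    rw [dist_eq_norm, ← Prod.snd_sub, ← h2, Prod.fst_sub, hzx, hzx, ← dist_eq_norm]
    exact hN n hn
  obtain ⟨y, hy⟩ := cauchySeq_tendsto_of_complete hc
  refine ⟨y, ?_⟩
  rw [wienerGraph, ← SetLike.mem_coe, Submodule.topologicalClosure_coe]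
  refine mem_closure_of_tendsto (f := z) (b := atTop) ?_ (Eventually.of_forall hz)
  have h1 : Tendsto (fun n => (z n).1) atTop (𝓝 h) := by
    simp_rw [hzx]
    exact hlim
  exact h1.prodMk_nhds hy

/-- The Wiener integral of `h` is Gaussian with variance `‖h‖²`. -/
theorem integral_cexp_of_mem_wienerGraph {z : Lp ℝ 2 unitVolume × Lp ℝ 2 P}
    (hz : z ∈ wienerGraph hW) :
    ∫ ω, Complex.exp ((z.2 ω : ℝ) * Complex.I) ∂P = Complex.exp (-(‖z.1‖ ^ 2 / 2 : ℝ)) := by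
  have hprob := hW.isGaussianProcess.isProbabilityMeasure
  have hclosed : IsClosed {z : Lp ℝ 2 unitVolume × Lp ℝ 2 P |
      ∫ ω, Complex.exp ((z.2 ω : ℝ) * Complex.I) ∂P = Complex.exp (-(‖z.1‖ ^ 2 / 2 : ℝ))} :=
    isClosed_eq (lipschitz_integral_cexp.continuous.comp continuous_snd) (by fun_prop)
  -- Both sides depend continuously on z, so finite combinations of values of the Gaussian process W
  -- suffice.
  refine closure_minimal (fun z hz => ?_) hclosed hz
  have hz' : z ∈ Submodule.span ℝ
      (range fun t => (ioIndicator t, (memLp_unitProcess hW t).toLp)) := hz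
  obtain ⟨c, hc⟩ := Finsupp.mem_span_range_iff_exists_finsupp.1 hz'
  have h2 : z.2 = ∑ t ∈ c.support, c t • (memLp_unitProcess hW t).toLp := by
    rw [← hc, Finsupp.sum, Prod.snd_sum]
    rfl
  have hrep : z.2 =ᵐ[P] fun ω => ∑ t ∈ c.support, c t • unitProcess W t ω := by
    rw [h2]
    have h3 := Lp.coeFn_finsetSum c.support fun t => c t • (memLp_unitProcess hW t).toLp
    have h4 : ∀ᵐ ω ∂P, ∀ t ∈ c.support, (c t • (memLp_unitProcess hW t).toLp : Lp ℝ 2 P) ω =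
        c t • unitProcess W t ω := by
      rw [Finset.eventually_all]
      intro t _
      filter_upwards [Lp.coeFn_smul (c t) (memLp_unitProcess hW t).toLp,
        (memLp_unitProcess hW t).coeFn_toLp] with ω h5 h6
      rw [h5, Pi.smul_apply, h6]
    filter_upwards [h3, h4] with ω h5 h6
    rw [h5, Finset.sum_apply]
    exact Finset.sum_congr rfl h6
  have hgauss : HasGaussianLaw (fun ω => ∑ t ∈ c.support, c t • unitProcess W t ω) P :=
    ((hW.isGaussianProcess.comp_right fun t : Icc (0 : ℝ) 1 => (⟨t, t.2.1⟩ : ℝ≥0)).smul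
      c).hasGaussianLaw_fun_sum
  have hgauss' : HasGaussianLaw z.2 P := hgauss.congr hrep.symm
  have hmean : ∫ ω, z.2 ω ∂P = 0 := by
    rw [integral_congr_ae hrep, integral_finsetSum]
    · refine Finset.sum_eq_zero fun t _ => ?_
      rw [integral_smul, integral_unitProcess hW, smul_zero]
    · intro t _
      exact ((memLp_unitProcess hW t).integrable one_le_two).smul (c t)
  have hvar : Var[z.2; P] = ‖z.1‖ ^ 2 := by
    rw [variance_of_integral_eq_zero hgauss'.aemeasurable hmean, norm_eq_norm_of_mem_span hW hz',
      ← real_inner_self_eq_norm_sq, L2.inner_def]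
    refine integral_congr_ae (ae_of_all _ fun ω => ?_)
    simp [sq]
  have h3 := hgauss'.map_eq_gaussianReal
  rw [hmean, hvar] at h3
  have h4 := charFun_apply_real (μ := P.map z.2) 1
  rw [h3, charFun_gaussianReal, ← h3, integral_map hgauss'.aemeasurable
    (Continuous.aestronglyMeasurable (by fun_prop))] at h4
  simp only [Complex.ofReal_one, one_mul] at h4
  change _ = _
  rw [← h4]
  congr 1
  rw [Real.coe_toNNReal _ (by positivity)]
  push_cast
  ring

end WhiteNoiseLaw

/-! ### Reductions between the Gaussian sequence and the white noise model -/

section Reductions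

variable {Ω : Type*} [MeasurableSpace Ω] {P : Measure Ω} {W : ℝ≥0 → Ω → ℝ}

theorem measurable_whiteNoisePath (hm : ∀ t, Measurable (W t)) (σ : ℝ) (f : ℝ → ℝ) :
    Measurable (whiteNoisePath W σ f) :=
  measurable_pi_lambda _ fun _ => measurable_const.add ((hm _).const_mul σ)

theorem isProbabilityMeasure_whiteNoiseLaw [IsProbabilityMeasure P] (hm : ∀ t, Measurable (W t))
    (σ : ℝ) (f : ℝ → ℝ) : IsProbabilityMeasure (whiteNoiseLaw P W σ f) :=
  Measure.isProbabilityMeasure_map (measurable_whiteNoisePath hm σ f).aemeasurable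

theorem sum_smul_mem_wienerGraph {J : Type*} [Fintype J] (hW : IsPreBrownianReal W P)
    (τ : J → Icc (0 : ℝ) 1) (c : J → ℝ) :
    ∑ j, c j • (ioIndicator (τ j), (memLp_unitProcess hW (τ j)).toLp) ∈ wienerGraph hW :=
  Submodule.sum_mem _ fun j _ => Submodule.smul_mem _ _
    (Submodule.le_topologicalClosure _ (Submodule.subset_span ⟨τ j, rfl⟩))

theorem coeFn_sum_smul {J : Type*} [Fintype J] (y : J → Lp ℝ 2 P) (c : J → ℝ) :
    (∑ j, c j • y j : Lp ℝ 2 P) =ᵐ[P] fun ω => ∑ j, c j * y j ω := by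
  have h3 := Lp.coeFn_finsetSum Finset.univ fun j => c j • y j
  have h4 : ∀ᵐ ω ∂P, ∀ j, (c j • y j : Lp ℝ 2 P) ω = c j * y j ω := by
    rw [ae_all_iff]
    intro j
    filter_upwards [Lp.coeFn_smul (c j) (y j)] with ω h5
    rw [h5, Pi.smul_apply, smul_eq_mul]
  filter_upwards [h3, h4] with ω h5 h6
  rw [h5, Finset.sum_apply]
  exact Finset.sum_congr rfl fun j _ => h6 j

theorem coeFn_sum_smul_unitProcess {J : Type*} [Fintype J] (hW : IsPreBrownianReal W P)
    (τ : J → Icc (0 : ℝ) 1) (c : J → ℝ) :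
    (∑ j, c j • (memLp_unitProcess hW (τ j)).toLp : Lp ℝ 2 P) =ᵐ[P]
      fun ω => ∑ j, c j * unitProcess W (τ j) ω := by
  have h4 : ∀ᵐ ω ∂P, ∀ j, MemLp.toLp _ (memLp_unitProcess hW (τ j)) ω = unitProcess W (τ j) ω :=
    by
      rw [ae_all_iff]
      exact fun j => (memLp_unitProcess hW (τ j)).coeFn_toLp
  filter_upwards [coeFn_sum_smul (fun j => (memLp_unitProcess hW (τ j)).toLp) c, h4] with ω h5 h6
  rw [h5]
  exact Finset.sum_congr rfl fun j _ => by rw [h6]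

theorem integral_cexp_smul_of_mem_wienerGraph (hW : IsPreBrownianReal W P) (σ : ℝ)
    {z : Lp ℝ 2 unitVolume × Lp ℝ 2 P} (hz : z ∈ wienerGraph hW) :
    ∫ ω, Complex.exp ((σ * z.2 ω : ℝ) * Complex.I) ∂P =
      Complex.exp (-(σ ^ 2 / 2 * ‖z.1‖ ^ 2 : ℝ)) := by
  have h := integral_cexp_of_mem_wienerGraph hW (Submodule.smul_mem _ σ hz)
  have e : ∫ ω, Complex.exp ((σ * z.2 ω : ℝ) * Complex.I) ∂P =
      ∫ ω, Complex.exp (((σ • z).2 ω : ℝ) * Complex.I) ∂P := by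
    refine integral_congr_ae ?_
    filter_upwards [Lp.coeFn_smul σ z.2] with ω hω
    rw [Prod.smul_snd, hω, Pi.smul_apply, smul_eq_mul]
  rw [e, h, Prod.smul_fst, norm_smul, mul_pow, Real.norm_eq_abs, sq_abs]
  congr 3
  ring

/-- The characteristic function of the white noise path. -/
theorem integral_cexp_whiteNoiseLaw {J : Type*} [Fintype J] (hW : IsPreBrownianReal W P)
    (hm : ∀ t, Measurable (W t)) (σ : ℝ) (f : ℝ → ℝ) (τ : J → Icc (0 : ℝ) 1) (c : J → ℝ) :
    ∫ x, Complex.exp ((∑ j, c j * x (τ j) : ℝ) * Complex.I) ∂whiteNoiseLaw P W σ f =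
      Complex.exp ((∑ j, c j * ∫ u in (0 : ℝ)..τ j, f u : ℝ) * Complex.I -
        (σ ^ 2 / 2 * ‖∑ j, c j • ioIndicator (τ j)‖ ^ 2 : ℝ)) := by
  rw [whiteNoiseLaw, integral_map (measurable_whiteNoisePath hm σ f).aemeasurable
    (Measurable.aestronglyMeasurable (by fun_prop))]
  have h := integral_cexp_smul_of_mem_wienerGraph hW σ (sum_smul_mem_wienerGraph hW τ c)
  have e : ∫ ω, Complex.exp ((∑ j, c j * whiteNoisePath W σ f ω (τ j) : ℝ) * Complex.I) ∂P =
      ∫ ω, Complex.exp ((∑ j, c j * ∫ u in (0 : ℝ)..τ j, f u : ℝ) * Complex.I) *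
        Complex.exp ((σ * (∑ j, c j • (ioIndicator (τ j), (memLp_unitProcess hW (τ j)).toLp) :
          Lp ℝ 2 unitVolume × Lp ℝ 2 P).2 ω : ℝ) * Complex.I) ∂P := by
    refine integral_congr_ae ?_
    filter_upwards [coeFn_sum_smul_unitProcess hW τ c] with ω hω
    rw [Prod.snd_sum]
    simp only [Prod.smul_snd]
    rw [hω, ← Complex.exp_add, ← add_mul, ← Complex.ofReal_add, Finset.mul_sum,
      ← Finset.sum_add_distrib]
    congr 3
    refine Finset.sum_congr rfl fun j _ => ?_
    change c j * (_ + σ * unitProcess W (τ j) ω) = _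
    ring
  rw [e, integral_const_mul, h, ← Complex.exp_add, Prod.fst_sum, sub_eq_add_neg]
  simp only [Prod.smul_fst]

/-- The σ-algebra is generated by the coordinates, so finite-dimensional marginals determine a
probability measure even on this uncountable product. -/
theorem measure_ext_of_restrict {μ ν : Measure (Icc (0 : ℝ) 1 → ℝ)} [IsProbabilityMeasure μ]
    [IsProbabilityMeasure ν] (h : ∀ I : Finset (Icc (0 : ℝ) 1), μ.map I.restrict = ν.map I.restrict) :
    μ = ν := by
  have hμ : IsProjectiveLimit μ fun I : Finset (Icc (0 : ℝ) 1) => ν.map I.restrict := h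
  have hν : IsProjectiveLimit ν fun I : Finset (Icc (0 : ℝ) 1) => ν.map I.restrict := fun _ => rfl
  have : ∀ I : Finset (Icc (0 : ℝ) 1), IsFiniteMeasure (ν.map I.restrict) := fun I => inferInstance
  exact hμ.unique hν

/-- From observations in the Gaussian sequence model, with means the coefficients of an orthonormal
system, one obtains the white noise path by adding independent noise. -/
theorem exists_kernel_gaussianSequence_whiteNoiseLaw {d : ℕ} (hW : IsPreBrownianReal W P)
    (hm : ∀ t, Measurable (W t)) (σ : ℝ) {φ : Fin d → ℝ → ℝ} (hφ : ∀ i, MemLp (φ i) 2 unitVolume)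
    (horth : ∀ i j, ∫ u in Icc (0 : ℝ) 1, φ i u * φ j u = if i = j then 1 else 0) {w : ℝ → ℝ}
    (hw : MemLp w 2 unitVolume) :
    ∃ κ : (Fin d → ℝ) × Ω → Icc (0 : ℝ) 1 → ℝ, Measurable κ ∧ ∀ v : Fin d → ℝ,
      ((gaussianSequence σ v).prod P).map κ =
        whiteNoiseLaw P W σ fun t => w t + ∑ i, v i * φ i t := by
  have hprob := hW.isGaussianProcess.isProbabilityMeasure
  choose η hη using fun i => exists_mem_wienerGraph hW (hφ i).toLp
  have hη' : ∀ i, Measurable (η i) := fun i => (Lp.stronglyMeasurable (η i)).measurable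
  set Φ : Fin d → Icc (0 : ℝ) 1 → ℝ := fun i t => ∫ u in (0 : ℝ)..t, φ i u with hΦ
  have hint : ∀ {g : ℝ → ℝ}, MemLp g 2 unitVolume → ∀ t : Icc (0 : ℝ) 1,
      IntervalIntegrable g volume 0 t := fun hg t => by
    rw [intervalIntegrable_iff_integrableOn_Icc_of_le t.2.1]
    exact (hg.integrable one_le_two).mono_measure
      (Measure.restrict_mono (Icc_subset_Icc_right t.2.2) le_rfl)
  have hΦinner : ∀ i t, inner ℝ (ioIndicator t) (hφ i).toLp = Φ i t := fun i t => by
    rw [ioIndicator, L2.inner_indicatorConstLp_one, restrict_unitVolume_Ioc, hΦ]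
    simp only
    rw [intervalIntegral.integral_of_le t.2.1]
    refine integral_congr_ae ?_
    rw [← restrict_unitVolume_Ioc]
    exact ae_restrict_of_ae (hφ i).coeFn_toLp
  have hon : Orthonormal ℝ fun i => (hφ i).toLp := by
    rw [orthonormal_iff_ite]
    intro i j
    rw [L2.inner_def, ← horth]
    refine integral_congr_ae ?_
    filter_upwards [(hφ i).coeFn_toLp, (hφ j).coeFn_toLp] with u h1 h2
    rw [h1, h2]
    simp [mul_comm]
  -- The components of W along the φ_i, with coefficients η_i, are removed and the observed
  -- coordinates put in their place. The remainder of W belongs to the orthogonal complement, so its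
  -- variance and that of the observations add up to that of W.
  set κ : (Fin d → ℝ) × Ω → Icc (0 : ℝ) 1 → ℝ := fun p t =>
    (∫ u in (0 : ℝ)..t, w u) + ∑ i, p.1 i * Φ i t +
      σ * (unitProcess W t p.2 - ∑ i, Φ i t * η i p.2) with hκ
  have hWm : ∀ t : Icc (0 : ℝ) 1, Measurable (unitProcess W t) := fun t => hm _
  have hκm : Measurable κ := measurable_pi_lambda _ fun t => by fun_prop
  refine ⟨κ, hκm, fun v => ?_⟩
  have := isProbabilityMeasure_whiteNoiseLaw (P := P) hm σ fun t => w t + ∑ i, v i * φ i t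
  have := Measure.isProbabilityMeasure_map (μ := (gaussianSequence σ v).prod P) hκm.aemeasurable
  refine measure_ext_of_restrict fun I => ?_
  have hIm : Measurable (I.restrict : (Icc (0 : ℝ) 1 → ℝ) → I → ℝ) := I.measurable_restrict
  refine ext_of_integral_cexp fun c => ?_
  rw [integral_map hIm.aemeasurable (continuous_cexp_sum c).aestronglyMeasurable,
    integral_map hIm.aemeasurable (continuous_cexp_sum c).aestronglyMeasurable]
  simp only [Finset.restrict_def]
  rw [integral_cexp_whiteNoiseLaw hW hm σ _ (fun j : I => (j : Icc (0 : ℝ) 1)) c,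
    integral_map hκm.aemeasurable (Measurable.aestronglyMeasurable (by fun_prop))]
  set a : Lp ℝ 2 unitVolume := ∑ j : I, c j • ioIndicator j with ha
  set b : Fin d → ℝ := fun i => ∑ j : I, c j * Φ i j with hb
  have hainner : ∀ i, inner ℝ a (hφ i).toLp = b i := fun i => by
    rw [ha, sum_inner]
    simp_rw [inner_smul_left, hΦinner]
    rfl
  -- The first component of z is the projection of a onto the complement of the φ_i, of squared norm
  -- ‖a‖² - Σ b_i². The missing Σ b_i² is supplied by the sequence observations.
  set z : Lp ℝ 2 unitVolume × Lp ℝ 2 P :=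
    ∑ j : I, c j • (ioIndicator j, (memLp_unitProcess hW j).toLp) -
      ∑ i, b i • ((hφ i).toLp, η i) with hz
  have hzmem : z ∈ wienerGraph hW := Submodule.sub_mem _ (sum_smul_mem_wienerGraph hW _ c)
    (Submodule.sum_mem _ fun i _ => Submodule.smul_mem _ _ (hη i))
  have hz1 : z.1 = a - ∑ i, b i • (hφ i).toLp := by
    rw [hz, Prod.fst_sub, Prod.fst_sum, Prod.fst_sum]
    rfl
  have hz2 : z.2 = ∑ j : I, c j • (memLp_unitProcess hW j).toLp - ∑ i, b i • η i := by
    rw [hz, Prod.snd_sub, Prod.snd_sum, Prod.snd_sum]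
    rfl
  have hnorm : ‖z.1‖ ^ 2 = ‖a‖ ^ 2 - ∑ i, b i ^ 2 := by
    rw [hz1, norm_sub_sq_real, inner_sum]
    simp_rw [inner_smul_right, hainner]
    rw [← real_inner_self_eq_norm_sq (∑ i, b i • (hφ i).toLp), hon.inner_sum]
    simp only [conj_trivial, ← sq]
    ring
  have hz2' : z.2 =ᵐ[P] fun ω => ∑ j : I, c j * unitProcess W j ω - ∑ i, b i * η i ω := by
    rw [hz2]
    filter_upwards [Lp.coeFn_sub (∑ j : I, c j • (memLp_unitProcess hW j).toLp)
      (∑ i, b i • η i), coeFn_sum_smul_unitProcess hW (fun j : I => (j : Icc (0 : ℝ) 1)) c,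
      coeFn_sum_smul η b] with ω h1 h2 h3
    rw [h1, Pi.sub_apply, h2, h3]
  have hlin : ∀ p : (Fin d → ℝ) × Ω, ∑ j : I, c j * κ p j =
      (∑ j : I, c j * ∫ u in (0 : ℝ)..j, w u) + ∑ i, b i * p.1 i +
        σ * (∑ j : I, c j * unitProcess W j p.2 - ∑ i, b i * η i p.2) := fun p => by
    have e1 : ∀ y : Fin d → ℝ, ∑ j : I, c j * ∑ i, y i * Φ i j = ∑ i, b i * y i := fun y => by
      simp_rw [Finset.mul_sum, hb, Finset.sum_mul]
      rw [Finset.sum_comm]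
      exact Finset.sum_congr rfl fun i _ => Finset.sum_congr rfl fun j _ => by ring
    have e2 : ∀ j : I, c j * κ p j = c j * (∫ u in (0 : ℝ)..j, w u) + c j * ∑ i, p.1 i * Φ i j +
        (σ * (c j * unitProcess W j p.2) - σ * (c j * ∑ i, η i p.2 * Φ i j)) := fun j => by
      simp only [hκ]
      rw [Finset.sum_congr rfl fun i _ => mul_comm (η i p.2) (Φ i j)]
      ring
    simp_rw [e2]
    rw [Finset.sum_add_distrib, Finset.sum_add_distrib, Finset.sum_sub_distrib, e1,
      ← Finset.mul_sum, ← Finset.mul_sum, e1 fun i => η i p.2]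
    ring
  have hmean : ∑ j : I, c j * ∫ u in (0 : ℝ)..j, (w u + ∑ i, v i * φ i u) =
      (∑ j : I, c j * ∫ u in (0 : ℝ)..j, w u) + ∑ i, b i * v i := by
    have e1 : ∀ j : I, ∫ u in (0 : ℝ)..j, (w u + ∑ i, v i * φ i u) =
        (∫ u in (0 : ℝ)..j, w u) + ∑ i, v i * Φ i j := fun j => by
      rw [intervalIntegral.integral_add (hint hw _)]
      · congr 1
        rw [intervalIntegral.integral_finsetSum fun i _ => (hint (hφ i) j).const_mul (v i)]
        exact Finset.sum_congr rfl fun i _ => intervalIntegral.integral_const_mul _ _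
      · have := IntervalIntegrable.sum (μ := volume) (a := 0) (b := ((j : Icc (0 : ℝ) 1) : ℝ))
          Finset.univ (f := fun i u => v i * φ i u) fun i _ => (hint (hφ i) j).const_mul (v i)
        exact this.congr fun u _ => Finset.sum_apply u _ _
    simp_rw [e1, mul_add, Finset.sum_add_distrib, hb, Finset.mul_sum, Finset.sum_mul]
    congr 1
    rw [Finset.sum_comm]
    exact Finset.sum_congr rfl fun i _ => Finset.sum_congr rfl fun j _ => by ring
  set E : ℝ := ∑ j : I, c j * ∫ u in (0 : ℝ)..j, w u with hE
  have hprod : ∫ p, Complex.exp ((∑ j : I, c j * κ p j : ℝ) * Complex.I)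
      ∂(gaussianSequence σ v).prod P =
      Complex.exp (E * Complex.I) * ((∫ x, Complex.exp ((∑ i, b i * x i : ℝ) * Complex.I)
        ∂gaussianSequence σ v) * ∫ ω, Complex.exp ((σ * (∑ j : I, c j * unitProcess W j ω -
          ∑ i, b i * η i ω) : ℝ) * Complex.I) ∂P) := by
    rw [← integral_prod_mul, ← integral_const_mul]
    refine integral_congr_ae (ae_of_all _ fun p => ?_)
    simp only
    rw [hlin, ← Complex.exp_add, ← Complex.exp_add]
    congr 1
    push_cast
    ring
  have hnoise : ∫ ω, Complex.exp ((σ * (∑ j : I, c j * unitProcess W j ω -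
      ∑ i, b i * η i ω) : ℝ) * Complex.I) ∂P = Complex.exp (-(σ ^ 2 / 2 * ‖z.1‖ ^ 2 : ℝ)) := by
    rw [← integral_cexp_smul_of_mem_wienerGraph hW σ hzmem]
    refine integral_congr_ae ?_
    filter_upwards [hz2'] with ω hω
    rw [hω]
  rw [hprod, hnoise, ← gaussianPi_eq_gaussianSequence, integral_cexp_gaussianPi, hmean, hnorm,
    ← Complex.exp_add, ← Complex.exp_add]
  congr 1
  push_cast
  ring

/-- The point `i/D` of the unit interval. -/
noncomputable def gridPoint (D : ℕ) (i : ℕ) (h : i ≤ D) : Icc (0 : ℝ) 1 :=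
  ⟨i / D, by positivity, by
    rcases D.eq_zero_or_pos with rfl | hD
    · simp
    · rw [div_le_one (by positivity)]
      exact_mod_cast h⟩

theorem coe_gridPoint {D i : ℕ} (h : i ≤ D) : (gridPoint D i h : ℝ) = i / D := rfl

/-- The normalised increments of a path over the `D` cells of a grid. -/
noncomputable def gridIncrement (D : ℕ) (x : Icc (0 : ℝ) 1 → ℝ) (i : Fin D) : ℝ :=
  √D * (x (gridPoint D (i + 1) i.2) - x (gridPoint D i i.2.le))

theorem measurable_gridIncrement (D : ℕ) : Measurable (gridIncrement D) :=
  measurable_pi_lambda _ fun i => by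
    unfold gridIncrement
    fun_prop

/-- The normalised means of a function over the `D` cells of a grid. -/
noncomputable def cellMean (D : ℕ) (f : ℝ → ℝ) (i : Fin D) : ℝ :=
  √D * ∫ u in (i / D : ℝ)..((i + 1) / D), f u

/-- These are the normalised indicators of the cells; orthonormality is what makes the grid
increments independent with variance σ². -/
theorem orthonormal_ioIndicator_sub (D : ℕ) :
    Orthonormal ℝ fun i : Fin D => √D • (ioIndicator (gridPoint D (i + 1) i.2) -
      ioIndicator (gridPoint D i i.2.le)) := by
  rw [orthonormal_iff_ite]
  intro i j
  have hD : (0 : ℝ) < D := by exact_mod_cast i.pos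
  have hmin : ∀ a b : ℝ, min (a / D) (b / D) = min a b / D := fun a b =>
    min_div_div_right hD.le a b
  simp only [inner_smul_left, inner_smul_right, inner_sub_left, inner_sub_right,
    inner_ioIndicator_ioIndicator, coe_gridPoint, conj_trivial, hmin]
  rw [← mul_sub, ← mul_assoc, Real.mul_self_sqrt hD.le]
  rcases lt_trichotomy i j with h | h | h
  · have h' : ((i : ℕ) : ℝ) + 1 ≤ j := by exact_mod_cast h
    rw [if_neg h.ne]
    push_cast
    rw [min_eq_left (by linarith), min_eq_left (by linarith), min_eq_left (by linarith),
      min_eq_left (by linarith)]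
    ring
  · subst h
    rw [if_pos rfl]
    push_cast
    rw [min_self, min_self, min_eq_left (by linarith), min_eq_right (by linarith)]
    field_simp
    ring
  · have h' : ((j : ℕ) : ℝ) + 1 ≤ i := by exact_mod_cast h
    rw [if_neg h.ne']
    push_cast
    rw [min_eq_right (by linarith), min_eq_right (by linarith), min_eq_right (by linarith),
      min_eq_right (by linarith)]
    ring

/-- The normalised increments of the white noise path follow the Gaussian sequence model. -/
theorem map_gridIncrement_whiteNoiseLaw (hW : IsPreBrownianReal W P) (hm : ∀ t, Measurable (W t))
    (D : ℕ) (σ : ℝ) {f : ℝ → ℝ} (hf : MemLp f 2 unitVolume) :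
    (whiteNoiseLaw P W σ f).map (gridIncrement D) = gaussianSequence σ (cellMean D f) := by
  have hprob := hW.isGaussianProcess.isProbabilityMeasure
  have := isProbabilityMeasure_whiteNoiseLaw (P := P) hm σ f
  have := Measure.isProbabilityMeasure_map (μ := whiteNoiseLaw P W σ f)
    (measurable_gridIncrement D).aemeasurable
  refine ext_of_integral_cexp fun c => ?_
  rw [integral_map (measurable_gridIncrement D).aemeasurable
    (continuous_cexp_sum c).aestronglyMeasurable, ← gaussianPi_eq_gaussianSequence,
    integral_cexp_gaussianPi]
  -- Each increment uses two times, a right and a left endpoint; the sum type lists both, so that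
  -- the formula for finitely many path values applies.
  set τ : Fin D ⊕ Fin D → Icc (0 : ℝ) 1 := Sum.elim (fun i => gridPoint D (i + 1) i.2)
    fun i => gridPoint D i i.2.le with hτ
  set e : Fin D ⊕ Fin D → ℝ := Sum.elim (fun i => c i * √D) fun i => -(c i * √D) with he
  have h1 : ∀ x : Icc (0 : ℝ) 1 → ℝ, ∑ i, c i * gridIncrement D x i = ∑ j, e j * x (τ j) :=
    fun x => by
      rw [Fintype.sum_sum_type, ← Finset.sum_add_distrib]
      refine Finset.sum_congr rfl fun i _ => ?_
      simp only [gridIncrement, hτ, he, Sum.elim_inl, Sum.elim_inr]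
      ring
  have h2 : ∑ j, e j * ∫ u in (0 : ℝ)..τ j, f u = ∑ i, c i * cellMean D f i := by
    rw [← h1 fun t => ∫ u in (0 : ℝ)..t, f u]
    refine Finset.sum_congr rfl fun i _ => ?_
    have hint : ∀ t : Icc (0 : ℝ) 1, IntervalIntegrable f volume 0 t := fun t => by
      rw [intervalIntegrable_iff_integrableOn_Icc_of_le t.2.1]
      exact (hf.integrable one_le_two).mono_measure
        (Measure.restrict_mono (Icc_subset_Icc_right t.2.2) le_rfl)
    rw [gridIncrement, cellMean, intervalIntegral.integral_interval_sub_left (hint _) (hint _),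
      coe_gridPoint, coe_gridPoint]
    push_cast
    rfl
  have h3 : ∑ j, e j • ioIndicator (τ j) = ∑ i, c i • (√D • (ioIndicator
      (gridPoint D (i + 1) i.2) - ioIndicator (gridPoint D i i.2.le))) := by
    rw [Fintype.sum_sum_type, ← Finset.sum_add_distrib]
    refine Finset.sum_congr rfl fun i _ => ?_
    simp only [hτ, he, Sum.elim_inl, Sum.elim_inr, smul_sub, smul_smul, neg_smul]
    rw [sub_eq_add_neg]
  simp_rw [h1]
  rw [integral_cexp_whiteNoiseLaw hW hm, h2, h3, ← real_inner_self_eq_norm_sq,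
    (orthonormal_ioIndicator_sub D).inner_sum]
  simp only [conj_trivial, ← sq]

end Reductions

/-! ### Finite differences -/

section Differences

theorem rthDiff_eq_fwdDiff (r : ℕ) (f : ℝ → ℝ) (u t : ℝ) :
    rthDiff r f u t = (-1) ^ r * (fwdDiff u)^[r] f t := by
  rw [fwdDiff_iter_eq_sum_shift, rthDiff, Finset.mul_sum]
  refine Finset.sum_congr rfl fun k hk => ?_
  have hk' : k ≤ r := Nat.lt_succ_iff.1 (Finset.mem_range.1 hk)
  obtain ⟨m, rfl⟩ := Nat.exists_eq_add_of_le hk'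
  rw [Nat.add_sub_cancel_left, zsmul_eq_mul, nsmul_eq_mul, pow_add]
  have h : ((-1 : ℝ) ^ m) * (-1) ^ m = 1 := by rw [← mul_pow]; norm_num
  push_cast
  linear_combination (-(((k + m).choose k : ℝ) * (-1) ^ k * f (t + k * u))) * h

/-- Induction on r: by the mean value inequality one difference with step u trades one derivative
for a factor u. -/
theorem abs_fwdDiff_iter_le {u : ℝ} (hu : 0 ≤ u) (r : ℕ) : ∀ {f : ℝ → ℝ} {M : ℝ},
    ContDiff ℝ r f → (∀ x, |iteratedDeriv r f x| ≤ M) → ∀ t, |(fwdDiff u)^[r] f t| ≤ M * u ^ r := by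
  induction r with
  | zero =>
    intro f M _ hM t
    simpa using hM t
  | succ r ih =>
    intro f M hf hM t
    have hfr : ContDiff ℝ r f := hf.of_le (by exact_mod_cast r.le_succ)
    have hshift : ContDiff ℝ r fun x => f (x + u) := hfr.comp (by fun_prop)
    have hg : fwdDiff u f = (fun x => f (x + u)) - f := by
      ext x
      simp [fwdDiff]
    have h1 : ∀ x, |iteratedDeriv r (fwdDiff u f) x| ≤ M * u := fun x => by
      rw [hg, iteratedDeriv_sub hshift.contDiffAt hfr.contDiffAt, iteratedDeriv_comp_add_const]
      have h2 := Convex.norm_image_sub_le_of_norm_deriv_le (f := iteratedDeriv r f) (s := univ)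
        (x := x) (y := x + u) (C := M)
        (fun y _ => (hf.differentiable_iteratedDeriv r (by exact_mod_cast r.lt_succ_self)) y)
        (fun y _ => by rw [← iteratedDeriv_succ]; exact hM y) convex_univ trivial trivial
      simpa [abs_of_nonneg hu] using h2
    have h3 := ih (f := fwdDiff u f) (hg ▸ hshift.sub hfr) h1 t
    rw [Function.iterate_succ_apply, pow_succ']
    linarith

theorem exists_abs_rthDiff_le (r : ℕ) {φ : ℝ → ℝ} (hφ : ContDiff ℝ r φ) (hs : HasCompactSupport φ) :
    ∃ M : ℝ, 0 ≤ M ∧ ∀ h t, 0 ≤ h → |rthDiff r φ h t| ≤ M * h ^ r := by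
  obtain ⟨M, hM⟩ := (hφ.continuous_iteratedFDeriv le_rfl).bounded_above_of_compact_support
    (hs.iteratedFDeriv r)
  have hM' : ∀ x, |iteratedDeriv r φ x| ≤ M := fun x => by
    rw [← Real.norm_eq_abs, ← norm_iteratedFDeriv_eq_norm_iteratedDeriv]
    exact hM x
  refine ⟨M, (abs_nonneg _).trans (hM' 0), fun h t hh => ?_⟩
  rw [rthDiff_eq_fwdDiff, abs_mul, abs_pow, abs_neg, abs_one, one_pow, one_mul]
  exact abs_fwdDiff_iter_le hh r hφ hM' t

/-- The margin 1/8 at both ends keeps r-th differences with small steps supported inside (0,1), so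
that differences of neighbouring translates remain disjoint. -/
theorem exists_bump (r : ℕ) : ∃ φ : ℝ → ℝ, ContDiff ℝ r φ ∧ HasCompactSupport φ ∧
    (∀ x, x ∉ Ioo (1 / 8 : ℝ) (7 / 8) → φ x = 0) ∧ ∫ x, φ x ^ 2 = 1 := by
  obtain ⟨b, hin, hout⟩ : ∃ b : ContDiffBump (1 / 2 : ℝ), b.rIn = 1 / 8 ∧ b.rOut = 1 / 4 :=
    ⟨⟨1 / 8, 1 / 4, by norm_num, by norm_num⟩, rfl, rfl⟩
  have hi : Integrable fun x => b x ^ 2 := by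
    refine Continuous.integrable_of_hasCompactSupport (b.continuous.pow 2) ?_
    have := b.hasCompactSupport.mul_right (f' := b)
    simpa only [sq] using! this
  have hpos : 0 < ∫ x, b x ^ 2 := by
    rw [integral_pos_iff_support_of_nonneg (fun x => sq_nonneg _) hi]
    refine lt_of_lt_of_le ?_ (measure_mono (show Metric.ball (1 / 2 : ℝ) (1 / 8) ⊆ _ from ?_))
    · rw [Real.volume_ball]
      norm_num
    · intro x hx
      have := b.one_of_mem_closedBall (hin ▸ Metric.ball_subset_closedBall hx)
      simp [this]
  set c := (√(∫ x, b x ^ 2))⁻¹ with hc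
  refine ⟨fun x => c * b x, contDiff_const.mul b.contDiff, b.hasCompactSupport.mul_left,
    fun x hx => ?_, ?_⟩
  · suffices h : b.rOut ≤ dist x (1 / 2) by
      change c * b x = 0
      rw [b.zero_of_le_dist h, mul_zero]
    rw [hout, Real.dist_eq]
    by_contra! h
    rw [abs_lt] at h
    exact hx ⟨by linarith, by linarith⟩
  · simp_rw [mul_pow]
    rw [integral_const_mul, hc, inv_pow, Real.sq_sqrt hpos.le, inv_mul_cancel₀ hpos.ne']

end Differences

/-! ### Sums of rescaled bumps -/

section Bumps

variable {p : ℝ}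

theorem lintegral_comp_mul_sub {g : ℝ → ℝ≥0∞} (hg : Measurable g) {N : ℝ} (hN : 0 < N) (x : ℝ) :
    ∫⁻ t, g (N * t - x) = ENNReal.ofReal N⁻¹ * ∫⁻ t, g t := by
  have h1 := lintegral_map (μ := volume) (f := fun y => g (y - x)) (g := fun t => N * t)
    (by fun_prop) (by fun_prop)
  rw [← h1, Real.map_volume_mul_left hN.ne', lintegral_smul_measure, lintegral_sub_right_eq_self,
    abs_of_pos (inv_pos.2 hN), smul_eq_mul]

/-- At each point at most one summand is nonzero, so the p-th power passes through the sum. The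
scale N may vary with j, which later allows a coarse bump next to fine ones. -/
theorem lintegral_enorm_sum_rpow_of_disjoint {J : Type*} [Fintype J] {ψ : ℝ → ℝ}
    (hψ : Measurable ψ) (hp : 0 < p) {N : J → ℝ} (hN : ∀ j, 0 < N j) (x a : J → ℝ)
    (hdisj : ∀ t j j', j ≠ j' → ψ (N j * t - x j) = 0 ∨ ψ (N j' * t - x j') = 0) :
    ∫⁻ t, ‖∑ j, a j * ψ (N j * t - x j)‖ₑ ^ p =
      ENNReal.ofReal (∑ j, |a j| ^ p / N j) * ∫⁻ t, ‖ψ t‖ₑ ^ p := by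
  have h1 : ∀ t, ‖∑ j, a j * ψ (N j * t - x j)‖ₑ ^ p =
      ∑ j, ‖a j‖ₑ ^ p * ‖ψ (N j * t - x j)‖ₑ ^ p := fun t => by
    by_cases h : ∃ j, ψ (N j * t - x j) ≠ 0
    · obtain ⟨j, hj⟩ := h
      have h0 : ∀ j' ≠ j, ψ (N j' * t - x j') = 0 := fun j' hj' =>
        (hdisj t j' j hj').resolve_right hj
      rw [Fintype.sum_eq_single j fun j' hj' => by rw [h0 j' hj', mul_zero],
        Fintype.sum_eq_single j fun j' hj' => by
          rw [h0 j' hj', enorm_zero, ENNReal.zero_rpow_of_pos hp, mul_zero],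
        enorm_mul, ENNReal.mul_rpow_of_nonneg _ _ hp.le]
    · push Not at h
      simp [h, ENNReal.zero_rpow_of_pos hp]
  simp_rw [h1]
  rw [lintegral_finsetSum _ fun j _ => by fun_prop, ENNReal.ofReal_sum_of_nonneg
    fun j _ => div_nonneg (Real.rpow_nonneg (abs_nonneg _) _) (hN j).le, Finset.sum_mul]
  refine Finset.sum_congr rfl fun j _ => ?_
  rw [lintegral_const_mul _ (by fun_prop),
    lintegral_comp_mul_sub (g := fun y => ‖ψ y‖ₑ ^ p) (by fun_prop) (hN j), ← mul_assoc,
    div_eq_mul_inv, ENNReal.ofReal_mul (Real.rpow_nonneg (abs_nonneg _) _),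
    Real.enorm_eq_ofReal_abs, ENNReal.ofReal_rpow_of_nonneg (abs_nonneg _) hp.le]

theorem eLpNorm_ofReal_eq (hp : 1 ≤ p) (f : ℝ → ℝ) (μ : Measure ℝ) :
    eLpNorm f (ENNReal.ofReal p) μ = (∫⁻ t, ‖f t‖ₑ ^ p ∂μ) ^ (1 / p) := by
  have hp0 : 0 < p := by linarith
  rw [eLpNorm_eq_lintegral_rpow_enorm_toReal (by simpa using hp0) ENNReal.ofReal_ne_top,
    ENNReal.toReal_ofReal hp0.le]

theorem eLpNorm_sum_of_disjoint {J : Type*} [Fintype J] {ψ : ℝ → ℝ} (hψ : Measurable ψ)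
    (hp : 1 ≤ p) {N : J → ℝ} (hN : ∀ j, 0 < N j) (x a : J → ℝ)
    (hdisj : ∀ t j j', j ≠ j' → ψ (N j * t - x j) = 0 ∨ ψ (N j' * t - x j') = 0) :
    eLpNorm (fun t => ∑ j, a j * ψ (N j * t - x j)) (ENNReal.ofReal p) volume =
      ENNReal.ofReal ((∑ j, |a j| ^ p / N j) ^ (1 / p)) *
        eLpNorm ψ (ENNReal.ofReal p) volume := by
  have hp0 : 0 ≤ 1 / p := by positivity
  rw [eLpNorm_ofReal_eq hp, eLpNorm_ofReal_eq hp,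
    lintegral_enorm_sum_rpow_of_disjoint hψ (by linarith) hN x a hdisj,
    ENNReal.mul_rpow_of_nonneg _ _ hp0, ENNReal.ofReal_rpow_of_nonneg
      (Finset.sum_nonneg fun j _ => div_nonneg (Real.rpow_nonneg (abs_nonneg _) _) (hN j).le) hp0]

/-- The sum of the bumps `φ(N t - i)`, `i < N`, with coefficients `c`. -/
noncomputable def bumpSum (φ : ℝ → ℝ) (N : ℕ) {J : Type*} [Fintype J] (e : J → ℕ) (c : J → ℝ)
    (t : ℝ) : ℝ :=
  ∑ j, c j * φ (N * t - e j)

theorem eq_zero_or_eq_zero_of_ne {ψ : ℝ → ℝ} (hψ : ∀ x, x ∉ Ioo (0 : ℝ) 1 → ψ x = 0) {m n : ℕ}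
    (h : m ≠ n) (t : ℝ) : ψ (t - m) = 0 ∨ ψ (t - n) = 0 := by
  by_contra! hc
  have h1 : t - m ∈ Ioo (0 : ℝ) 1 := by_contra fun h' => hc.1 (hψ _ h')
  have h2 : t - n ∈ Ioo (0 : ℝ) 1 := by_contra fun h' => hc.2 (hψ _ h')
  have h3 : (m : ℝ) < n + 1 := by linarith [h1.1, h2.2]
  have h4 : (n : ℝ) < m + 1 := by linarith [h1.2, h2.1]
  have h5 : m < n + 1 := by exact_mod_cast h3
  have h6 : n < m + 1 := by exact_mod_cast h4
  omega

theorem eLpNorm_bumpSum {J : Type*} [Fintype J] {ψ : ℝ → ℝ} (hψ : Measurable ψ)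
    (hψ0 : ∀ x, x ∉ Ioo (0 : ℝ) 1 → ψ x = 0) (hp : 1 ≤ p) {N : ℕ} (hN : 0 < N) {e : J → ℕ}
    (he : Function.Injective e) (c : J → ℝ) :
    eLpNorm (bumpSum ψ N e c) (ENNReal.ofReal p) volume =
      ENNReal.ofReal ((∑ j, |c j| ^ p / N) ^ (1 / p)) * eLpNorm ψ (ENNReal.ofReal p) volume :=
  eLpNorm_sum_of_disjoint hψ hp (N := fun _ => (N : ℝ)) (fun _ => by exact_mod_cast hN)
    (fun j => (e j : ℝ)) c fun t _ _ hj => eq_zero_or_eq_zero_of_ne hψ0 (he.ne hj) _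

theorem rthDiff_bumpSum (r : ℕ) (φ : ℝ → ℝ) (N : ℕ) {J : Type*} [Fintype J] (e : J → ℕ)
    (c : J → ℝ) (u t : ℝ) :
    rthDiff r (bumpSum φ N e c) u t = bumpSum (rthDiff r φ (N * u)) N e c t := by
  simp only [rthDiff, bumpSum, Finset.mul_sum]
  rw [Finset.sum_comm]
  refine Finset.sum_congr rfl fun j _ => Finset.sum_congr rfl fun k _ => ?_
  rw [show (N : ℝ) * (t + k * u) - e j = N * t - e j + k * (N * u) by ring]
  ring

theorem continuous_rthDiff (r : ℕ) {f : ℝ → ℝ} (hf : Continuous f) (u : ℝ) :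
    Continuous (rthDiff r f u) := by
  unfold rthDiff
  fun_prop

theorem continuous_bumpSum {φ : ℝ → ℝ} (hφ : Continuous φ) (N : ℕ) {J : Type*} [Fintype J]
    (e : J → ℕ) (c : J → ℝ) : Continuous (bumpSum φ N e c) := by
  unfold bumpSum
  fun_prop

theorem eLpNorm_rthDiff_le (hp : 1 ≤ p) (r : ℕ) {f : ℝ → ℝ} (hf : Continuous f) (u : ℝ) :
    eLpNorm (rthDiff r f u) (ENNReal.ofReal p) volume ≤
      2 ^ r * eLpNorm f (ENNReal.ofReal p) volume := by
  have hp' : 1 ≤ ENNReal.ofReal p := by simpa using hp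
  have h1 : rthDiff r f u = ∑ k ∈ Finset.range (r + 1),
      ((r.choose k : ℝ) * (-1) ^ k) • fun t => f (t + k * u) := by
    ext t
    simp [rthDiff]
  rw [h1]
  refine (eLpNorm_sum_le (fun k _ => ?_) hp').trans ?_
  · exact (Continuous.aestronglyMeasurable (by fun_prop)).const_smul _
  have h2 : ∀ k : ℕ, eLpNorm (fun t => f (t + k * u)) (ENNReal.ofReal p) volume =
      eLpNorm f (ENNReal.ofReal p) volume := fun k =>
    eLpNorm_comp_measurePreserving hf.aestronglyMeasurable
      (measurePreserving_add_right volume ((k : ℝ) * u))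
  simp_rw [eLpNorm_const_smul, h2, ← Finset.sum_mul]
  gcongr
  refine le_of_eq ?_
  have h3 := Nat.sum_range_choose r
  have h4 : (2 : ℝ≥0∞) ^ r = ((2 ^ r : ℕ) : ℝ≥0∞) := by push_cast; rfl
  rw [h4, ← h3, Nat.cast_sum]
  refine Finset.sum_congr rfl fun k _ => ?_
  rw [enorm_mul, enorm_pow, enorm_neg, enorm_one, one_pow, mul_one]
  simp

/-- The differences of a sum of bumps. -/
theorem exists_diffNorm_bumpSum_le (hp : 1 ≤ p) (r : ℕ) {φ : ℝ → ℝ} (hφ : ContDiff ℝ r φ)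
    (hs : HasCompactSupport φ) (hφ0 : ∀ x, x ∉ Ioo (1 / 8 : ℝ) (7 / 8) → φ x = 0) :
    ∃ C : ℝ, 0 ≤ C ∧ ∀ {J : Type} [Fintype J] {e : J → ℕ}, Function.Injective e →
      ∀ (N : ℕ) (c : J → ℝ) (u : ℝ), 0 < N → 0 < u →
        diffNorm r p (bumpSum φ N e c) u ≤
          ENNReal.ofReal (C * (∑ j, |c j| ^ p / N) ^ (1 / p) * min 1 ((N * u) ^ r)) := by
  obtain ⟨M, hM0, hM⟩ := exists_abs_rthDiff_le r hφ hs
  have hp0 : 0 < p := by linarith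
  have hφfin : eLpNorm φ (ENNReal.ofReal p) volume ≠ ∞ :=
    (hφ.continuous.memLp_of_hasCompactSupport hs).2.ne
  set F := (eLpNorm φ (ENNReal.ofReal p) volume).toReal with hF
  -- M serves for small steps, where the differences of the bumps stay disjoint and smoothness gives
  -- (Nu)^r. The other term serves for large steps, where the bound by 2^r times the norm is used;
  -- there (8r+8)Nu > 1, so (8r+8)^r compensates the minimum.
  set C := M + 2 ^ r * F * (8 * r + 8) ^ r with hC
  have hF0 : 0 ≤ F := ENNReal.toReal_nonneg
  have hφ0' : ∀ x, x ∉ Ioo (0 : ℝ) 1 → φ x = 0 := fun x hx => hφ0 x fun h =>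
    hx ⟨by linarith [h.1], by linarith [h.2]⟩
  refine ⟨C, by positivity, fun {J} _ {e} he N c u hN hu => ?_⟩
  set S := (∑ j, |c j| ^ p / N) ^ (1 / p) with hS
  have hS0 : 0 ≤ S := by positivity
  have hN' : (0 : ℝ) < N := by exact_mod_cast hN
  refine (eLpNorm_mono_measure _ Measure.restrict_le_self).trans ?_
  by_cases h : (8 * r + 8) * (N * u) ≤ 1
  · have e1 : rthDiff r (bumpSum φ N e c) u = bumpSum (rthDiff r φ (N * u)) N e c :=
      funext fun t => rthDiff_bumpSum r φ N e c u t
    have hsupp : ∀ x, x ∉ Ioo (0 : ℝ) 1 → rthDiff r φ (N * u) x = 0 := fun x hx => by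
      refine Finset.sum_eq_zero fun k hk => ?_
      rw [hφ0, mul_zero]
      intro h2
      have hk' : (k : ℝ) ≤ r := by exact_mod_cast Nat.lt_succ_iff.1 (Finset.mem_range.1 hk)
      have h3 : (k : ℝ) * (N * u) ≤ r * (N * u) := by gcongr
      have h4 : 0 ≤ (k : ℝ) * (N * u) := by positivity
      have h5 : 0 ≤ N * u := by positivity
      exact hx ⟨by linarith [h2.1], by linarith [h2.2]⟩
    rw [e1, eLpNorm_bumpSum (continuous_rthDiff r hφ.continuous _).measurable hsupp hp hN he]
    have h1 : eLpNorm (rthDiff r φ (N * u)) (ENNReal.ofReal p) volume ≤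
        ENNReal.ofReal (M * (N * u) ^ r) := by
      rw [← eLpNorm_restrict_eq_of_support_subset (s := Ioo (0 : ℝ) 1)
        (fun x hx => by_contra fun h' => hx (hsupp x h'))]
      refine (eLpNorm_le_of_ae_bound (C := M * (N * u) ^ r) (ae_of_all _ fun x =>
        hM _ x (by positivity))).trans ?_
      simp
    calc _ ≤ ENNReal.ofReal S * ENNReal.ofReal (M * (N * u) ^ r) := by gcongr
      _ = ENNReal.ofReal (M * S * (N * u) ^ r) := by
        rw [← ENNReal.ofReal_mul hS0]
        congr 1
        ring
      _ ≤ _ := by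
        have h6 : (N * u) ^ r ≤ 1 := pow_le_one₀ (by positivity) (by nlinarith [mul_pos hN' hu])
        rw [min_eq_right h6]
        refine ENNReal.ofReal_le_ofReal ?_
        gcongr
        rw [hC]
        have : 0 ≤ 2 ^ r * F * (8 * r + 8 : ℝ) ^ r := by positivity
        linarith
  · refine (eLpNorm_rthDiff_le hp r (continuous_bumpSum hφ.continuous N e c) u).trans ?_
    rw [eLpNorm_bumpSum hφ.continuous.measurable hφ0' hp hN he, ← ENNReal.ofReal_toReal hφfin,
      ← ENNReal.ofReal_mul hS0, show (2 : ℝ≥0∞) ^ r = ENNReal.ofReal (2 ^ r) by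
        rw [ENNReal.ofReal_pow (by norm_num), ENNReal.ofReal_ofNat],
      ← ENNReal.ofReal_mul (by positivity)]
    refine ENNReal.ofReal_le_ofReal ?_
    push Not at h
    have h1 : (1 : ℝ) ≤ (8 * r + 8) ^ r * min 1 ((N * u) ^ r) := by
      rcases min_choice (1 : ℝ) ((N * u) ^ r) with h2 | h2
      · rw [h2, mul_one]
        exact one_le_pow₀ (by linarith [(Nat.cast_nonneg r : (0 : ℝ) ≤ r)])
      · rw [h2, ← mul_pow]
        exact one_le_pow₀ h.le
    have h2 : 0 ≤ min 1 ((N * u) ^ r) := by positivity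
    calc 2 ^ r * (S * F) = 2 ^ r * F * S * 1 := by ring
      _ ≤ 2 ^ r * F * S * ((8 * r + 8) ^ r * min 1 ((N * u) ^ r)) := by gcongr
      _ = 0 + 2 ^ r * F * (8 * r + 8) ^ r * S * min 1 ((N * u) ^ r) := by ring
      _ ≤ M * S * min 1 ((N * u) ^ r) + 2 ^ r * F * (8 * r + 8) ^ r * S * min 1 ((N * u) ^ r) := by
        gcongr
        positivity
      _ = _ := by
        rw [hC]
        ring

end Bumps

/-! ### Bounds on the Besov norm -/

section Besov

variable {r : ℕ} {s p : ℝ} {q : ℝ≥0∞}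

theorem min_one_pow_le_rpow (hs : 0 < s) (hr : s < r) {x : ℝ} (hx : 0 < x) :
    min 1 (x ^ r) ≤ x ^ s := by
  rcases le_total x 1 with h | h
  · refine (min_le_right _ _).trans ?_
    rw [← Real.rpow_natCast]
    exact Real.rpow_le_rpow_of_exponent_ge hx h hr.le
  · exact (min_le_left _ _).trans (Real.one_le_rpow h hs.le)

theorem lintegral_rpow_Ioc {a c : ℝ} (ha : 0 < a) (hc : 0 < c) :
    ∫⁻ u in Ioc 0 c, ENNReal.ofReal (u ^ (a - 1)) = ENNReal.ofReal (c ^ a / a) := by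
  have hi : IntervalIntegrable (fun u : ℝ => u ^ (a - 1)) volume 0 c :=
    intervalIntegral.intervalIntegrable_rpow' (by linarith)
  rw [← ofReal_integral_eq_lintegral_ofReal hi.1, ← intervalIntegral.integral_of_le hc.le,
    integral_rpow (Or.inl (by linarith)), sub_add_cancel, Real.zero_rpow ha.ne', sub_zero]
  exact (ae_restrict_iff' measurableSet_Ioc).2 (ae_of_all _ fun u hu => Real.rpow_nonneg hu.1.le _)

theorem lintegral_rpow_Ioi {a c : ℝ} (ha : 0 < a) (hc : 0 < c) :
    ∫⁻ u in Ioi c, ENNReal.ofReal (u ^ (-a - 1)) = ENNReal.ofReal (c ^ (-a) / a) := by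
  have hi := integrableOn_Ioi_rpow_of_lt (a := -a - 1) (by linarith) hc
  rw [← ofReal_integral_eq_lintegral_ofReal hi, integral_Ioi_rpow_of_lt (by linarith) hc,
    sub_add_cancel, neg_div_neg_eq]
  exact (ae_restrict_iff' measurableSet_Ioi).2
    (ae_of_all _ fun u hu => Real.rpow_nonneg (hc.le.trans (le_of_lt hu)) _)

/-- Split at u = 1/N: below, (Nu)^r/u^s is integrable because r > s; above, u^{-s} is because s > 0.
By scaling both parts are multiples of N^{sq}. -/
theorem lintegral_min_one_pow_le (hs : 0 < s) (hr : s < r) {q : ℝ} (hq : 0 < q) {N : ℝ}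
    (hN : 0 < N) :
    ∫⁻ u in Ioi (0 : ℝ), ENNReal.ofReal ((min 1 ((N * u) ^ r) / u ^ s) ^ q / u) ≤
      ENNReal.ofReal ((1 / ((r - s) * q) + 1 / (s * q)) * (N ^ s) ^ q) := by
  have hrs : 0 < (r - s) * q := mul_pos (by linarith) hq
  have hsq : 0 < s * q := mul_pos hs hq
  have hc : 0 < N⁻¹ := inv_pos.2 hN
  have h0 : ∀ u : ℝ, 0 < u → 0 ≤ min 1 ((N * u) ^ r) / u ^ s := fun u hu => by positivity
  rw [← Ioc_union_Ioi_eq_Ioi hc.le, lintegral_union measurableSet_Ioi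
    (Set.disjoint_left.2 fun x hx hx' => not_lt.2 hx.2 hx')]
  have h1 : ∫⁻ u in Ioc 0 N⁻¹, ENNReal.ofReal ((min 1 ((N * u) ^ r) / u ^ s) ^ q / u) ≤
      ENNReal.ofReal (1 / ((r - s) * q) * (N ^ s) ^ q) := by
    calc _ ≤ ∫⁻ u in Ioc 0 N⁻¹, ENNReal.ofReal (N ^ (r * q)) *
          ENNReal.ofReal (u ^ ((r - s) * q - 1)) := by
          refine setLIntegral_mono' measurableSet_Ioc fun u hu => ?_
          have hu0 : 0 < u := hu.1
          rw [← ENNReal.ofReal_mul (by positivity)]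
          refine ENNReal.ofReal_le_ofReal ?_
          calc (min 1 ((N * u) ^ r) / u ^ s) ^ q / u ≤ ((N * u) ^ r / u ^ s) ^ q / u := by
                gcongr
                exact min_le_right _ _
            _ = N ^ (r * q) * u ^ ((r - s) * q - 1) := by
                rw [← Real.rpow_natCast, Real.mul_rpow hN.le hu0.le, mul_div_assoc,
                  ← Real.rpow_sub hu0, Real.mul_rpow (by positivity) (by positivity),
                  ← Real.rpow_mul hN.le, ← Real.rpow_mul hu0.le, Real.rpow_sub_one hu0.ne',
                  mul_div_assoc]
      _ = ENNReal.ofReal (1 / ((r - s) * q) * (N ^ s) ^ q) := by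
          rw [lintegral_const_mul' _ _ ENNReal.ofReal_ne_top, lintegral_rpow_Ioc hrs hc,
            ← ENNReal.ofReal_mul (by positivity), Real.inv_rpow hN.le, ← Real.rpow_neg hN.le,
            ← Real.rpow_mul hN.le, ← mul_div_assoc, ← Real.rpow_add hN]
          congr 1
          rw [show (r : ℝ) * q + -((r - s) * q) = s * q by ring]
          ring
  have h2 : ∫⁻ u in Ioi N⁻¹, ENNReal.ofReal ((min 1 ((N * u) ^ r) / u ^ s) ^ q / u) ≤
      ENNReal.ofReal (1 / (s * q) * (N ^ s) ^ q) := by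
    calc _ ≤ ∫⁻ u in Ioi N⁻¹, ENNReal.ofReal (u ^ (-(s * q) - 1)) := by
          refine setLIntegral_mono' measurableSet_Ioi fun u hu => ?_
          have hu0 : 0 < u := hc.trans hu
          refine ENNReal.ofReal_le_ofReal ?_
          calc (min 1 ((N * u) ^ r) / u ^ s) ^ q / u ≤ (1 / u ^ s) ^ q / u := by
                gcongr
                exact min_le_left _ _
            _ = u ^ (-(s * q) - 1) := by
                rw [one_div, ← Real.rpow_neg hu0.le, ← Real.rpow_mul hu0.le,
                  Real.rpow_sub_one hu0.ne', neg_mul]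
      _ = ENNReal.ofReal (1 / (s * q) * (N ^ s) ^ q) := by
          rw [lintegral_rpow_Ioi hsq hc, Real.rpow_neg hc.le, Real.inv_rpow hN.le, inv_inv,
            ← Real.rpow_mul hN.le]
          congr 1
          ring
  refine (add_le_add h1 h2).trans ?_
  rw [← ENNReal.ofReal_add (by positivity) (by positivity), ← add_mul]

/-- A function whose differences are governed by two scales `N₁` and `N₂`. -/
theorem exists_besovNorm_le (hs : 0 < s) (hr : s < r) (p : ℝ) (hq : 1 ≤ q) :
    ∃ C : ℝ, 0 ≤ C ∧ ∀ (f : ℝ → ℝ) (B₁ B₂ N₁ N₂ : ℝ), 0 ≤ B₁ → 0 ≤ B₂ → 0 < N₁ → 0 < N₂ →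
      (∀ u, 0 < u → diffNorm r p f u ≤
        ENNReal.ofReal (B₁ * min 1 ((N₁ * u) ^ r) + B₂ * min 1 ((N₂ * u) ^ r))) →
      besovNorm r s p q f ≤ unitLpNorm p f + ENNReal.ofReal (C * (B₁ * N₁ ^ s + B₂ * N₂ ^ s)) := by
  by_cases hqt : q = ∞
  · refine ⟨1, zero_le_one, fun f B₁ B₂ N₁ N₂ hB₁ hB₂ hN₁ hN₂ h => ?_⟩
    rw [besovNorm, if_pos hqt]
    gcongr
    refine iSup₂_le fun u hu => ?_
    have hus : 0 < u ^ s := Real.rpow_pos_of_pos hu.1 s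
    refine ENNReal.div_le_of_le_mul ((h u hu.1).trans ?_)
    rw [← ENNReal.ofReal_mul (by positivity)]
    refine ENNReal.ofReal_le_ofReal ?_
    have h1 := min_one_pow_le_rpow hs hr (mul_pos hN₁ hu.1)
    have h2 := min_one_pow_le_rpow hs hr (mul_pos hN₂ hu.1)
    rw [Real.mul_rpow hN₁.le hu.1.le] at h1
    rw [Real.mul_rpow hN₂.le hu.1.le] at h2
    calc _ ≤ B₁ * (N₁ ^ s * u ^ s) + B₂ * (N₂ ^ s * u ^ s) := by gcongr
      _ = _ := by ring
  · have hq1 : 1 ≤ q.toReal := by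
      rw [← ENNReal.toReal_one]
      exact ENNReal.toReal_mono hqt hq
    set q' := q.toReal with hq'
    have hq0 : 0 < q' := by linarith
    set K := 1 / ((r - s) * q') + 1 / (s * q') with hK
    have hrs : 0 < (r - s) * q' := mul_pos (by linarith) hq0
    have hK0 : 0 ≤ K := by positivity
    refine ⟨2 * K ^ (1 / q'), by positivity, fun f B₁ B₂ N₁ N₂ hB₁ hB₂ hN₁ hN₂ h => ?_⟩
    rw [besovNorm, if_neg hqt]
    gcongr
    have hk0 : ∀ N u : ℝ, 0 < N → 0 < u → 0 ≤ min 1 ((N * u) ^ r) / u ^ s :=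
      fun N u hN hu => by positivity
    have h1 : ∀ u ∈ Ioi (0 : ℝ), (diffNorm r p f u / ENNReal.ofReal (u ^ s)) ^ q' /
        ENNReal.ofReal u ≤ ENNReal.ofReal ((2 * B₁) ^ q') *
          ENNReal.ofReal ((min 1 ((N₁ * u) ^ r) / u ^ s) ^ q' / u) +
        ENNReal.ofReal ((2 * B₂) ^ q') *
          ENNReal.ofReal ((min 1 ((N₂ * u) ^ r) / u ^ s) ^ q' / u) := fun u hu => by
      have hu0 : 0 < u := hu
      have hus : 0 < u ^ s := Real.rpow_pos_of_pos hu0 s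
      set k₁ := min 1 ((N₁ * u) ^ r) / u ^ s with hk₁
      set k₂ := min 1 ((N₂ * u) ^ r) / u ^ s with hk₂
      have hk₁0 : 0 ≤ k₁ := hk0 N₁ u hN₁ hu0
      have hk₂0 : 0 ≤ k₂ := hk0 N₂ u hN₂ hu0
      have h2 : diffNorm r p f u / ENNReal.ofReal (u ^ s) ≤ ENNReal.ofReal (B₁ * k₁ + B₂ * k₂) := by
        refine (ENNReal.div_le_div_right (h u hu0) _).trans ?_
        rw [← ENNReal.ofReal_div_of_pos hus]
        refine ENNReal.ofReal_le_ofReal (le_of_eq ?_)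
        rw [hk₁, hk₂]
        ring
      -- The sum is at most twice its larger term. This crude splitting, followed by subadditivity
      -- of the power 1/q, replaces Minkowski's inequality and produces the 2 in the constant.
      have h3 : (B₁ * k₁ + B₂ * k₂) ^ q' ≤ (2 * B₁ * k₁) ^ q' + (2 * B₂ * k₂) ^ q' := by
        rcases le_total (B₁ * k₁) (B₂ * k₂) with h4 | h4
        · calc _ ≤ (2 * B₂ * k₂) ^ q' := by
                refine Real.rpow_le_rpow (by positivity) (by linarith) hq0.le
            _ ≤ _ := le_add_of_nonneg_left (by positivity)
        · calc _ ≤ (2 * B₁ * k₁) ^ q' := by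
                refine Real.rpow_le_rpow (by positivity) (by linarith) hq0.le
            _ ≤ _ := le_add_of_nonneg_right (by positivity)
      calc _ ≤ ENNReal.ofReal (B₁ * k₁ + B₂ * k₂) ^ q' / ENNReal.ofReal u := by gcongr
        _ = ENNReal.ofReal ((B₁ * k₁ + B₂ * k₂) ^ q' / u) := by
          rw [ENNReal.ofReal_rpow_of_nonneg (by positivity) hq0.le, ENNReal.ofReal_div_of_pos hu0]
        _ ≤ ENNReal.ofReal ((2 * B₁) ^ q' * (k₁ ^ q' / u) + (2 * B₂) ^ q' * (k₂ ^ q' / u)) := by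
          refine ENNReal.ofReal_le_ofReal ?_
          rw [Real.mul_rpow (by positivity) hk₁0, Real.mul_rpow (by positivity) hk₂0] at h3
          refine (div_le_div_of_nonneg_right h3 hu0.le).trans (le_of_eq ?_)
          ring
        _ = _ := by
          rw [ENNReal.ofReal_add (by positivity) (by positivity), ENNReal.ofReal_mul (by positivity),
            ENNReal.ofReal_mul (by positivity)]
    calc _ ≤ (ENNReal.ofReal ((2 * B₁) ^ q') * ENNReal.ofReal (K * (N₁ ^ s) ^ q') +
          ENNReal.ofReal ((2 * B₂) ^ q') * ENNReal.ofReal (K * (N₂ ^ s) ^ q')) ^ (1 / q') := by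
          refine ENNReal.rpow_le_rpow ?_ (by positivity)
          refine (setLIntegral_mono' measurableSet_Ioi h1).trans ?_
          rw [lintegral_add_left (by fun_prop), lintegral_const_mul' _ _ ENNReal.ofReal_ne_top,
            lintegral_const_mul' _ _ ENNReal.ofReal_ne_top]
          gcongr
          · exact lintegral_min_one_pow_le hs hr hq0 hN₁
          · exact lintegral_min_one_pow_le hs hr hq0 hN₂
      _ ≤ (ENNReal.ofReal ((2 * B₁) ^ q') * ENNReal.ofReal (K * (N₁ ^ s) ^ q')) ^ (1 / q') +
          (ENNReal.ofReal ((2 * B₂) ^ q') * ENNReal.ofReal (K * (N₂ ^ s) ^ q')) ^ (1 / q') :=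
          ENNReal.rpow_add_le_add_rpow _ _ (by positivity) (by rw [div_le_one hq0]; exact hq1)
      _ = _ := by
          have h5 : ∀ B N : ℝ, 0 ≤ B → 0 < N → (ENNReal.ofReal ((2 * B) ^ q') *
              ENNReal.ofReal (K * (N ^ s) ^ q')) ^ (1 / q') =
              ENNReal.ofReal (2 * K ^ (1 / q') * (B * N ^ s)) := fun B N hB hN => by
            rw [← ENNReal.ofReal_mul (by positivity),
              ENNReal.ofReal_rpow_of_nonneg (by positivity) (by positivity),
              show (2 * B) ^ q' * (K * (N ^ s) ^ q') = K * (2 * B * N ^ s) ^ q' by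
                rw [Real.mul_rpow (x := 2 * B) (by positivity) (by positivity)]; ring,
              Real.mul_rpow hK0 (by positivity), ← Real.rpow_mul (by positivity),
              mul_one_div_cancel hq0.ne', Real.rpow_one]
            congr 1
            ring
          rw [h5 _ _ hB₁ hN₁, h5 _ _ hB₂ hN₂, ← ENNReal.ofReal_add (by positivity) (by positivity),
            ← mul_add]

end Besov

/-! ### The family of bumps -/

section BumpFamily

variable {r : ℕ} {s p : ℝ} {q : ℝ≥0∞}

/-- Bumps of height √(2d) and width 1/(2d) turn the ℓ_p norm into an L_p norm with the factor
(2d)^{1/2-1/p}; its part 2^{1/2-1/p} is absorbed in the constant `M` of the family. -/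
theorem sum_abs_mul_sqrt_rpow (hp : 1 ≤ p) {d : ℕ} (hd : 1 ≤ d) (v : Fin d → ℝ) :
    ∑ i, |v i * √(2 * d)| ^ p / (2 * d) =
      (2 ^ (1 / 2 - 1 / p) * ((d : ℝ) ^ (1 / 2 - 1 / p) * lpNorm p v)) ^ p := by
  have hd' : (0 : ℝ) < d := by exact_mod_cast hd
  have hp0 : p ≠ 0 := by linarith
  rw [← mul_assoc, ← Real.mul_rpow (by norm_num) hd'.le,
    Real.mul_rpow (by positivity) (lpNorm_nonneg p v), lpNorm_rpow hp, Finset.mul_sum,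
    ← Real.rpow_mul (by positivity)]
  refine Finset.sum_congr rfl fun i _ => ?_
  rw [abs_mul, Real.mul_rpow (abs_nonneg _) (abs_nonneg _), abs_of_nonneg (Real.sqrt_nonneg _),
    Real.sqrt_eq_rpow, ← Real.rpow_mul (by positivity), mul_div_assoc,
    ← Real.rpow_sub_one (by positivity), mul_comm]
  congr 2
  field_simp

theorem integral_bump_mul_bump {φ : ℝ → ℝ} (hφ0 : ∀ x, x ∉ Ioo (0 : ℝ) 1 → φ x = 0)
    (hφ2 : ∫ x, φ x ^ 2 = 1) {d : ℕ} (i j : Fin d) :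
    ∫ t in Icc (0 : ℝ) 1, (√(2 * d) * φ (2 * d * t - i)) * (√(2 * d) * φ (2 * d * t - j)) =
      if i = j then 1 else 0 := by
  have hd : (0 : ℝ) < d := by exact_mod_cast i.pos
  by_cases hij : i = j
  · subst hij
    rw [if_pos rfl, setIntegral_eq_integral_of_forall_compl_eq_zero]
    · have e : ∀ t : ℝ, √(2 * d) * φ (2 * d * t - i) * (√(2 * d) * φ (2 * d * t - i)) =
          2 * d * (fun y => φ (y - i) ^ 2) (2 * d * t) := fun t => by
        have := Real.mul_self_sqrt (show (0 : ℝ) ≤ 2 * d by positivity)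
        simp only
        linear_combination φ (2 * d * t - i) ^ 2 * this
      simp_rw [e]
      rw [integral_const_mul, Measure.integral_comp_mul_left (fun y => φ (y - i) ^ 2),
        integral_sub_right_eq_self (fun y => φ y ^ 2), hφ2, abs_of_pos (by positivity),
        smul_eq_mul, mul_one, mul_inv_cancel₀ (by positivity)]
    · intro t ht
      rw [hφ0, mul_zero, mul_zero]
      intro h
      have hi : ((i : ℕ) : ℝ) + 1 ≤ d := by exact_mod_cast i.2
      have hi0 : (0 : ℝ) ≤ ((i : ℕ) : ℝ) := Nat.cast_nonneg _
      refine ht ⟨?_, ?_⟩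
      · by_contra! h'
        nlinarith [h.1]
      · by_contra! h'
        nlinarith [h.2]
  · rw [if_neg hij, integral_eq_zero_of_ae]
    refine ae_of_all _ fun t => ?_
    rcases eq_zero_or_eq_zero_of_ne hφ0 (Fin.val_ne_of_ne hij) (2 * d * t) with h | h
    · simp [h]
    · simp [h]

theorem rthDiff_add (r : ℕ) (f g : ℝ → ℝ) (u : ℝ) :
    rthDiff r (fun t => f t + g t) u = rthDiff r f u + rthDiff r g u := by
  ext t
  simp only [rthDiff, Pi.add_apply, mul_add, Finset.sum_add_distrib]

theorem diffNorm_add_le (hp : 1 ≤ p) {f g : ℝ → ℝ} (hf : Continuous f) (hg : Continuous g)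
    (u : ℝ) : diffNorm r p (fun t => f t + g t) u ≤ diffNorm r p f u + diffNorm r p g u := by
  rw [diffNorm, rthDiff_add]
  exact eLpNorm_add_le (continuous_rthDiff r hf u).aestronglyMeasurable
    (continuous_rthDiff r hg u).aestronglyMeasurable (by simpa using hp)

/-- A smooth function on `[1/2,1]` and, in every dimension, an orthonormal family of disjoint bumps
on `[0,1/2]`, with norms of their combinations. -/
theorem exists_bumpFamily (hs : 0 < s) (hr : s < r) (hp : 1 ≤ p) (hq : 1 ≤ q) :
    ∃ (M C : ℝ) (w : ℝ → ℝ) (ψ : ∀ d : ℕ, Fin d → ℝ → ℝ), 0 < M ∧ 0 < C ∧ MemLp w 2 unitVolume ∧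
      ∀ d : ℕ, 1 ≤ d → (∀ i, MemLp (ψ d i) 2 unitVolume) ∧
        (∀ i j, ∫ t in Icc (0 : ℝ) 1, ψ d i t * ψ d j t = if i = j then 1 else 0) ∧
        ∀ (ρ : ℝ) (v : Fin d → ℝ), 0 ≤ ρ →
          unitLpNorm p (fun t => ρ * w t + ∑ i, v i * ψ d i t) = ENNReal.ofReal
            ((ρ ^ p + (M * ((d : ℝ) ^ (1 / 2 - 1 / p) * lpNorm p v)) ^ p) ^ (1 / p)) ∧
          besovNorm r s p q (fun t => ρ * w t + ∑ i, v i * ψ d i t) ≤ ENNReal.ofReal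
            (C * (ρ + (d : ℝ) ^ s * ((d : ℝ) ^ (1 / 2 - 1 / p) * lpNorm p v))) := by
  have hp0 : 0 < p := by linarith
  obtain ⟨φ, hφ, hφc, hφ0, hφ2⟩ := exists_bump r
  have hφ0' : ∀ x, x ∉ Ioo (0 : ℝ) 1 → φ x = 0 := fun x hx => hφ0 x fun h =>
    hx ⟨by linarith [h.1], by linarith [h.2]⟩
  obtain ⟨C₀, hC₀, hdiff⟩ := exists_diffNorm_bumpSum_le hp r hφ hφc hφ0
  obtain ⟨C₁, hC₁, hbes⟩ := exists_besovNorm_le hs hr p hq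
  have hcont : Continuous φ := hφ.continuous
  have hfin : eLpNorm φ (ENNReal.ofReal p) volume ≠ ∞ := (hcont.memLp_of_hasCompactSupport hφc).2.ne
  set F := (eLpNorm φ (ENNReal.ofReal p) volume).toReal with hF
  have hF0 : 0 < F := by
    refine ENNReal.toReal_pos (fun h => ?_) hfin
    rw [eLpNorm_eq_zero_iff hcont.aestronglyMeasurable (by simpa using hp0)] at h
    have : ∫ x, φ x ^ 2 = 0 := integral_eq_zero_of_ae (by
      filter_upwards [h] with x hx
      simp [hx])
    linarith
  set b : ℝ := 2 ^ (1 / 2 - 1 / p) with hb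
  have hb0 : 0 < b := by positivity
  -- Normalises w to unit L_p norm: a^p·(1/2)·F^p = 1, the factor 1/2 being the width of w.
  set a := 2 ^ (1 / p) / F with ha
  have ha0 : 0 < a := by positivity
  have hap : a ^ p / 2 = (1 / F) ^ p := by
    rw [ha, Real.div_rpow (by positivity) hF0.le, ← Real.rpow_mul (by norm_num),
      one_div_mul_cancel hp0.ne', Real.rpow_one, Real.div_rpow zero_le_one hF0.le, Real.one_rpow]
    ring
  set w : ℝ → ℝ := fun t => a * φ (2 * t - 1) with hw
  set ψ : ∀ d : ℕ, Fin d → ℝ → ℝ := fun d i t => √(2 * d) * φ (2 * d * t - i) with hψ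
  have hmem : ∀ {g : ℝ → ℝ}, Continuous g → MemLp g 2 unitVolume := fun hg =>
    (memLp_two_iff_integrable_sq hg.aestronglyMeasurable).2
      ((hg.pow 2).continuousOn.integrableOn_Icc)
  refine ⟨b * F, 1 + b * F + C₁ * C₀ * (2 ^ s / F) + C₁ * C₀ * (b * 2 ^ s), w, ψ, by positivity,
    by positivity, hmem (by fun_prop), fun d hd => ⟨fun i => hmem (by fun_prop),
    fun i j => integral_bump_mul_bump hφ0' hφ2 i j, fun ρ v hρ => ?_⟩⟩
  have hd' : (1 : ℝ) ≤ d := by exact_mod_cast hd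
  set n := (d : ℝ) ^ (1 / 2 - 1 / p) * lpNorm p v with hn
  have hn0 : 0 ≤ n := mul_nonneg (by positivity) (lpNorm_nonneg p v)
  have hsum : ∑ i, |v i * √(2 * d)| ^ p / (2 * d) = (b * n) ^ p := sum_abs_mul_sqrt_rpow hp hd v
  set f := fun t => ρ * w t + ∑ i, v i * ψ d i t with hf
  have hsupp : Function.support f ⊆ Icc 0 1 := fun t ht => by
    by_contra h
    refine ht ?_
    have h1 : φ (2 * t - 1) = 0 := hφ0' _ fun h' =>
      h ⟨by linarith [h'.1], by linarith [h'.2]⟩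
    have h2 : ∀ i : Fin d, φ (2 * d * t - i) = 0 := fun i => hφ0' _ fun h' => by
      have hi : ((i : ℕ) : ℝ) + 1 ≤ d := by exact_mod_cast i.2
      have hi0 : (0 : ℝ) ≤ ((i : ℕ) : ℝ) := Nat.cast_nonneg _
      refine h ⟨?_, ?_⟩
      · by_contra! h3
        nlinarith [h'.1]
      · by_contra! h3
        nlinarith [h'.2]
    simp [hf, hw, hψ, h1, h2]
  have hnorm : unitLpNorm p f = ENNReal.ofReal ((ρ ^ p + (b * F * n) ^ p) ^ (1 / p)) := by
    rw [unitLpNorm, eLpNorm_restrict_eq_of_support_subset hsupp]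
    -- The index `none` stands for the coarse function w on the right half, `some i` for the fine
    -- bumps on the left half. Disjointness makes p-th powers of all norms add.
    have e : f = fun t => ∑ j : Option (Fin d), (j.elim (ρ * a) fun i => v i * √(2 * d)) *
        φ (j.elim (2 : ℝ) (fun _ => 2 * (d : ℝ)) * t - j.elim (1 : ℝ) fun i => i) := by
      ext t
      rw [Fintype.sum_option]
      simp only [hf, hw, hψ, Option.elim, mul_assoc]
    have hlow : ∀ (t : ℝ) (i : Fin d), φ (2 * t - 1) = 0 ∨ φ (2 * d * t - i) = 0 := fun t i => by
      by_contra! h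
      have h1 : 2 * t - 1 ∈ Ioo (0 : ℝ) 1 := by_contra fun h' => h.1 (hφ0' _ h')
      have h2 : 2 * d * t - i ∈ Ioo (0 : ℝ) 1 := by_contra fun h' => h.2 (hφ0' _ h')
      have hi : ((i : ℕ) : ℝ) + 1 ≤ d := by exact_mod_cast i.2
      nlinarith [h1.1, h2.2]
    rw [e, eLpNorm_sum_of_disjoint hcont.measurable hp
      (N := fun j : Option (Fin d) => j.elim (2 : ℝ) fun _ => 2 * (d : ℝ))]
    · rw [Fintype.sum_option]
      simp only [Option.elim]
      rw [hsum, ← ENNReal.ofReal_toReal hfin, ← hF, ← ENNReal.ofReal_mul (by positivity),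
        abs_of_nonneg (by positivity), Real.mul_rpow hρ ha0.le, mul_div_assoc, hap]
      congr 1
      have h1 : F = (F ^ p) ^ (1 / p) := by
        rw [← Real.rpow_mul hF0.le, mul_one_div_cancel hp0.ne', Real.rpow_one]
      nth_rewrite 2 [h1]
      rw [← Real.mul_rpow (by positivity) (by positivity), add_mul, mul_assoc,
        ← Real.mul_rpow (by positivity) hF0.le, ← Real.mul_rpow (by positivity) hF0.le,
        one_div_mul_cancel hF0.ne', Real.one_rpow, mul_one, mul_right_comm b n F]
    · rintro (_ | i)
      · simp
      · simp only [Option.elim]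
        positivity
    · rintro t (_ | i) (_ | j) hij
      · exact absurd rfl hij
      · exact hlow t j
      · exact (hlow t i).symm
      · exact eq_zero_or_eq_zero_of_ne hφ0' (Fin.val_ne_of_ne fun h => hij (by rw [h])) _
  refine ⟨hnorm, ?_⟩
  have hdec : f = fun t => bumpSum φ 2 (fun _ : Unit => 1) (fun _ => ρ * a) t +
      bumpSum φ (2 * d) (fun i : Fin d => (i : ℕ)) (fun i => v i * √(2 * d)) t := by
    ext t
    simp only [hf, hw, hψ, bumpSum, Finset.univ_unique, Finset.sum_singleton, mul_assoc]
    push_cast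
    simp only [mul_assoc]
  have hdn : ∀ u, 0 < u → diffNorm r p f u ≤ ENNReal.ofReal (C₀ * (ρ / F) * min 1 ((2 * u) ^ r) +
      C₀ * (b * n) * min 1 ((2 * d * u) ^ r)) := fun u hu => by
    rw [hdec]
    refine (diffNorm_add_le hp (continuous_bumpSum hcont _ _ _)
      (continuous_bumpSum hcont _ _ _) u).trans ?_
    rw [ENNReal.ofReal_add (by positivity) (by positivity)]
    refine add_le_add ((hdiff (Function.injective_of_subsingleton _) 2 _ u two_pos hu).trans
      (le_of_eq ?_)) ((hdiff Fin.val_injective (2 * d) _ u (by omega) hu).trans (le_of_eq ?_))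
    · simp only [Finset.univ_unique, Finset.sum_singleton, Nat.cast_ofNat]
      rw [abs_of_nonneg (by positivity), Real.mul_rpow hρ ha0.le, mul_div_assoc, hap,
        ← Real.mul_rpow hρ (by positivity), ← Real.rpow_mul (by positivity),
        mul_one_div_cancel hp0.ne', Real.rpow_one, mul_one_div]
    · push_cast
      rw [hsum, ← Real.rpow_mul (by positivity), mul_one_div_cancel hp0.ne', Real.rpow_one]
  refine (hbes f _ _ 2 (2 * d) (by positivity) (by positivity) two_pos (by positivity) hdn).trans ?_
  rw [hnorm, ← ENNReal.ofReal_add (by positivity) (by positivity)]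
  refine ENNReal.ofReal_le_ofReal ?_
  have hadd : (ρ ^ p + (b * F * n) ^ p) ^ (1 / p) ≤ ρ + b * F * n :=
    Real.rpow_add_rpow_le_add hρ (by positivity) hp
  have hds : 1 ≤ (d : ℝ) ^ s := Real.one_le_rpow hd' hs.le
  rw [Real.mul_rpow two_pos.le (by positivity)]
  set D := (d : ℝ) ^ s with hD
  have hnD : n ≤ D * n := le_mul_of_one_le_left hn0 hds
  have hDn : 0 ≤ D * n := by positivity
  calc _ ≤ ρ + b * F * n + C₁ * (C₀ * (ρ / F) * 2 ^ s + C₀ * (b * n) * (2 ^ s * D)) := by gcongr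
    _ = 1 * ρ + b * F * n + C₁ * C₀ * (2 ^ s / F) * ρ + C₁ * C₀ * (b * 2 ^ s) * (D * n) := by ring
    _ ≤ (1 * ρ + b * F * (D * n) + C₁ * C₀ * (2 ^ s / F) * ρ + C₁ * C₀ * (b * 2 ^ s) * (D * n)) +
        (1 * (D * n) + b * F * ρ + C₁ * C₀ * (2 ^ s / F) * (D * n) + C₁ * C₀ * (b * 2 ^ s) * ρ) := by
      have : 0 ≤ 1 * (D * n) + b * F * ρ + C₁ * C₀ * (2 ^ s / F) * (D * n) +
        C₁ * C₀ * (b * 2 ^ s) * ρ := by positivity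
      have : b * F * n ≤ b * F * (D * n) := by gcongr
      linarith
    _ = _ := by ring

end BumpFamily

/-! ### The integral Minkowski inequality -/

section Minkowski

open Filter Topology

variable {p : ℝ} {μ ν : Measure ℝ}

/-- The `L_p` norm of a nonnegative function. -/
noncomputable def lintegralNorm (p : ℝ) (μ : Measure ℝ) (g : ℝ → ℝ≥0∞) : ℝ≥0∞ :=
  (∫⁻ t, g t ^ p ∂μ) ^ (1 / p)

theorem lintegralNorm_mono (hp : 1 ≤ p) {g g' : ℝ → ℝ≥0∞} (h : ∀ t, g t ≤ g' t) :
    lintegralNorm p μ g ≤ lintegralNorm p μ g' :=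
  ENNReal.rpow_le_rpow (lintegral_mono fun t => ENNReal.rpow_le_rpow (h t) (by linarith))
    (by positivity)

theorem lintegralNorm_mono_measure (hp : 1 ≤ p) (h : μ ≤ ν) (g : ℝ → ℝ≥0∞) :
    lintegralNorm p μ g ≤ lintegralNorm p ν g :=
  ENNReal.rpow_le_rpow (lintegral_mono' h le_rfl) (by positivity)

theorem lintegralNorm_add_le (hp : 1 ≤ p) {g g' : ℝ → ℝ≥0∞} (hg : Measurable g)
    (hg' : Measurable g') :
    lintegralNorm p μ (fun t => g t + g' t) ≤ lintegralNorm p μ g + lintegralNorm p μ g' :=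
  ENNReal.lintegral_Lp_add_le hg.aemeasurable hg'.aemeasurable hp

theorem lintegralNorm_const_mul (hp : 1 ≤ p) (c : ℝ≥0∞) {g : ℝ → ℝ≥0∞} (hg : Measurable g) :
    lintegralNorm p μ (fun t => c * g t) = c * lintegralNorm p μ g := by
  have hp0 : 0 < p := by linarith
  simp only [lintegralNorm, ENNReal.mul_rpow_of_nonneg _ _ hp0.le]
  rw [lintegral_const_mul _ (by fun_prop), ENNReal.mul_rpow_of_nonneg _ _ (by positivity),
    ← ENNReal.rpow_mul, mul_one_div_cancel hp0.ne', ENNReal.rpow_one]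

theorem lintegralNorm_sum_le (hp : 1 ≤ p) {J : Type*} (S : Finset J) {g : J → ℝ → ℝ≥0∞}
    (hg : ∀ j, Measurable (g j)) :
    lintegralNorm p μ (fun t => ∑ j ∈ S, g j t) ≤ ∑ j ∈ S, lintegralNorm p μ (g j) := by
  classical
  have hp0 : 0 < p := by linarith
  induction S using Finset.induction_on with
  | empty => simp [lintegralNorm, ENNReal.zero_rpow_of_pos hp0, hp0]
  | insert a S ha ih =>
    simp_rw [Finset.sum_insert ha]
    exact (lintegralNorm_add_le hp (hg a) (Finset.measurable_sum S fun j _ => hg j)).trans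
      (add_le_add_right ih _)

theorem lintegralNorm_comp_add_le (hp : 1 ≤ p) (S : Set ℝ) (g : ℝ → ℝ≥0∞) (c : ℝ) :
    lintegralNorm p (volume.restrict S) (fun t => g (t + c)) ≤ lintegralNorm p volume g := by
  refine (lintegralNorm_mono_measure hp Measure.restrict_le_self _).trans (le_of_eq ?_)
  rw [lintegralNorm, lintegral_add_right_eq_self fun t => g t ^ p]
  rfl

/-- Duality: with φ the truncated integral and I = ∫ φ^p, Fubini and Hölder give I ≤ X·I^{1/q}.
Dividing by I^{1/q} requires I finite, which truncation and finiteness of μ ensure. -/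
theorem lintegralNorm_min_le [SFinite ν] [IsFiniteMeasure μ] (hp : 1 ≤ p) {g : ℝ → ℝ → ℝ≥0∞}
    (hg : Measurable (Function.uncurry g)) (n : ℕ) :
    lintegralNorm p μ (fun t => min (∫⁻ u, g t u ∂ν) n) ≤
      ∫⁻ u, lintegralNorm p μ (fun t => g t u) ∂ν := by
  rcases hp.eq_or_lt with rfl | hp1
  · simp only [lintegralNorm, ENNReal.rpow_one, div_one]
    rw [← lintegral_lintegral_swap hg.aemeasurable]
    exact lintegral_mono fun t => min_le_left _ _
  have hp0 : 0 < p := by linarith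
  set φ : ℝ → ℝ≥0∞ := fun t => min (∫⁻ u, g t u ∂ν) n with hφ
  have hG : Measurable fun t => ∫⁻ u, g t u ∂ν := hg.lintegral_prod_right'
  have hφm : Measurable φ := hG.min measurable_const
  have hpq := Real.HolderConjugate.conjExponent hp1
  set q := p.conjExponent with hq
  set I := ∫⁻ t, φ t ^ p ∂μ with hI
  have hItop : I ≠ ∞ := by
    refine ((lintegral_mono (g := fun _ => (n : ℝ≥0∞) ^ p) fun t =>
      ENNReal.rpow_le_rpow (min_le_right _ _) hp0.le).trans_lt ?_).ne
    rw [lintegral_const]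
    exact ENNReal.mul_lt_top (ENNReal.rpow_lt_top_of_nonneg hp0.le (ENNReal.natCast_ne_top n))
      (measure_lt_top _ _)
  set X := ∫⁻ u, lintegralNorm p μ (fun t => g t u) ∂ν with hX
  have h1 : I ≤ X * I ^ (1 / q) := by
    calc I ≤ ∫⁻ t, (∫⁻ u, g t u ∂ν) * φ t ^ (p - 1) ∂μ := by
          refine lintegral_mono fun t => ?_
          by_cases h0 : φ t = 0
          · rw [h0, ENNReal.zero_rpow_of_pos hp0]
            exact zero_le
          · have hφt : φ t ≠ ∞ := ne_top_of_le_ne_top (ENNReal.natCast_ne_top n) (min_le_right _ _)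
            calc φ t ^ p = φ t * φ t ^ (p - 1) := by
                  rw [ENNReal.rpow_sub p 1 h0 hφt, ENNReal.rpow_one, ENNReal.mul_div_cancel h0 hφt]
              _ ≤ _ := by
                  gcongr
                  exact min_le_left _ _
      _ = ∫⁻ t, ∫⁻ u, g t u * φ t ^ (p - 1) ∂ν ∂μ := by
          refine lintegral_congr fun t => ?_
          exact (lintegral_mul_const _ (hg.comp measurable_prodMk_left)).symm
      _ = ∫⁻ u, ∫⁻ t, g t u * φ t ^ (p - 1) ∂μ ∂ν := by
          refine lintegral_lintegral_swap (Measurable.aemeasurable ?_)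
          exact hg.mul ((hφm.comp measurable_fst).pow_const _)
      _ ≤ ∫⁻ u, lintegralNorm p μ (fun t => g t u) * I ^ (1 / q) ∂ν := by
          refine lintegral_mono fun u => ?_
          exact ENNReal.lintegral_mul_rpow_le_lintegral_rpow_mul_lintegral_rpow hpq
            (hg.comp measurable_prodMk_right).aemeasurable hφm.aemeasurable
      _ = X * I ^ (1 / q) := lintegral_mul_const' _ _
          (ENNReal.rpow_ne_top_of_nonneg (by have := hpq.symm.pos; positivity) hItop)
  change I ^ (1 / p) ≤ X
  rcases eq_or_ne I 0 with h0 | h0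
  · rw [h0, ENNReal.zero_rpow_of_pos (by positivity)]
    exact zero_le
  have h2 : I ^ (1 / p) * I ^ (1 / q) = I := by
    rw [← ENNReal.rpow_add _ _ h0 hItop, one_div, one_div, hpq.inv_add_inv_eq_one, ENNReal.rpow_one]
  have h3 : I ^ (1 / q) ≠ ∞ :=
    ENNReal.rpow_ne_top_of_nonneg (by have := hpq.symm.pos; positivity) hItop
  have h4 : I ^ (1 / q) ≠ 0 := fun h => by
    rw [h, mul_zero] at h2
    exact h0 h2.symm
  exact (ENNReal.mul_le_mul_iff_left h4 h3).1 (h2.le.trans h1)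

/-- **Minkowski's integral inequality**. -/
theorem lintegralNorm_lintegral_le [SFinite ν] [IsFiniteMeasure μ] (hp : 1 ≤ p) {g : ℝ → ℝ → ℝ≥0∞}
    (hg : Measurable (Function.uncurry g)) :
    lintegralNorm p μ (fun t => ∫⁻ u, g t u ∂ν) ≤
      ∫⁻ u, lintegralNorm p μ (fun t => g t u) ∂ν := by
  have hp0 : 0 < p := by linarith
  have hG : Measurable fun t => ∫⁻ u, g t u ∂ν := hg.lintegral_prod_right'
  have hlim : Tendsto (fun n : ℕ => ∫⁻ t, min (∫⁻ u, g t u ∂ν) (n : ℝ≥0∞) ^ p ∂μ) atTop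
      (𝓝 (∫⁻ t, (∫⁻ u, g t u ∂ν) ^ p ∂μ)) := by
    refine lintegral_tendsto_of_tendsto_of_monotone
      (fun n => ((hG.min measurable_const).pow_const p).aemeasurable)
      (ae_of_all _ fun t m n hmn => ?_) (ae_of_all _ fun t => ?_)
    · exact ENNReal.rpow_le_rpow (min_le_min_left _ (by exact_mod_cast hmn)) hp0.le
    · refine (ENNReal.continuous_rpow_const.tendsto _).comp ?_
      have h := (tendsto_const_nhds (x := ∫⁻ u, g t u ∂ν)).min ENNReal.tendsto_nat_nhds_top
      rwa [min_eq_left le_top] at h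
  exact le_of_tendsto ((ENNReal.continuous_rpow_const.tendsto _).comp hlim)
    (Eventually.of_forall fun n => lintegralNorm_min_le hp hg n)

end Minkowski

/-! ### Projection on step functions -/

section StepProjection

variable {f : ℝ → ℝ}

/-- The integral of `f` over the cell `[n/D, (n+1)/D]`. -/
noncomputable def cellIntegral (D : ℕ) (f : ℝ → ℝ) (n : ℤ) : ℝ :=
  ∫ y in (n / D : ℝ)..((n + 1) / D), f y

/-- The step function with the means of `f` over the cells of the grid of width `1/D`. -/
noncomputable def stepMean (D : ℕ) (f : ℝ → ℝ) (x : ℝ) : ℝ :=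
  D * cellIntegral D f ⌊D * x⌋

theorem measurable_stepMean (D : ℕ) (f : ℝ → ℝ) : Measurable (stepMean D f) :=
  ((measurable_from_top (f := cellIntegral D f)).comp
    (Int.measurable_floor.comp (measurable_const_mul _))).const_mul _

theorem abs_cellIntegral_le (hf : Integrable f) (D : ℕ) (n : ℤ) :
    |cellIntegral D f n| ≤ ∫ y, |f y| := by
  have hle : (n / D : ℝ) ≤ (n + 1) / D := by gcongr; linarith
  rw [cellIntegral, intervalIntegral.integral_of_le hle]
  exact (abs_integral_le_integral_abs).trans
    (setIntegral_le_integral hf.abs (ae_of_all _ fun _ => abs_nonneg _))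

theorem intervalIntegrable_stepMean (hf : Integrable f) (D : ℕ) (a b : ℝ) :
    IntervalIntegrable (stepMean D f) volume a b := by
  rw [intervalIntegrable_iff]
  refine Measure.integrableOn_of_bounded (M := D * ∫ y, |f y|) (by simp)
    (measurable_stepMean D f).aestronglyMeasurable (ae_of_all _ fun x => ?_)
  rw [stepMean, Real.norm_eq_abs, abs_mul, Nat.abs_cast]
  gcongr
  exact abs_cellIntegral_le hf D _

/-- The local average of `|f|` at scale `1/D`. -/
noncomputable def localMass (D : ℕ) (f : ℝ → ℝ) (x : ℝ) : ℝ≥0∞ :=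
  ∫⁻ y in Icc (-(1 / D : ℝ)) (1 / D), ‖f (x + y)‖ₑ

theorem lintegral_Ioc_le_localMass {D : ℕ} {a b x : ℝ} (ha : x - 1 / D ≤ a) (hb : b ≤ x + 1 / D)
    (hf : Measurable f) : ∫⁻ y in Ioc a b, ‖f y‖ₑ ≤ localMass D f x := by
  have h := (measurePreserving_add_left volume x).setLIntegral_comp_preimage
    (measurableSet_Icc : MeasurableSet (Icc (x - 1 / D : ℝ) (x + 1 / D))) hf.enorm
  have e : (fun y => x + y) ⁻¹' Icc (x - 1 / D : ℝ) (x + 1 / D) = Icc (-(1 / D : ℝ)) (1 / D) := by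
    ext y
    simp only [mem_preimage, mem_Icc]
    constructor <;> rintro ⟨h1, h2⟩ <;> constructor <;> linarith
  rw [localMass, ← e, h]
  exact lintegral_mono_set fun y hy => ⟨ha.trans hy.1.le, hy.2.trans hb⟩

theorem measurable_localMass (hf : Measurable f) (D : ℕ) : Measurable (localMass D f) := by
  unfold localMass
  exact Measurable.lintegral_prod_right' (f := fun z : ℝ × ℝ => ‖f (z.1 + z.2)‖ₑ) (by fun_prop)

variable {D : ℕ}

theorem floor_div_le (hD : 0 < D) (x : ℝ) : (⌊D * x⌋ : ℝ) / D ≤ x := by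
  have hD' : (0 : ℝ) < D := by exact_mod_cast hD
  rw [div_le_iff₀ hD', mul_comm]
  exact Int.floor_le _

theorem le_floor_add_one_div (hD : 0 < D) (x : ℝ) : x ≤ (⌊D * x⌋ + 1 : ℝ) / D := by
  have hD' : (0 : ℝ) < D := by exact_mod_cast hD
  rw [le_div_iff₀ hD', mul_comm]
  exact (Int.lt_floor_add_one _).le

theorem enorm_cellIntegral_le (hD : 0 < D) (hf : Measurable f) (x : ℝ) :
    ‖cellIntegral D f ⌊D * x⌋‖ₑ ≤ localMass D f x := by
  have hle : (⌊D * x⌋ / D : ℝ) ≤ (⌊D * x⌋ + 1) / D := by gcongr; linarith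
  rw [cellIntegral, intervalIntegral.integral_of_le hle]
  refine (enorm_integral_le_lintegral_enorm _).trans (lintegral_Ioc_le_localMass ?_ ?_ hf)
  · have := le_floor_add_one_div hD x
    rw [add_div] at this
    linarith
  · rw [add_div]
    have := floor_div_le hD x
    linarith

theorem integral_stepMean (hD : 0 < D) {n : ℤ} {x : ℝ} (h1 : (n / D : ℝ) ≤ x)
    (h2 : x ≤ (n + 1) / D) :
    ∫ y in (n / D : ℝ)..x, stepMean D f y = (x - n / D) * (D * cellIntegral D f n) := by
  have hD' : (0 : ℝ) < D := by exact_mod_cast hD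
  have e : ∫ y in (n / D : ℝ)..x, stepMean D f y =
      ∫ _ in (n / D : ℝ)..x, (D * cellIntegral D f n) := by
    refine intervalIntegral.integral_congr_Ioo_of_le h1 fun y hy => ?_
    have : ⌊(D : ℝ) * y⌋ = n := by
      rw [Int.floor_eq_iff]
      have h3 := (div_lt_iff₀ hD').1 hy.1
      have h4 := (lt_div_iff₀ hD').1 (hy.2.trans_le h2)
      constructor <;> linarith
    rw [stepMean, this]
  rw [e, intervalIntegral.integral_const, smul_eq_mul]

/-- The step function has the same integral as f over every cell, so the primitive of the difference
vanishes at all grid points. -/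
theorem integral_sub_stepMean_eq_zero (hD : 0 < D) (hf : Integrable f) (n : ℤ) :
    ∫ y in (0 : ℝ)..(n / D), (f y - stepMean D f y) = 0 := by
  have hD' : (0 : ℝ) < D := by exact_mod_cast hD
  have hi : ∀ a b, IntervalIntegrable (fun y => f y - stepMean D f y) volume a b := fun a b =>
    hf.intervalIntegrable.sub (intervalIntegrable_stepMean hf D a b)
  have hcell : ∀ n : ℤ, ∫ y in (n / D : ℝ)..((n + 1) / D), (f y - stepMean D f y) = 0 := fun n => by
    rw [intervalIntegral.integral_sub hf.intervalIntegrable (intervalIntegrable_stepMean hf D _ _),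
      integral_stepMean hD (by gcongr; linarith) le_rfl, cellIntegral]
    field_simp
    ring
  induction n using Int.induction_on with
  | zero => simp
  | succ i ih =>
    rw [← intervalIntegral.integral_add_adjacent_intervals (hi _ _) (hi _ _), ih]
    push_cast
    simpa using hcell i
  | pred i ih =>
    have h := hcell (-i - 1)
    push_cast at h ih ⊢
    rw [sub_add_cancel] at h
    rwa [← intervalIntegral.integral_add_adjacent_intervals (hi _ _) (hi _ _), h, add_zero] at ih

/-- Only the incomplete cell containing x contributes, once through f and once through its step
function. In L_p this makes the primitive of the difference of order ‖f‖_p/D. -/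
theorem enorm_integral_sub_stepMean_le (hD : 0 < D) (hf : Integrable f) (hfm : Measurable f)
    (x : ℝ) : ‖∫ y in (0 : ℝ)..x, (f y - stepMean D f y)‖ₑ ≤ 2 * localMass D f x := by
  have hD' : (0 : ℝ) < D := by exact_mod_cast hD
  have hi : ∀ a b, IntervalIntegrable (fun y => f y - stepMean D f y) volume a b := fun a b =>
    hf.intervalIntegrable.sub (intervalIntegrable_stepMean hf D a b)
  set n := ⌊D * x⌋ with hn
  have h1 : (n / D : ℝ) ≤ x := floor_div_le hD x
  have h2 : x ≤ (n + 1 : ℝ) / D := le_floor_add_one_div hD x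
  rw [← intervalIntegral.integral_add_adjacent_intervals (hi _ (n / D)) (hi _ _),
    integral_sub_stepMean_eq_zero hD hf, zero_add,
    intervalIntegral.integral_sub hf.intervalIntegrable (intervalIntegrable_stepMean hf D _ _),
    integral_stepMean hD h1 h2]
  refine (enorm_sub_le).trans ?_
  rw [two_mul]
  rw [add_div] at h2
  refine add_le_add ?_ ?_
  · rw [intervalIntegral.integral_of_le h1]
    refine (enorm_integral_le_lintegral_enorm _).trans (lintegral_Ioc_le_localMass ?_ ?_ hfm)
    · linarith
    · have : 0 ≤ 1 / (D : ℝ) := by positivity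
      linarith
  · refine le_trans ?_ (enorm_cellIntegral_le hD hfm x)
    rw [← mul_assoc, enorm_mul]
    refine mul_le_of_le_one_left zero_le ?_
    rw [Real.enorm_eq_ofReal_abs, ENNReal.ofReal_le_one, abs_of_nonneg (by
      have : 0 ≤ x - n / D := by linarith
      positivity)]
    calc (x - n / D) * D ≤ 1 / D * D := by gcongr; linarith
      _ = 1 := by field_simp

end StepProjection

/-! ### Averaged differences -/

section Averaging

variable {f : ℝ → ℝ} {D : ℕ} {p : ℝ}

theorem rthDiff_eq_add_sum (r : ℕ) (f : ℝ → ℝ) (u t : ℝ) :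
    rthDiff r f u t = f t + ∑ k ∈ Finset.range r,
      (r.choose (k + 1) : ℝ) * (-1) ^ (k + 1) * f (t + (k + 1) * u) := by
  rw [rthDiff, Finset.sum_range_succ']
  simp [add_comm]

/-- Integrating over the step of a difference, `f` is controlled through its step projection. -/
theorem enorm_integral_comp_add_mul_le (hD : 0 < D) (hf : Integrable f) (hfm : Measurable f)
    {c : ℝ} (hc : 1 ≤ |c|) {h : ℝ} (hh : 0 < h) (t : ℝ) :
    ‖∫ u in h..2 * h, f (t + c * u)‖ₑ ≤ (∫⁻ u in Icc h (2 * h), ‖stepMean D f (t + c * u)‖ₑ) +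
      (2 * localMass D f (t + c * (2 * h)) + 2 * localMass D f (t + c * h)) := by
  have hc0 : c ≠ 0 := fun h => by
    rw [h, abs_zero] at hc
    linarith
  have hle : h ≤ 2 * h := by linarith
  have hi : ∀ a b, IntervalIntegrable (fun y => f y - stepMean D f y) volume a b := fun a b =>
    hf.intervalIntegrable.sub (intervalIntegrable_stepMean hf D a b)
  have hcomp : ∀ {g : ℝ → ℝ}, (∀ a b, IntervalIntegrable g volume a b) →
      IntervalIntegrable (fun u => g (t + c * u)) volume h (2 * h) := fun {g} hg => by
    have h1 := ((hg (c * h + t) (c * (2 * h) + t)).comp_add_right t).comp_mul_left (c := c)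
    simp only [add_sub_cancel_right, mul_div_cancel_left₀ _ hc0] at h1
    exact h1.congr fun u _ => by simp only [add_comm]
  have e : ∫ u in h..2 * h, f (t + c * u) = (∫ u in h..2 * h, stepMean D f (t + c * u)) +
      ∫ u in h..2 * h, (f (t + c * u) - stepMean D f (t + c * u)) := by
    rw [← intervalIntegral.integral_add (hcomp fun a b => intervalIntegrable_stepMean hf D a b)
      (hcomp (g := fun y => f y - stepMean D f y) hi)]
    simp
  rw [e]
  refine (enorm_add_le _ _).trans (add_le_add ?_ ?_)
  · rw [intervalIntegral.integral_of_le hle]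
    exact (enorm_integral_le_lintegral_enorm _).trans (lintegral_mono_set Ioc_subset_Icc_self)
  -- After substitution this is the increment of a primitive between two points, hence the two local
  -- masses. The Jacobian 1/|c| is at most 1.
  · rw [intervalIntegral.integral_comp_add_mul (fun y => f y - stepMean D f y) hc0,
      ← intervalIntegral.integral_interval_sub_left (hi 0 _) (hi 0 _), enorm_smul]
    refine (mul_le_of_le_one_left zero_le ?_).trans (enorm_sub_le.trans (add_le_add
      (enorm_integral_sub_stepMean_le hD hf hfm _) (enorm_integral_sub_stepMean_le hD hf hfm _)))
    rw [Real.enorm_eq_ofReal_abs, ENNReal.ofReal_le_one, abs_inv]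
    exact inv_le_one_of_one_le₀ hc

/-- The value f(t) enters the r-th difference with coefficient 1, so it can be solved for. Averaging
over the step u in [h, 2h] turns the other terms into integrals of f, which the step projection
reproduces up to local masses. The sign e selects forward or backward differences. -/
theorem ofReal_mul_enorm_le (hD : 0 < D) (hf : Integrable f) (hfm : Measurable f) (r : ℕ)
    {e : ℝ} (he : |e| = 1) {h : ℝ} (hh : 0 < h) (t : ℝ) :
    ENNReal.ofReal h * ‖f t‖ₑ ≤ (∫⁻ u in Icc h (2 * h), ‖rthDiff r f (e * u) t‖ₑ) +
      ∑ k ∈ Finset.range r, (r.choose (k + 1) : ℝ≥0∞) *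
        ((∫⁻ u in Icc h (2 * h), ‖stepMean D f (t + (k + 1) * e * u)‖ₑ) +
          (2 * localMass D f (t + (k + 1) * e * (2 * h)) +
            2 * localMass D f (t + (k + 1) * e * h))) := by
  have hle : h ≤ 2 * h := by linarith
  have he0 : e ≠ 0 := fun h => by simp [h] at he
  have hk0 : ∀ k : ℕ, ((k : ℝ) + 1) * e ≠ 0 := fun k => mul_ne_zero (by positivity) he0
  have hi : ∀ k : ℕ, IntervalIntegrable (fun u => f (t + (k + 1) * e * u)) volume h (2 * h) :=
    fun k => by
      have h1 := (hf.comp_add_left t).comp_mul_left' (hk0 k)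
      exact h1.intervalIntegrable
  have hsplit : ∀ u, f t = rthDiff r f (e * u) t - ∑ k ∈ Finset.range r,
      (r.choose (k + 1) : ℝ) * (-1) ^ (k + 1) * f (t + (k + 1) * e * u) := fun u => by
    rw [rthDiff_eq_add_sum]
    simp only [mul_assoc]
    ring
  have hsum : IntervalIntegrable (fun u => ∑ k ∈ Finset.range r,
      (r.choose (k + 1) : ℝ) * (-1) ^ (k + 1) * f (t + (k + 1) * e * u)) volume h (2 * h) := by
    have := IntervalIntegrable.sum (Finset.range r) fun k _ =>
      (hi k).const_mul ((r.choose (k + 1) : ℝ) * (-1) ^ (k + 1))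
    exact this.congr fun u _ => Finset.sum_apply u _ _
  have hdiff : IntervalIntegrable (fun u => rthDiff r f (e * u) t) volume h (2 * h) := by
    have h1 : ∀ u, rthDiff r f (e * u) t = f t + ∑ k ∈ Finset.range r,
        (r.choose (k + 1) : ℝ) * (-1) ^ (k + 1) * f (t + (k + 1) * e * u) := fun u => by
      linarith [hsplit u]
    simp_rw [h1]
    exact intervalIntegrable_const.add hsum
  have hint : h * f t = (∫ u in h..2 * h, rthDiff r f (e * u) t) - ∑ k ∈ Finset.range r,
      (r.choose (k + 1) : ℝ) * (-1) ^ (k + 1) * ∫ u in h..2 * h, f (t + (k + 1) * e * u) := by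
    have h1 : h * f t = ∫ _ in h..2 * h, f t := by
      rw [intervalIntegral.integral_const, smul_eq_mul]
      ring
    rw [h1, intervalIntegral.integral_congr fun u _ => hsplit u,
      intervalIntegral.integral_sub hdiff hsum,
      intervalIntegral.integral_finsetSum fun k _ => (hi k).const_mul _]
    simp only [intervalIntegral.integral_const_mul]
  have hleft : ENNReal.ofReal h * ‖f t‖ₑ = ‖h * f t‖ₑ := by
    rw [enorm_mul, Real.enorm_eq_ofReal_abs h, abs_of_pos hh]
  rw [hleft, hint]
  refine enorm_sub_le.trans (add_le_add ?_ ?_)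
  · rw [intervalIntegral.integral_of_le hle]
    exact (enorm_integral_le_lintegral_enorm _).trans (lintegral_mono_set Ioc_subset_Icc_self)
  · refine (enorm_sum_le _ _).trans (Finset.sum_le_sum fun k _ => ?_)
    rw [enorm_mul, enorm_mul, enorm_pow, enorm_neg, enorm_one, one_pow, mul_one]
    refine mul_le_mul' (le_of_eq (by simp)) (enorm_integral_comp_add_mul_le hD hf hfm ?_ hh t)
    rw [abs_mul, he, mul_one, abs_of_nonneg (by positivity)]
    have : (0 : ℝ) ≤ k := Nat.cast_nonneg k
    linarith

theorem setLIntegral_Icc_le {a b : ℝ} {g : ℝ → ℝ≥0∞} {c : ℝ≥0∞} (h : ∀ u, g u ≤ c) :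
    ∫⁻ u in Icc a b, g u ≤ ENNReal.ofReal (b - a) * c := by
  calc _ ≤ ∫⁻ _ in Icc a b, c := lintegral_mono h
    _ = _ := by rw [setLIntegral_const, Real.volume_Icc, mul_comm]

/-- A local mass integrates translates over a window of length 2/D, so Minkowski's integral
inequality applies. This small factor is later absorbed by taking D large. -/
theorem lintegralNorm_localMass_le (hp : 1 ≤ p) (hfm : Measurable f) (S : Set ℝ)
    [IsFiniteMeasure (volume.restrict S)] (c : ℝ) :
    lintegralNorm p (volume.restrict S) (fun t => localMass D f (t + c)) ≤
      ENNReal.ofReal (2 / D) * lintegralNorm p volume fun t => ‖f t‖ₑ := by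
  unfold localMass
  refine (lintegralNorm_lintegral_le hp (g := fun t y => ‖f (t + c + y)‖ₑ) (by fun_prop)).trans ?_
  refine (setLIntegral_Icc_le (c := lintegralNorm p volume fun t => ‖f t‖ₑ) fun y => ?_).trans
    (le_of_eq ?_)
  · simp_rw [add_assoc]
    exact lintegralNorm_comp_add_le hp S (fun t => ‖f t‖ₑ) (c + y)
  · congr 2
    ring

/-- The averaging argument bounding a function by its differences and its step projection. -/
theorem ofReal_mul_lintegralNorm_le (hp : 1 ≤ p) (hD : 0 < D) (hf : Integrable f)
    (hfm : Measurable f) (r : ℕ) {e : ℝ} (he : |e| = 1) {h : ℝ} (hh : 0 < h) (S : Set ℝ)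
    [IsFiniteMeasure (volume.restrict S)] :
    ENNReal.ofReal h * lintegralNorm p (volume.restrict S) (fun t => ‖f t‖ₑ) ≤
      (∫⁻ u in Icc h (2 * h), lintegralNorm p (volume.restrict S)
        fun t => ‖rthDiff r f (e * u) t‖ₑ) +
      2 ^ r * (ENNReal.ofReal h * (lintegralNorm p volume fun t => ‖stepMean D f t‖ₑ) +
        ENNReal.ofReal (8 / D) * lintegralNorm p volume fun t => ‖f t‖ₑ) := by
  set F := lintegralNorm p volume fun t => ‖f t‖ₑ with hF
  set G := lintegralNorm p volume fun t => ‖stepMean D f t‖ₑ with hG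
  have hsm := measurable_stepMean D f
  have hlm := measurable_localMass hfm D
  have hdm : Measurable (Function.uncurry fun t u => ‖rthDiff r f (e * u) t‖ₑ) := by
    unfold rthDiff
    fun_prop
  have hstepm : ∀ k : ℕ, Measurable (Function.uncurry fun t u : ℝ =>
      ‖stepMean D f (t + (k + 1) * e * u)‖ₑ) := fun k => by fun_prop
  have hm1 : Measurable fun t => ∫⁻ u in Icc h (2 * h), ‖rthDiff r f (e * u) t‖ₑ :=
    hdm.lintegral_prod_right'
  have hm2 : ∀ k : ℕ, Measurable fun t => ∫⁻ u in Icc h (2 * h),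
      ‖stepMean D f (t + (k + 1) * e * u)‖ₑ := fun k => (hstepm k).lintegral_prod_right'
  have hm3 : ∀ c : ℝ, Measurable fun t => 2 * localMass D f (t + c) := fun c => by fun_prop
  have hm4 : ∀ k : ℕ, Measurable fun t => (∫⁻ u in Icc h (2 * h),
      ‖stepMean D f (t + (k + 1) * e * u)‖ₑ) + (2 * localMass D f (t + (k + 1) * e * (2 * h)) +
            2 * localMass D f (t + (k + 1) * e * h)) := fun k =>
    (hm2 k).add ((hm3 _).add (hm3 _))
  rw [← lintegralNorm_const_mul hp _ hfm.enorm]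
  refine (lintegralNorm_mono hp fun t => ofReal_mul_enorm_le hD hf hfm r he hh t).trans ?_
  refine (lintegralNorm_add_le hp hm1 (Finset.measurable_sum _ fun k _ =>
    (hm4 k).const_mul _)).trans (add_le_add (lintegralNorm_lintegral_le hp hdm) ?_)
  refine (lintegralNorm_sum_le hp _ fun k => (hm4 k).const_mul _).trans ?_
  have hterm : ∀ k : ℕ, lintegralNorm p (volume.restrict S) (fun t => (r.choose (k + 1) : ℝ≥0∞) *
      ((∫⁻ u in Icc h (2 * h), ‖stepMean D f (t + (k + 1) * e * u)‖ₑ) +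
        (2 * localMass D f (t + (k + 1) * e * (2 * h)) +
          2 * localMass D f (t + (k + 1) * e * h)))) ≤
      (r.choose (k + 1) : ℝ≥0∞) * (ENNReal.ofReal h * G + ENNReal.ofReal (8 / D) * F) := fun k => by
    rw [lintegralNorm_const_mul hp _ (hm4 k)]
    gcongr
    refine (lintegralNorm_add_le hp (hm2 k) ((hm3 _).add (hm3 _))).trans (add_le_add ?_ ?_)
    · refine (lintegralNorm_lintegral_le hp (hstepm k)).trans ?_
      refine (setLIntegral_Icc_le (c := G) fun u =>
        lintegralNorm_comp_add_le hp S (fun t => ‖stepMean D f t‖ₑ) _).trans (le_of_eq ?_)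
      congr 2
      ring
    · refine (lintegralNorm_add_le hp (hm3 _) (hm3 _)).trans ?_
      rw [lintegralNorm_const_mul hp _ (by fun_prop), lintegralNorm_const_mul hp _ (by fun_prop)]
      refine (add_le_add (mul_le_mul_right (lintegralNorm_localMass_le hp hfm S _) _)
        (mul_le_mul_right (lintegralNorm_localMass_le hp hfm S _) _)).trans (le_of_eq ?_)
      rw [← hF, ← mul_assoc, ← add_mul]
      congr 1
      rw [← two_mul, ← ENNReal.ofReal_ofNat, ← ENNReal.ofReal_mul (by positivity),
        ← ENNReal.ofReal_mul (by positivity)]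
      congr 1
      ring
  refine (Finset.sum_le_sum fun k _ => hterm k).trans ?_
  rw [← Finset.sum_mul]
  gcongr
  have h3 := Nat.sum_range_choose r
  rw [Finset.sum_range_succ'] at h3
  have h4 : ∑ k ∈ Finset.range r, r.choose (k + 1) ≤ 2 ^ r := by omega
  exact_mod_cast h4

end Averaging

/-! ### Cell means of Besov functions -/

section Projection

variable {f : ℝ → ℝ} {r : ℕ} {s p : ℝ} {q : ℝ≥0∞}

theorem diffNorm_congr {g : ℝ → ℝ} (h : f =ᵐ[unitVolume] g) {u : ℝ} (hu : 0 ≤ u) :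
    diffNorm r p f u = diffNorm r p g u := by
  refine eLpNorm_congr_ae ?_
  have h0 : ∀ᵐ x, x ∈ Icc (0 : ℝ) 1 → f x = g x := (ae_restrict_iff' measurableSet_Icc).1 h
  have h1 : ∀ᵐ t, ∀ k : ℕ, t + k * u ∈ Icc (0 : ℝ) 1 → f (t + k * u) = g (t + k * u) := by
    rw [ae_all_iff]
    exact fun k => (measurePreserving_add_right volume ((k : ℝ) * u)).quasiMeasurePreserving.ae h0
  refine (ae_restrict_iff' measurableSet_Icc).2 ?_
  filter_upwards [h1] with t ht htu
  refine Finset.sum_congr rfl fun k hk => ?_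
  have hk' : (k : ℝ) ≤ r := by exact_mod_cast Nat.lt_succ_iff.1 (Finset.mem_range.1 hk)
  have h2 : (k : ℝ) * u ≤ r * u := by gcongr
  rw [ht k ⟨by have := htu.1; positivity, by linarith [htu.2]⟩]

theorem cellMean_congr {g : ℝ → ℝ} (h : f =ᵐ[unitVolume] g) {D : ℕ} :
    cellMean D f = cellMean D g := by
  have h0 : ∀ᵐ x, x ∈ Icc (0 : ℝ) 1 → f x = g x := (ae_restrict_iff' measurableSet_Icc).1 h
  ext i
  have hD : (0 : ℝ) < D := by exact_mod_cast i.pos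
  have hle : (i / D : ℝ) ≤ (i + 1) / D := by gcongr; linarith
  unfold cellMean
  congr 1
  refine intervalIntegral.integral_congr_ae ?_
  filter_upwards [h0] with x hx hxi
  rw [uIoc_of_le hle] at hxi
  have hi : ((i : ℕ) : ℝ) + 1 ≤ D := by exact_mod_cast i.2
  have hi0 : (0 : ℝ) ≤ (i : ℕ) / D := by positivity
  exact hx ⟨by linarith [hxi.1], hxi.2.trans ((div_le_one hD).2 hi)⟩

/-- Norms, differences and cell means see f only almost everywhere on [0,1], so f may be replaced by
a Borel function on the line, to which the averaging argument applies. -/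
theorem exists_measurable_eq_zero_off (hf : MemLp f 2 unitVolume) :
    ∃ g : ℝ → ℝ, Measurable g ∧ Integrable g ∧ (∀ x, x ∉ Icc (0 : ℝ) 1 → g x = 0) ∧
      f =ᵐ[unitVolume] g := by
  have hae : f =ᵐ[unitVolume] (Icc 0 1).indicator (hf.1.mk f) :=
    hf.1.ae_eq_mk.trans (indicator_ae_eq_restrict measurableSet_Icc).symm
  refine ⟨(Icc 0 1).indicator (hf.1.mk f), hf.1.stronglyMeasurable_mk.measurable.indicator
    measurableSet_Icc, ?_, fun x hx => indicator_of_notMem hx _, hae⟩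
  rw [integrable_indicator_iff measurableSet_Icc]
  exact (hf.integrable one_le_two).congr hf.1.ae_eq_mk

theorem lintegral_le_rpow_mul {μ : Measure ℝ} [IsFiniteMeasure μ] {q : ℝ} (hq : 1 ≤ q)
    {δ : ℝ → ℝ≥0∞} (hδ : Measurable δ) :
    ∫⁻ u, δ u ∂μ ≤ (∫⁻ u, δ u ^ q ∂μ) ^ (1 / q) * μ univ ^ (1 - 1 / q) := by
  have h := eLpNorm'_le_eLpNorm'_mul_rpow_measure_univ (μ := μ) (f := δ) zero_lt_one hq
    hδ.aestronglyMeasurable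
  simpa [eLpNorm'] using h

/-- The local average of the moduli of a function in a Besov ball. -/
theorem setLIntegral_le_of_besovNorm_le (hs : 0 < s) (hq : 1 ≤ q) {L : ℝ} (hL : 0 ≤ L)
    (hf : besovNorm r s p q f ≤ ENNReal.ofReal L) {δ : ℝ → ℝ≥0∞} (hδ : Measurable δ) {h : ℝ}
    (hh : 0 < h) (hh1 : 2 * h < 1) (hle : ∀ u ∈ Icc h (2 * h), δ u ≤ diffNorm r p f u) :
    ∫⁻ u in Icc h (2 * h), δ u ≤ ENNReal.ofReal (2 * h * ((2 * h) ^ s * L)) := by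
  have h2 : 0 < 2 * h := by linarith
  have hsem := (le_add_self.trans hf : (if q = ∞ then _ else _) ≤ ENNReal.ofReal L)
  by_cases hqt : q = ∞
  · rw [if_pos hqt] at hsem
    have h1 : ∀ u ∈ Icc h (2 * h), δ u ≤ ENNReal.ofReal ((2 * h) ^ s * L) := fun u hu => by
      have hu0 : 0 < u := hh.trans_le hu.1
      have hus : 0 < u ^ s := Real.rpow_pos_of_pos hu0 s
      have h3 : diffNorm r p f u / ENNReal.ofReal (u ^ s) ≤ ENNReal.ofReal L :=
        (le_iSup₂ (f := fun u (_ : u ∈ Ioo (0 : ℝ) 1) => diffNorm r p f u / ENNReal.ofReal (u ^ s))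
          u ⟨hu0, hu.2.trans_lt hh1⟩).trans hsem
      rw [ENNReal.div_le_iff (by simpa using hus) ENNReal.ofReal_ne_top,
        ← ENNReal.ofReal_mul hL] at h3
      refine (hle u hu).trans (h3.trans (ENNReal.ofReal_le_ofReal ?_))
      rw [mul_comm]
      gcongr
      exact hu.2
    calc _ ≤ ∫⁻ _ in Icc h (2 * h), ENNReal.ofReal ((2 * h) ^ s * L) :=
          setLIntegral_mono' measurableSet_Icc h1
      _ = ENNReal.ofReal (h * ((2 * h) ^ s * L)) := by
          rw [setLIntegral_const, Real.volume_Icc, mul_comm, ← ENNReal.ofReal_mul (by linarith)]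
          congr 2
          ring
      _ ≤ _ := by
          refine ENNReal.ofReal_le_ofReal ?_
          gcongr
          linarith
  · rw [if_neg hqt] at hsem
    have hq1 : 1 ≤ q.toReal := by
      rw [← ENNReal.toReal_one]
      exact ENNReal.toReal_mono hqt hq
    set q' := q.toReal with hq'
    have hq0 : 0 < q' := by linarith
    -- For u ≤ 2h the Besov weight u^{-sq-1} is at least its value at 2h, so an unweighted q-th
    -- moment over the window is controlled; Hölder then reduces it to the first moment.
    have hpt : ∀ u ∈ Icc h (2 * h), δ u ^ q' ≤ ENNReal.ofReal ((2 * h) ^ (s * q' + 1)) *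
        ((diffNorm r p f u / ENNReal.ofReal (u ^ s)) ^ q' / ENNReal.ofReal u) := fun u hu => by
      have hu0 : 0 < u := hh.trans_le hu.1
      have hus : 0 < u ^ s := Real.rpow_pos_of_pos hu0 s
      have e : diffNorm r p f u ^ q' = ENNReal.ofReal (u ^ (s * q' + 1)) *
          ((diffNorm r p f u / ENNReal.ofReal (u ^ s)) ^ q' / ENNReal.ofReal u) := by
        rw [ENNReal.div_rpow_of_nonneg _ _ hq0.le, ENNReal.ofReal_rpow_of_pos hus,
          ← Real.rpow_mul hu0.le, Real.rpow_add_one hu0.ne', ENNReal.ofReal_mul (by positivity),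
          mul_comm (ENNReal.ofReal _) (ENNReal.ofReal u), mul_assoc, mul_comm, mul_assoc,
          mul_comm _ (ENNReal.ofReal u)]
        have hA : ENNReal.ofReal (u ^ (s * q')) ≠ 0 := by
          simpa using Real.rpow_pos_of_pos hu0 (s * q')
        have hB : ENNReal.ofReal u ≠ 0 := by simpa using hu0
        rw [ENNReal.mul_div_cancel hB ENNReal.ofReal_ne_top,
          ENNReal.mul_div_cancel hA ENNReal.ofReal_ne_top]
      refine (ENNReal.rpow_le_rpow (hle u hu) hq0.le).trans ?_
      rw [e]
      refine mul_le_mul_left (ENNReal.ofReal_le_ofReal ?_) _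
      exact Real.rpow_le_rpow hu0.le hu.2 (by positivity)
    have hint : ∫⁻ u in Icc h (2 * h), δ u ^ q' ≤ ENNReal.ofReal ((2 * h) ^ (s * q' + 1)) *
        ENNReal.ofReal L ^ q' := by
      refine (setLIntegral_mono' measurableSet_Icc hpt).trans ?_
      rw [lintegral_const_mul' _ _ ENNReal.ofReal_ne_top]
      gcongr
      rw [one_div, ENNReal.rpow_inv_le_iff hq0] at hsem
      exact (lintegral_mono_set fun u hu => hh.trans_le hu.1).trans hsem
    refine (lintegral_le_rpow_mul hq1 hδ).trans ?_
    have hq1' : 0 ≤ 1 - 1 / q' := by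
      rw [sub_nonneg, div_le_one hq0]
      exact hq1
    calc _ ≤ (ENNReal.ofReal ((2 * h) ^ (s * q' + 1)) * ENNReal.ofReal L ^ q') ^ (1 / q') *
          ENNReal.ofReal (2 * h) ^ (1 - 1 / q') := by
          gcongr
          rw [Measure.restrict_apply_univ, Real.volume_Icc]
          exact ENNReal.ofReal_le_ofReal (by linarith)
      _ = ENNReal.ofReal (2 * h * ((2 * h) ^ s * L)) := by
          rw [ENNReal.ofReal_rpow_of_nonneg hL hq0.le, ← ENNReal.ofReal_mul (by positivity),
            ENNReal.ofReal_rpow_of_nonneg (by positivity) (by positivity),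
            ENNReal.ofReal_rpow_of_nonneg h2.le hq1', ← ENNReal.ofReal_mul (by positivity),
            Real.mul_rpow (by positivity) (by positivity), ← Real.rpow_mul h2.le,
            ← Real.rpow_mul hL, mul_one_div_cancel hq0.ne', Real.rpow_one, mul_right_comm,
            ← Real.rpow_add h2]
          congr 1
          rw [show (s * q' + 1) * (1 / q') + (1 - 1 / q') = 1 + s by field_simp; ring,
            Real.rpow_add h2, Real.rpow_one]
          ring

theorem lintegralNorm_eq_unitLpNorm (hp : 1 ≤ p) {g : ℝ → ℝ}
    (hg : ∀ x, x ∉ Icc (0 : ℝ) 1 → g x = 0) :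
    lintegralNorm p volume (fun t => ‖g t‖ₑ) = unitLpNorm p g := by
  rw [unitLpNorm, eLpNorm_restrict_eq_of_support_subset
    (fun x hx => by_contra fun h => hx (hg x h)), eLpNorm_ofReal_eq hp]
  rfl

theorem cellIntegral_eq_zero {D : ℕ} (hD : 0 < D) {g : ℝ → ℝ}
    (hg : ∀ x, x ∉ Icc (0 : ℝ) 1 → g x = 0) {n : ℤ} (hn : n < 0 ∨ (D : ℤ) ≤ n) :
    cellIntegral D g n = 0 := by
  have hD' : (0 : ℝ) < D := by exact_mod_cast hD
  have hle : (n / D : ℝ) ≤ (n + 1) / D := by gcongr; linarith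
  rw [cellIntegral, intervalIntegral.integral_congr_Ioo_of_le (g := fun _ => 0) hle]
  · simp
  · intro y hy
    refine hg y fun hy01 => ?_
    rcases hn with hn | hn
    · have h1 : (n : ℝ) + 1 ≤ 0 := by exact_mod_cast hn
      have h2 := (lt_div_iff₀ hD').1 hy.2
      nlinarith [hy01.1]
    · have h1 : (D : ℝ) ≤ n := by exact_mod_cast hn
      have h2 := (div_lt_iff₀ hD').1 hy.1
      nlinarith [hy01.2]

theorem stepMean_eq_sum {D : ℕ} (hD : 0 < D) {g : ℝ → ℝ}
    (hg : ∀ x, x ∉ Icc (0 : ℝ) 1 → g x = 0) (x : ℝ) :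
    stepMean D g x = ∑ i : Fin D, (√D * cellMean D g i) *
      (Ico (0 : ℝ) 1).indicator (fun _ => (1 : ℝ)) (D * x - (i : ℕ)) := by
  have hD' : (0 : ℝ) < D := by exact_mod_cast hD
  have hmem : ∀ i : Fin D, ((D * x - (i : ℕ)) ∈ Ico (0 : ℝ) 1 ↔ ⌊D * x⌋ = (i : ℕ)) := fun i => by
    rw [Int.floor_eq_iff, mem_Ico]
    push_cast
    constructor <;> rintro ⟨h1, h2⟩ <;> constructor <;> linarith
  by_cases hn : ⌊D * x⌋ < 0 ∨ (D : ℤ) ≤ ⌊D * x⌋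
  · rw [stepMean, cellIntegral_eq_zero hD hg hn, mul_zero, eq_comm]
    refine Finset.sum_eq_zero fun i _ => ?_
    rw [indicator_of_notMem, mul_zero]
    rw [hmem]
    have := i.2
    omega
  · push Not at hn
    obtain ⟨n, hn'⟩ := Int.eq_ofNat_of_zero_le hn.1
    have hnD : n < D := by omega
    rw [Finset.sum_eq_single ⟨n, hnD⟩]
    · rw [indicator_of_mem ((hmem _).2 hn'), mul_one, stepMean, hn', cellMean, ← mul_assoc,
        Real.mul_self_sqrt hD'.le, cellIntegral]
      simp
    · intro i _ hi
      rw [indicator_of_notMem, mul_zero]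
      rw [hmem, hn']
      intro h
      refine hi (Fin.ext ?_)
      simp only
      omega
    · simp

/-- On a cell of width 1/D the step function takes the value √D times the normalised mean, whence
the exponent 1/2 - 1/p. -/
theorem lintegralNorm_stepMean (hp : 1 ≤ p) {D : ℕ} (hD : 0 < D) {g : ℝ → ℝ}
    (hg : ∀ x, x ∉ Icc (0 : ℝ) 1 → g x = 0) :
    lintegralNorm p volume (fun t => ‖stepMean D g t‖ₑ) =
      ENNReal.ofReal ((D : ℝ) ^ (1 / 2 - 1 / p) * lpNorm p (cellMean D g)) := by
  have hD' : (0 : ℝ) < D := by exact_mod_cast hD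
  have hp0 : 0 < p := by linarith
  have hψ : Measurable ((Ico (0 : ℝ) 1).indicator fun _ => (1 : ℝ)) :=
    measurable_const.indicator measurableSet_Ico
  have hone : ∫⁻ t, ‖(Ico (0 : ℝ) 1).indicator (fun _ => (1 : ℝ)) t‖ₑ ^ p = 1 := by
    have : ∀ t, ‖(Ico (0 : ℝ) 1).indicator (fun _ => (1 : ℝ)) t‖ₑ ^ p =
        (Ico (0 : ℝ) 1).indicator (fun _ => (1 : ℝ≥0∞)) t := fun t => by
      by_cases ht : t ∈ Ico (0 : ℝ) 1
      · simp [ht]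
      · simp [ht, ENNReal.zero_rpow_of_pos hp0]
    simp_rw [this]
    rw [lintegral_indicator measurableSet_Ico, setLIntegral_const, Real.volume_Ico]
    simp
  simp_rw [stepMean_eq_sum hD hg]
  rw [lintegralNorm, lintegral_enorm_sum_rpow_of_disjoint hψ hp0 (N := fun _ : Fin D => (D : ℝ))
    (fun _ => hD') (fun i => ((i : ℕ) : ℝ)), hone, mul_one,
    ENNReal.ofReal_rpow_of_nonneg (by positivity) (by positivity)]
  · congr 1
    rw [← Real.rpow_left_inj (by positivity) (mul_nonneg (by positivity) (lpNorm_nonneg _ _)) hp0.ne',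
      ← Real.rpow_mul (by positivity), one_div_mul_cancel hp0.ne', Real.rpow_one,
      Real.mul_rpow (by positivity) (lpNorm_nonneg _ _), lpNorm_rpow hp, Finset.mul_sum,
      ← Real.rpow_mul hD'.le]
    refine Finset.sum_congr rfl fun i _ => ?_
    rw [abs_mul, Real.mul_rpow (abs_nonneg _) (abs_nonneg _), abs_of_nonneg (Real.sqrt_nonneg _),
      Real.sqrt_eq_rpow, ← Real.rpow_mul hD'.le, mul_div_right_comm, ← Real.rpow_sub_one hD'.ne']
    congr 2
    field_simp
  · intro t i j hij
    by_contra! h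
    have h1 := mem_of_indicator_ne_zero h.1
    have h2 := mem_of_indicator_ne_zero h.2
    have h3 : ((i : ℕ) : ℝ) < (j : ℕ) + 1 := by linarith [h1.1, h2.2]
    have h4 : ((j : ℕ) : ℝ) < (i : ℕ) + 1 := by linarith [h1.2, h2.1]
    have h5 : (i : ℕ) < j + 1 := by exact_mod_cast h3
    have h6 : (j : ℕ) < i + 1 := by exact_mod_cast h4
    exact hij (Fin.ext (by omega))

/-- The cell means are bounded in terms of the `L_p` norm. -/
theorem lpNorm_cellMean_le (hp : 1 ≤ p) {D : ℕ} (hD : 0 < D) (hf : MemLp f 2 unitVolume) {ε : ℝ}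
    (hε : 0 ≤ ε) (h : unitLpNorm p f ≤ ENNReal.ofReal ε) :
    (D : ℝ) ^ (1 / 2 - 1 / p) * lpNorm p (cellMean D f) ≤ 2 * ε := by
  have hD' : (0 : ℝ) < D := by exact_mod_cast hD
  have hp0 : 0 < p := by linarith
  obtain ⟨g, hgm, hgi, hg0, hfg⟩ := exists_measurable_eq_zero_off hf
  rw [unitLpNorm, eLpNorm_congr_ae hfg, ← unitLpNorm, ← lintegralNorm_eq_unitLpNorm hp hg0] at h
  rw [cellMean_congr hfg, ← ENNReal.ofReal_le_ofReal_iff (by positivity),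
    ← lintegralNorm_stepMean hp hD hg0]
  have h1 : lintegralNorm p volume (fun t => ‖stepMean D g t‖ₑ) =
      lintegralNorm p (volume.restrict (Icc 0 1)) (fun t => ‖stepMean D g t‖ₑ) := by
    rw [lintegralNorm, lintegralNorm, setLIntegral_eq_of_support_subset]
    intro t ht
    by_contra h2
    refine ht ?_
    simp only
    have h3 : cellIntegral D g ⌊D * t⌋ = 0 := by
      refine cellIntegral_eq_zero hD hg0 ?_
      rw [mem_Icc, not_and_or, not_le, not_le] at h2
      rcases h2 with h2 | h2
      · left
        rw [Int.floor_lt]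
        push_cast
        nlinarith
      · right
        rw [Int.le_floor]
        push_cast
        nlinarith
    rw [stepMean, h3, mul_zero, enorm_zero, ENNReal.zero_rpow_of_pos hp0]
  rw [h1]
  -- The prefactor D cancels against the norm 2/D of the local mass, leaving the constant 2.
  have h2 : ∀ t, ‖stepMean D g t‖ₑ ≤ ENNReal.ofReal D * localMass D g (t + 0) := fun t => by
    rw [stepMean, enorm_mul, add_zero, Real.enorm_eq_ofReal_abs (D : ℝ), abs_of_pos hD']
    gcongr
    exact enorm_cellIntegral_le hD hgm t
  refine (lintegralNorm_mono hp h2).trans ?_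
  rw [lintegralNorm_const_mul hp _ (by simpa using measurable_localMass hgm D)]
  refine (mul_le_mul_right (lintegralNorm_localMass_le hp hgm _ 0) _).trans ?_
  rw [← mul_assoc, ← ENNReal.ofReal_mul hD'.le, mul_div_cancel₀ _ hD'.ne',
    ENNReal.ofReal_mul two_pos.le]
  gcongr

/-- On a Besov ball, the `L_p` norm is controlled by the cell means up to the smoothness scale. -/
theorem exists_le_lpNorm_cellMean (hs : 0 < s) (hr : s < r) (hp : 1 ≤ p) (hq : 1 ≤ q) {L : ℝ}
    (hL : 0 < L) : ∃ (m : ℕ) (C : ℝ), 1 ≤ m ∧ 0 < C ∧ ∀ (d : ℕ) (f : ℝ → ℝ) (ε : ℝ), 1 ≤ d →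
      MemLp f 2 unitVolume → 0 ≤ ε → besovNorm r s p q f ≤ ENNReal.ofReal L →
      ENNReal.ofReal ε ≤ unitLpNorm p f →
      ε ≤ C * (((m * d : ℕ) : ℝ) ^ (1 / 2 - 1 / p) * lpNorm p (cellMean (m * d) f) +
        (d : ℝ) ^ (-s)) := by
  have hr0 : 0 < r := by
    have : (0 : ℝ) < r := hs.trans hr
    exact_mod_cast this
  have hr' : (1 : ℝ) ≤ r := by exact_mod_cast hr0
  have hp0 : 0 < p := by linarith
  -- The number m of cells per unit of d is fixed so that the local-mass error is exactly half of
  -- the left-hand side (`hDh`) and can be absorbed.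
  refine ⟨128 * r * 2 ^ r, 8 * L + 4 * 2 ^ r, Nat.mul_pos (by omega) (by positivity), by positivity,
    fun d f ε hd hf hε hbes hεf => ?_⟩
  have hd' : (1 : ℝ) ≤ d := by exact_mod_cast hd
  set D := 128 * r * 2 ^ r * d with hDdef
  have hD : 0 < D := by positivity
  obtain ⟨g, hgm, hgi, hg0, hfg⟩ := exists_measurable_eq_zero_off hf
  have hnorm : unitLpNorm p f = unitLpNorm p g := eLpNorm_congr_ae hfg
  -- Steps up to 2h satisfy r·2h ≤ 1/2, so forward differences starting in [0,1/2] and backward ones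
  -- starting in [1/2,1] stay inside [0,1].
  set h : ℝ := 1 / (4 * r * d) with hh
  have hh0 : 0 < h := by positivity
  have hrh : r * (2 * h) ≤ 1 / 2 := by
    rw [hh]
    field_simp
    linarith
  have h2d : 2 * h ≤ 1 / d := by
    rw [hh, le_div_iff₀ (by positivity)]
    field_simp
    linarith
  have hh1 : 2 * h < 1 := by nlinarith
  set F := lintegralNorm p volume fun t => ‖g t‖ₑ with hF
  have hFu : F = unitLpNorm p f := by rw [hnorm, hF, lintegralNorm_eq_unitLpNorm hp hg0]
  have hFtop : F ≠ ∞ := by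
    rw [hFu]
    exact ne_top_of_le_ne_top ENNReal.ofReal_ne_top (le_self_add.trans hbes)
  set G := (D : ℝ) ^ (1 / 2 - 1 / p) * lpNorm p (cellMean D g) with hG
  have hG0 : 0 ≤ G := mul_nonneg (by positivity) (lpNorm_nonneg _ _)
  have hmeas : ∀ (S : Set ℝ) (e : ℝ), Measurable fun u =>
      lintegralNorm p (volume.restrict S) fun t => ‖rthDiff r g (e * u) t‖ₑ := fun S e => by
    unfold lintegralNorm
    refine Measurable.pow_const ?_ _
    refine Measurable.lintegral_prod_left (f := fun t u => ‖rthDiff r g (e * u) t‖ₑ ^ p) ?_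
    unfold rthDiff
    fun_prop
  have hdn : ∀ u, diffNorm r p g u =
      (∫⁻ t in Icc 0 (1 - r * u), ‖rthDiff r g u t‖ₑ ^ p) ^ (1 / p) := fun u =>
    eLpNorm_ofReal_eq hp _ _
  have hδ₁ : ∀ u ∈ Icc h (2 * h), lintegralNorm p (volume.restrict (Icc 0 (1 / 2)))
      (fun t => ‖rthDiff r g (1 * u) t‖ₑ) ≤ diffNorm r p f u := fun u hu => by
    have hru : r * u ≤ r * (2 * h) := by gcongr; exact hu.2
    rw [diffNorm_congr hfg (hh0.le.trans hu.1), hdn, one_mul]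
    refine ENNReal.rpow_le_rpow (lintegral_mono_set ?_) (by positivity)
    exact Icc_subset_Icc_right (by linarith)
  have hδ₂ : ∀ u ∈ Icc h (2 * h), lintegralNorm p (volume.restrict (Icc (1 / 2) 1))
      (fun t => ‖rthDiff r g (-1 * u) t‖ₑ) ≤ diffNorm r p f u := fun u hu => by
    have hru : r * u ≤ r * (2 * h) := by gcongr; exact hu.2
    rw [diffNorm_congr hfg (hh0.le.trans hu.1), hdn]
    refine ENNReal.rpow_le_rpow ?_ (by positivity)
    -- Up to sign, a backward difference at t is the forward difference at t - ru, so the same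
    -- modulus controls the right half.
    have hrefl : ∀ t, ‖rthDiff r g (-1 * u) t‖ₑ = ‖rthDiff r g u (t - r * u)‖ₑ := fun t => by
      have : rthDiff r g (-1 * u) t = (-1) ^ r * rthDiff r g u (t - r * u) := by
        rw [rthDiff, rthDiff, ← Finset.sum_range_reflect, Finset.mul_sum]
        refine Finset.sum_congr rfl fun k hk => ?_
        have hk' : k ≤ r := Nat.lt_succ_iff.1 (Finset.mem_range.1 hk)
        have e1 : r + 1 - 1 - k = r - k := by omega
        rw [e1, Nat.choose_symm hk']
        obtain ⟨m, rfl⟩ := Nat.exists_eq_add_of_le hk'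
        rw [Nat.add_sub_cancel_left, pow_add]
        have e2 : ((-1 : ℝ) ^ k) * (-1) ^ k = 1 := by rw [← mul_pow]; norm_num
        have e3 : t + (m : ℕ) * (-1 * u) = t - ((k + m : ℕ) : ℝ) * u + k * u := by
          push_cast
          ring
        rw [e3]
        linear_combination (-(((k + m).choose k : ℝ) * (-1) ^ m *
          g (t - ((k + m : ℕ) : ℝ) * u + k * u))) * e2
      rw [this, enorm_mul, enorm_pow, enorm_neg, enorm_one, one_pow, one_mul]
    simp_rw [hrefl]
    have hmp := (measurePreserving_sub_right volume ((r : ℝ) * u)).setLIntegral_comp_preimage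
      (measurableSet_Icc : MeasurableSet (Icc (0 : ℝ) (1 - r * u)))
      (f := fun y => ‖rthDiff r g u y‖ₑ ^ p) (by unfold rthDiff; fun_prop)
    rw [← hmp]
    refine lintegral_mono_set fun t ht => ?_
    exact ⟨by linarith [ht.1], by linarith [ht.2]⟩
  have hmain : ∀ (S : Set ℝ) [IsFiniteMeasure (volume.restrict S)] (e : ℝ), |e| = 1 →
      (∀ u ∈ Icc h (2 * h), lintegralNorm p (volume.restrict S)
        (fun t => ‖rthDiff r g (e * u) t‖ₑ) ≤ diffNorm r p f u) →
      ENNReal.ofReal h * lintegralNorm p (volume.restrict S) (fun t => ‖g t‖ₑ) ≤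
        ENNReal.ofReal (2 * h * ((2 * h) ^ s * L) + 2 ^ r * (h * G + 8 / D * F.toReal)) :=
    fun S _ e he hδ => by
      refine (ofReal_mul_lintegralNorm_le hp hD hgi hgm r he hh0 S).trans ?_
      rw [ENNReal.ofReal_add (by positivity) (by positivity)]
      refine add_le_add (setLIntegral_le_of_besovNorm_le hs hq hL.le hbes (hmeas S e) hh0 hh1 hδ) ?_
      rw [lintegralNorm_stepMean hp hD hg0, ← hG, ← hF,
        ENNReal.ofReal_mul (p := 2 ^ r) (by positivity),
        ENNReal.ofReal_pow two_pos.le, ENNReal.ofReal_ofNat,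
        ENNReal.ofReal_add (by positivity) (by positivity), ENNReal.ofReal_mul hh0.le,
        ENNReal.ofReal_mul (p := 8 / (D : ℝ)) (by positivity), ENNReal.ofReal_toReal hFtop]
  have hsplit : F ≤ lintegralNorm p (volume.restrict (Icc 0 (1 / 2))) (fun t => ‖g t‖ₑ) +
      lintegralNorm p (volume.restrict (Icc (1 / 2) 1)) (fun t => ‖g t‖ₑ) := by
    have h1 : ∫⁻ t, ‖g t‖ₑ ^ p = ∫⁻ t in Icc (0 : ℝ) (1 / 2) ∪ Icc (1 / 2) 1, ‖g t‖ₑ ^ p := by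
      rw [Icc_union_Icc_eq_Icc (by norm_num) (by norm_num), setLIntegral_eq_of_support_subset]
      intro t ht
      by_contra h2
      refine ht ?_
      simp only
      rw [hg0 t h2, enorm_zero, ENNReal.zero_rpow_of_pos hp0]
    rw [hF, lintegralNorm, h1]
    exact (ENNReal.rpow_le_rpow (lintegral_union_le _ _ _) (by positivity)).trans
      (ENNReal.rpow_add_le_add_rpow _ _ (by positivity) (by rw [div_le_one hp0]; exact hp))
  have hfin : h * F.toReal ≤
      2 * (2 * h * ((2 * h) ^ s * L) + 2 ^ r * (h * G + 8 / D * F.toReal)) := by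
    rw [← ENNReal.ofReal_le_ofReal_iff (by positivity), ENNReal.ofReal_mul hh0.le,
      ENNReal.ofReal_toReal hFtop, two_mul (_ + _), ENNReal.ofReal_add (by positivity) (by positivity)]
    refine (mul_le_mul_right hsplit _).trans ?_
    rw [mul_add]
    exact add_le_add (hmain _ 1 (by simp) hδ₁) (hmain _ (-1) (by simp) hδ₂)
  have hεF : ε ≤ F.toReal := by
    rw [← hFu] at hεf
    exact (ENNReal.ofReal_le_iff_le_toReal hFtop).1 hεf
  have hDh : 2 * (2 ^ r * (8 / D)) = h / 2 := by
    rw [hh, hDdef]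
    push_cast
    field_simp
    norm_num
  have hpow : (2 * h) ^ s ≤ (d : ℝ) ^ (-s) := by
    rw [Real.rpow_neg (by positivity), ← Real.inv_rpow (by positivity), ← one_div]
    exact Real.rpow_le_rpow (by positivity) h2d hs.le
  -- Absorption of F/2 on the left; it is legitimate because the Besov bound makes F finite.
  have h3 : F.toReal ≤ 8 * L * (2 * h) ^ s + 4 * 2 ^ r * G := by
    have h4 : h * F.toReal ≤ h * (4 * L * (2 * h) ^ s + 2 * 2 ^ r * G + F.toReal / 2) := by
      refine hfin.trans (le_of_eq ?_)
      linear_combination F.toReal * hDh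
    have h5 := le_of_mul_le_mul_left h4 hh0
    linarith
  rw [cellMean_congr hfg]
  change ε ≤ (8 * L + 4 * 2 ^ r) * (G + (d : ℝ) ^ (-s))
  have h6 : 8 * L * (2 * h) ^ s ≤ 8 * L * (d : ℝ) ^ (-s) := by gcongr
  have h7 : 0 ≤ 8 * L * G := by positivity
  have h8 : 0 ≤ 4 * 2 ^ r * (d : ℝ) ^ (-s) := by positivity
  linarith [h3, hεF]

end Projection

/-! ### Critical separations and tests -/

section Interface

variable {α β p σ : ℝ}

theorem gsAlt_antitone (p : ℝ) (d : ℕ) (σ : ℝ) (ε ε' : ℝ) (h : ε ≤ ε') :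
    gsAlt p d σ ε' ⊆ gsAlt p d σ ε := by
  rintro P ⟨v, hv, rfl⟩
  exact ⟨v, h.trans hv, rfl⟩

theorem minimaxRisk_gs_lt (hβ : 0 < β) {d : ℕ} {a b : ℝ}
    (h : HasTest (gaussianSequence σ) (fun v : Fin d → ℝ => lpNorm p v ≤ a)
      (fun v => b ≤ lpNorm p v) (ENNReal.ofReal (α / 2)) (ENNReal.ofReal (β / 4))) :
    minimaxRisk α (gsNull p d σ a) (gsAlt p d σ b) < ENNReal.ofReal β :=
  h.minimaxRisk_lt (fun _ hP => hP) (fun _ hP => hP) hβ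

theorem gsCritical_le_of_hasTest (hβ : 0 < β) {d : ℕ} {a b : ℝ} (hab : a ≤ b)
    (h : HasTest (gaussianSequence σ) (fun v : Fin d → ℝ => lpNorm p v ≤ a)
      (fun v => b ≤ lpNorm p v) (ENNReal.ofReal (α / 2)) (ENNReal.ofReal (β / 4))) :
    gsCritical α β p d σ a ≤ b :=
  criticalSeparation_le hab (minimaxRisk_gs_lt hβ h)

/-- The infimum defining the sequence separation is over a nonempty set, in every dimension; without
this no test could be extracted from it. -/
theorem exists_minimaxRisk_gs_lt (hp : 1 ≤ p) (hα : 0 < α) (hβ : 0 < β) :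
    ∃ η : ℝ, 0 < η ∧ ∀ (d : ℕ) (σ a : ℝ), 1 ≤ d → 0 < σ →
      minimaxRisk α (gsNull p d σ a) (gsAlt p d σ (a + 2 * (d * (√(d / η) * σ)))) <
        ENNReal.ofReal β := by
  have hη : 0 < min (α / 2) (β / 4) := lt_min (by linarith) (by linarith)
  refine ⟨min (α / 2) (β / 4), hη, fun d σ a hd hσ => minimaxRisk_gs_lt hβ ?_⟩
  exact (hasTest_gaussianSequence hp hd hη hσ a).mono (fun _ h => h) (fun _ h => h)
    (ENNReal.ofReal_le_ofReal (min_le_left _ _)) (ENNReal.ofReal_le_ofReal (min_le_right _ _))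

theorem exists_gsCritical_le (hp : 1 ≤ p) (hα : 0 < α) (hβ : 0 < β) :
    ∃ η : ℝ, 0 < η ∧ ∀ (d : ℕ) (σ a : ℝ), 1 ≤ d → 0 < σ →
      gsCritical α β p d σ a ≤ a + 2 * (d * (√(d / η) * σ)) := by
  obtain ⟨η, hη, h⟩ := exists_minimaxRisk_gs_lt (α := α) (β := β) hp hα hβ
  exact ⟨η, hη, fun d σ a hd hσ => criticalSeparation_le
    (le_add_of_nonneg_right (by positivity)) (h d σ a hd hσ)⟩

theorem le_gsCritical {d : ℕ} (a : ℝ) : a ≤ gsCritical α β p d σ a := le_criticalSeparation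

theorem hasTest_of_gsCritical_lt (hp : 1 ≤ p) (hα : 0 < α) (hβ : 0 < β) (hσ : 0 < σ) {d : ℕ}
    (hd : 1 ≤ d) {a b : ℝ} (h : gsCritical α β p d σ a < b) :
    HasTest (gaussianSequence σ) (fun v : Fin d → ℝ => lpNorm p v ≤ a)
      (fun v => b ≤ lpNorm p v) (ENNReal.ofReal α) (ENNReal.ofReal β) := by
  obtain ⟨η, hη, hne⟩ := exists_minimaxRisk_gs_lt (α := α) (β := β) hp hα hβ
  refine HasTest.of_minimaxRisk_lt (P₀ := gsNull p d σ a) (P₁ := gsAlt p d σ b)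
    (fun v hv => ⟨v, hv, rfl⟩) (fun v hv => ⟨v, hv, rfl⟩) ?_
  exact minimaxRisk_lt_of_criticalSeparation_lt (gsAlt_antitone p d σ)
    ⟨_, le_add_of_nonneg_right (by positivity), hne d σ a hd hσ⟩ h

variable {Ω : Type*} [MeasurableSpace Ω] {P : Measure Ω} {W : ℝ≥0 → Ω → ℝ} {r : ℕ} {s L : ℝ}
  {q : ℝ≥0∞}

/-- The null hypothesis of the white noise model. -/
def IsNullSignal (p a : ℝ) (f : ℝ → ℝ) : Prop :=
  MemLp f 2 unitVolume ∧ unitLpNorm p f ≤ ENNReal.ofReal a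

/-- The alternative of the white noise model. -/
def IsAltSignal (r : ℕ) (s p : ℝ) (q : ℝ≥0∞) (L b : ℝ) (f : ℝ → ℝ) : Prop :=
  MemLp f 2 unitVolume ∧ ENNReal.ofReal b ≤ unitLpNorm p f ∧
    besovNorm r s p q f ≤ ENNReal.ofReal L

theorem minimaxRisk_gw_lt (hβ : 0 < β) {a b : ℝ}
    (h : HasTest (whiteNoiseLaw P W σ) (IsNullSignal p a) (IsAltSignal r s p q L b)
      (ENNReal.ofReal (α / 2)) (ENNReal.ofReal (β / 4))) :
    minimaxRisk α (gwNull P W p σ a) (gwAlt P W r s p q L σ b) < ENNReal.ofReal β := by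
  refine h.minimaxRisk_lt ?_ ?_ hβ
  · rintro Q ⟨f, h1, h2, h3⟩
    exact ⟨f, ⟨h1, h2⟩, h3⟩
  · rintro Q ⟨f, h1, h2, h3, h4⟩
    exact ⟨f, ⟨h1, h2, h3⟩, h4⟩

theorem gwCritical_le_of_hasTest (hβ : 0 < β) {a b : ℝ} (hab : a ≤ b)
    (h : HasTest (whiteNoiseLaw P W σ) (IsNullSignal p a) (IsAltSignal r s p q L b)
      (ENNReal.ofReal (α / 2)) (ENNReal.ofReal (β / 4))) :
    gwCritical P W α β r s p q L σ a ≤ b :=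
  criticalSeparation_le hab (minimaxRisk_gw_lt hβ h)

theorem le_gwCritical (a : ℝ) : a ≤ gwCritical P W α β r s p q L σ a := le_criticalSeparation

theorem hasTest_of_gwCritical_lt (hβ : 0 < β) (hL : 0 < L) {a b : ℝ}
    (h : gwCritical P W α β r s p q L σ a < b) :
    HasTest (whiteNoiseLaw P W σ) (IsNullSignal p a) (IsAltSignal r s p q L b)
      (ENNReal.ofReal α) (ENNReal.ofReal β) := by
  refine HasTest.of_minimaxRisk_lt (P₀ := gwNull P W p σ a) (P₁ := gwAlt P W r s p q L σ b)
    (fun f hf => ⟨f, hf.1, hf.2, rfl⟩) (fun f hf => ⟨f, hf.1, hf.2.1, hf.2.2, rfl⟩) ?_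
  refine minimaxRisk_lt_of_criticalSeparation_lt (fun ε ε' hε => ?_)
    ⟨max a (L + 1), le_max_left _ _, ?_⟩ h
  · rintro Q ⟨f, h1, h2, h3⟩
    exact ⟨f, h1, (ENNReal.ofReal_le_ofReal hε).trans h2, h3⟩
  -- Beyond L the alternative is empty, since the Besov norm dominates the L_p norm, and the test
  -- that never rejects is perfect.
  · refine minimaxRisk_gw_lt hβ ⟨fun _ => 0, measurable_const, fun _ => zero_le, fun f _ => by simp,
      fun f hf => absurd ((hf.2.1.trans le_self_add).trans hf.2.2) ?_⟩
    rw [not_le, ENNReal.ofReal_lt_ofReal_iff (hL.trans (by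
      exact (lt_add_one L).trans_le (le_max_right _ _)))]
    exact (lt_add_one L).trans_le (le_max_right _ _)

end Interface

/-! ### Comparison of the two models -/

section Comparison

variable {α β p σ s L : ℝ} {Ω : Type*} [MeasurableSpace Ω] {P : Measure Ω} {W : ℝ≥0 → Ω → ℝ}
  {r : ℕ} {q : ℝ≥0∞}

theorem rpow_mul_rpow_neg_eq_one {d : ℕ} (hd : 1 ≤ d) (p : ℝ) :
    (d : ℝ) ^ (1 / 2 - 1 / p) * (d : ℝ) ^ (1 / p - 1 / 2) = 1 := by
  have hd' : (0 : ℝ) < d := by exact_mod_cast hd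
  rw [← Real.rpow_add hd']
  simp

/-- A test in the Gaussian sequence model yields a test in the white noise model. -/
theorem exists_hasTest_whiteNoiseLaw (hs : 0 < s) (hr : s < r) (hp : 1 ≤ p) (hq : 1 ≤ q)
    (hL : 0 < L) : ∃ (m : ℕ) (C : ℝ), 1 ≤ m ∧ 0 < C ∧
      ∀ {Ω : Type*} [MeasurableSpace Ω] {P : Measure Ω} {W : ℝ≥0 → Ω → ℝ},
        IsPreBrownianReal W P → (∀ t, Measurable (W t)) →
        ∀ (d : ℕ) (σ a b ε₀ ε₁ : ℝ) (x y : ℝ≥0∞), 1 ≤ d → 0 ≤ ε₀ → 0 ≤ ε₁ →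
        HasTest (gaussianSequence σ) (fun v : Fin (m * d) → ℝ => lpNorm p v ≤ a)
          (fun v => b ≤ lpNorm p v) x y →
        2 * ε₀ ≤ ((m * d : ℕ) : ℝ) ^ (1 / 2 - 1 / p) * a →
        C * (((m * d : ℕ) : ℝ) ^ (1 / 2 - 1 / p) * b + (d : ℝ) ^ (-s)) ≤ ε₁ →
        HasTest (whiteNoiseLaw P W σ) (IsNullSignal p ε₀) (IsAltSignal r s p q L ε₁) x y := by
  obtain ⟨m, C, hm, hC, hproj⟩ := exists_le_lpNorm_cellMean hs hr hp hq hL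
  refine ⟨m, C, hm, hC, fun {Ω} _ {P W} hW hWm d σ a b ε₀ ε₁ x y hd hε₀ hε₁ h ha hb => ?_⟩
  have hD : 0 < m * d := Nat.mul_pos hm hd
  have hDp : (0 : ℝ) < ((m * d : ℕ) : ℝ) ^ (1 / 2 - 1 / p) :=
    Real.rpow_pos_of_pos (by exact_mod_cast hD) _
  refine h.comap (measurable_gridIncrement (m * d)) (cellMean (m * d)) (fun f hf => ?_)
    (fun f hf => ?_) (fun f hf => ?_)
  · exact le_of_mul_le_mul_left ((lpNorm_cellMean_le hp hD hf.1 hε₀ hf.2).trans ha) hDp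
  · have h1 := hb.trans (hproj d f ε₁ hd hf.1 hε₁ hf.2.2 hf.2.1)
    have h2 := le_of_mul_le_mul_left h1 hC
    exact le_of_mul_le_mul_left (by linarith) hDp
  · exact map_gridIncrement_whiteNoiseLaw hW hWm _ σ (hf.elim (fun h => h.1) fun h => h.1)

/-- A test in the white noise model yields a test in the Gaussian sequence model, against
alternatives in a shell. -/
theorem exists_hasTest_gaussianSequence (hs : 0 < s) (hr : s < r) (hp : 1 ≤ p) (hq : 1 ≤ q) :
    ∃ M C : ℝ, 0 < M ∧ 0 < C ∧
      ∀ {Ω : Type*} [MeasurableSpace Ω] {P : Measure Ω} {W : ℝ≥0 → Ω → ℝ},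
        IsPreBrownianReal W P → (∀ t, Measurable (W t)) →
        ∀ (L : ℝ) (d : ℕ) (σ ρ ρ₀ ρ₁ ε₀ ε₁ : ℝ) (x y : ℝ≥0∞), 1 ≤ d → 0 ≤ ρ → 0 ≤ ρ₀ → 0 ≤ ρ₁ →
        0 ≤ ε₀ → 0 ≤ ε₁ →
        HasTest (whiteNoiseLaw P W σ) (IsNullSignal p ε₀) (IsAltSignal r s p q L ε₁) x y →
        ρ ^ p + ρ₀ ^ p ≤ ε₀ ^ p → ε₁ ^ p ≤ ρ ^ p + ρ₁ ^ p →
        C * (ρ + (d : ℝ) ^ s * (2 * ρ₁ / M)) ≤ L →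
        HasTest (gaussianSequence σ)
          (fun v : Fin d → ℝ => lpNorm p v ≤ ρ₀ / M * (d : ℝ) ^ (1 / p - 1 / 2))
          (fun v => ρ₁ / M * (d : ℝ) ^ (1 / p - 1 / 2) ≤ lpNorm p v ∧
            lpNorm p v < 2 * (ρ₁ / M * (d : ℝ) ^ (1 / p - 1 / 2))) x y := by
  obtain ⟨M, C, w, ψ, hM, hC, hw, hψ⟩ := exists_bumpFamily hs hr hp hq
  refine ⟨M, C, hM, hC, fun {Ω} _ {P W} hW hWm L d σ ρ ρ₀ ρ₁ ε₀ ε₁ x y hd hρ hρ₀ hρ₁ hε₀ hε₁ h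
    h0 h1 hB => ?_⟩
  have hp0 : 0 < p := by linarith
  have hprob := hW.isGaussianProcess.isProbabilityMeasure
  have hd' : (0 : ℝ) < d := by exact_mod_cast hd
  obtain ⟨hmem, horth, hnorm⟩ := hψ d hd
  obtain ⟨κ, hκ, hlaw⟩ := exists_kernel_gaussianSequence_whiteNoiseLaw hW hWm σ hmem horth
    (hw.const_mul ρ)
  set D := (d : ℝ) ^ (1 / 2 - 1 / p) with hD
  have hD0 : 0 < D := by positivity
  have hDinv : (d : ℝ) ^ (1 / p - 1 / 2) = D⁻¹ :=
    eq_inv_of_mul_eq_one_right (rpow_mul_rpow_neg_eq_one hd p)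
  rw [hDinv]
  have hfmem : ∀ v : Fin d → ℝ, MemLp (fun t => ρ * w t + ∑ i, v i * ψ d i t) 2 unitVolume :=
    fun v => (hw.const_mul ρ).add (memLp_finsetSum _ fun i _ => (hmem i).const_mul (v i))
  have hrp : ∀ c : ℝ, 0 ≤ c → (c ^ p) ^ (1 / p) = c := fun c hc => by
    rw [← Real.rpow_mul hc, mul_one_div_cancel hp0.ne', Real.rpow_one]
  refine h.transport (ζ := P) hκ (fun v t => ρ * w t + ∑ i, v i * ψ d i t) (fun v hv => ?_)
    (fun v hv => ?_) (fun v _ => hlaw v)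
  · refine ⟨hfmem v, ?_⟩
    rw [(hnorm ρ v hρ).1]
    refine ENNReal.ofReal_le_ofReal ?_
    rw [← hrp ε₀ hε₀]
    have hn := lpNorm_nonneg p v
    refine Real.rpow_le_rpow (by positivity) (le_trans ?_ h0) (by positivity)
    gcongr
    calc M * (D * lpNorm p v) ≤ M * (D * (ρ₀ / M * D⁻¹)) := by gcongr
      _ = ρ₀ := by field_simp
  · have hn := lpNorm_nonneg p v
    refine ⟨hfmem v, ?_, ((hnorm ρ v hρ).2).trans (ENNReal.ofReal_le_ofReal (le_trans ?_ hB))⟩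
    · rw [(hnorm ρ v hρ).1]
      refine ENNReal.ofReal_le_ofReal ?_
      rw [← hrp ε₁ hε₁]
      refine Real.rpow_le_rpow (by positivity) (h1.trans ?_) (by positivity)
      gcongr
      calc ρ₁ = M * (D * (ρ₁ / M * D⁻¹)) := by field_simp
        _ ≤ M * (D * lpNorm p v) := by
          gcongr
          exact hv.1
    -- Here the upper end of the shell is used: without it the Besov norm of the alternative would
    -- be unbounded.
    · gcongr
      calc D * lpNorm p v ≤ D * (2 * (ρ₁ / M * D⁻¹)) := by
            gcongr
            exact hv.2.le
        _ = 2 * ρ₁ / M := by field_simp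

end Comparison

/-! ### Comparison of the critical separations -/

section CriticalComparison

variable {α β p s L : ℝ} {r : ℕ} {q : ℝ≥0∞}

theorem gwCritical_congr {Ω : Type*} [MeasurableSpace Ω] {P : Measure Ω} {W W' : ℝ≥0 → Ω → ℝ}
    (h : ∀ σ f, whiteNoiseLaw P W σ f = whiteNoiseLaw P W' σ f) (σ ε₀ : ℝ) :
    gwCritical P W α β r s p q L σ ε₀ = gwCritical P W' α β r s p q L σ ε₀ := by
  simp only [gwCritical, criticalSeparation, gwNull, gwAlt, h]

theorem rpow_neg_eq_inv {d : ℕ} (hd : 1 ≤ d) (p : ℝ) :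
    (d : ℝ) ^ (1 / p - 1 / 2) = ((d : ℝ) ^ (1 / 2 - 1 / p))⁻¹ :=
  eq_inv_of_mul_eq_one_right (rpow_mul_rpow_neg_eq_one hd p)

/-- A sequence test at 2G in dimension d is moved to dimension md and applied to cell means. The
bias d^{-s} from replacing f by its cell means is at most A·G·D by the balance condition, where G·D
is the rescaled separation. -/
theorem exists_gwCritical_le (hs : 0 < s) (hr : s < r) (hp : 1 ≤ p) (hq : 1 ≤ q) (hL : 0 < L)
    (hα : 0 < α) (hβ : 0 < β) (hαβ : β < 1 - α) {A : ℝ} (hA : 1 ≤ A) :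
    ∃ C : ℝ, 0 < C ∧ ∀ {Ω : Type*} [MeasurableSpace Ω] {P : Measure Ω} {W : ℝ≥0 → Ω → ℝ},
      IsPreBrownianReal W P → (∀ t, Measurable (W t)) →
      ∀ (σ ε₀ ε₀' : ℝ) (d : ℕ), 0 < σ → 0 ≤ ε₀ → 0 ≤ ε₀' → 1 ≤ d →
        EquivUpTo A ε₀' (ε₀ * (d : ℝ) ^ (1 / p - 1 / 2)) →
        EquivUpTo A ((d : ℝ) ^ (-s)) (gsCritical α β p d σ ε₀' * (d : ℝ) ^ (1 / 2 - 1 / p)) →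
        gwCritical P W α β r s p q L σ ε₀ ≤
          C * (gsCritical α β p d σ ε₀' * (d : ℝ) ^ (1 / 2 - 1 / p)) := by
  obtain ⟨m, C, hm, hC, hgw⟩ := exists_hasTest_whiteNoiseLaw hs hr hp hq hL
  have hm' : (0 : ℝ) < m := by exact_mod_cast hm
  set B := (m : ℝ) ^ (1 / 2 - 1 / p) with hB
  have hB0 : 0 < B := by positivity
  -- The null must cover the cell means of all f with ‖f‖_p ≤ ε₀: the 2 is the norm of the cell-mean
  -- map, A compares the tolerances, and B rescales from d to md.
  obtain ⟨C', hC', hblock⟩ := exists_hasTest_block (p := p) hp hα hβ hαβ hm (2 * A / B)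
  refine ⟨C * (B * (C' * 2) + A) + A, by positivity, fun {Ω} _ {P W} hW hWm σ ε₀ ε₀' d hσ hε₀ hε₀'
    hd he hg => ?_⟩
  have hd' : (0 : ℝ) < d := by exact_mod_cast hd
  rw [rpow_neg_eq_inv hd] at he
  set D := (d : ℝ) ^ (1 / 2 - 1 / p) with hD
  have hD0 : 0 < D := by positivity
  set G := gsCritical α β p d σ ε₀' with hG
  have hds : 0 < (d : ℝ) ^ (-s) := by positivity
  have hGD : 0 < G * D := pos_of_mul_pos_right (hds.trans_le hg.1) (by linarith)
  have hG0 : 0 < G := pos_of_mul_pos_left hGD hD0.le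
  have hGε : ε₀' ≤ G := le_gsCritical _
  have hε : ε₀ ≤ A * ε₀' * D := by
    have := he.2
    rwa [← div_eq_mul_inv, div_le_iff₀ hD0] at this
  have hε1 : ε₀ ≤ A * (G * D) := by
    refine hε.trans ?_
    rw [mul_assoc]
    gcongr
  have hcast : (((m * d : ℕ) : ℝ)) ^ (1 / 2 - 1 / p) = B * D := by
    rw [Nat.cast_mul, Real.mul_rpow hm'.le hd'.le]
  have hle : ε₀ ≤ (C * (B * (C' * 2) + A) + A) * (G * D) := by
    refine hε1.trans ?_
    gcongr
    exact le_add_of_nonneg_left (by positivity)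
  refine gwCritical_le_of_hasTest hβ hle ?_
  refine hgw hW hWm d σ (2 * A / B * ε₀') (C' * (2 * G)) ε₀ _ _ _ hd hε₀ (hε₀.trans hle)
    (hblock d σ ε₀' (2 * G) hε₀' (by positivity)
      (hasTest_of_gsCritical_lt hp hα hβ hσ hd (by rw [← hG]; linarith))) ?_ ?_
  · rw [hcast]
    calc 2 * ε₀ ≤ 2 * (A * ε₀' * D) := by gcongr
      _ = B * D * (2 * A / B * ε₀') := by field_simp
  · rw [hcast]
    have h1 : C * (B * D * (C' * (2 * G)) + (d : ℝ) ^ (-s)) ≤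
        C * (B * D * (C' * (2 * G)) + A * (G * D)) := by
      have := hg.1
      gcongr
    have h2 : 0 ≤ A * (G * D) := by positivity
    calc _ ≤ _ := h1
      _ ≤ C * (B * D * (C' * (2 * G)) + A * (G * D)) + A * (G * D) := by linarith
      _ = _ := by ring

/-- Either the white noise separation already exceeds a multiple of d^{-s}, and balance finishes, or
bumps of that size lie in the Besov ball and a white noise test gives a sequence test. No coarse
component is needed here, so ρ = 0. -/
theorem exists_le_gwCritical (hs : 0 < s) (hr : s < r) (hp : 1 ≤ p) (hq : 1 ≤ q) (hL : 0 < L)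
    (hα : 0 < α) (hβ : 0 < β) (hαβ : β < 1 - α) {A : ℝ} (hA : 1 ≤ A) :
    ∃ C : ℝ, 0 < C ∧ ∀ {Ω : Type*} [MeasurableSpace Ω] {P : Measure Ω} {W : ℝ≥0 → Ω → ℝ},
      IsPreBrownianReal W P → (∀ t, Measurable (W t)) →
      ∀ (σ ε₀ ε₀' : ℝ) (d : ℕ), 0 ≤ ε₀ → 1 ≤ d →
        EquivUpTo A ε₀' (ε₀ * (d : ℝ) ^ (1 / p - 1 / 2)) →
        EquivUpTo A ((d : ℝ) ^ (-s)) (gsCritical α β p d σ ε₀' * (d : ℝ) ^ (1 / 2 - 1 / p)) →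
        gsCritical α β p d σ ε₀' * (d : ℝ) ^ (1 / 2 - 1 / p) ≤
          C * gwCritical P W α β r s p q L σ ε₀ := by
  obtain ⟨M, C, hM, hC, hgs⟩ := exists_hasTest_gaussianSequence (q := q) hs hr hp hq
  obtain ⟨k₁, hshell⟩ := exists_hasTest_shell (p := p) hp hα hβ hαβ
  obtain ⟨k₂, hk₂⟩ := pow_unbounded_of_one_lt (A * M) (one_lt_two (α := ℝ))
  set k := max k₁ k₂ with hk
  have hkM : A * M ≤ 2 ^ k := hk₂.le.trans (pow_le_pow_right₀ one_le_two (le_max_right _ _))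
  have hp0 : 0 < p := by linarith
  -- At ρ₁ = c·d^{-s} the Besov bound of the bumps equals L.
  set c := L * M / (2 * C) with hc
  have hc0 : 0 < c := by positivity
  refine ⟨A / c + 2 ^ k / M, by positivity, fun {Ω} _ {P W} hW hWm σ ε₀ ε₀' d hε₀ hd he hg => ?_⟩
  have hd' : (0 : ℝ) < d := by exact_mod_cast hd
  rw [rpow_neg_eq_inv hd] at he
  set D := (d : ℝ) ^ (1 / 2 - 1 / p) with hD
  have hD0 : 0 < D := by positivity
  set G := gsCritical α β p d σ ε₀' with hG
  set g := gwCritical P W α β r s p q L σ ε₀ with hgdef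
  have hεg : ε₀ ≤ g := le_gwCritical _
  -- The infimum need not be attained, so tests exist only strictly above it.
  suffices h : ∀ ε₁, g < ε₁ → G * D ≤ (A / c + 2 ^ k / M) * ε₁ by
    have h1 : ∀ ε₁, g < ε₁ → G * D / (A / c + 2 ^ k / M) ≤ ε₁ := fun ε₁ hε₁ => by
      rw [div_le_iff₀' (by positivity)]
      exact h ε₁ hε₁
    have h2 := le_of_forall_gt_imp_ge_of_dense h1
    rwa [div_le_iff₀' (by positivity)] at h2
  intro ε₁ hε₁
  have hε₁0 : 0 < ε₁ := (hε₀.trans hεg).trans_lt hε₁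
  rw [add_mul]
  by_cases hcase : c * (d : ℝ) ^ (-s) ≤ ε₁
  · have h1 : G * D ≤ A / c * ε₁ := by
      calc G * D ≤ A * (d : ℝ) ^ (-s) := hg.2
        _ = A / c * (c * (d : ℝ) ^ (-s)) := by field_simp
        _ ≤ A / c * ε₁ := by gcongr
    have : 0 ≤ 2 ^ k / M * ε₁ := by positivity
    linarith
  · push Not at hcase
    have h1 := hasTest_of_gwCritical_lt (α := α) hβ hL hε₁
    have h2 := hgs hW hWm L d σ 0 ε₀ ε₁ ε₀ ε₁ _ _ hd le_rfl hε₀ hε₁0.le hε₀ hε₁0.le h1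
      (by rw [Real.zero_rpow hp0.ne', zero_add]) (by rw [Real.zero_rpow hp0.ne', zero_add]) (by
        have h3 : (d : ℝ) ^ s * (d : ℝ) ^ (-s) = 1 := by
          rw [← Real.rpow_add hd', add_neg_cancel, Real.rpow_zero]
        calc C * (0 + (d : ℝ) ^ s * (2 * ε₁ / M)) ≤
              C * (0 + (d : ℝ) ^ s * (2 * (c * (d : ℝ) ^ (-s)) / M)) := by gcongr
          _ = 2 * C * c / M * ((d : ℝ) ^ s * (d : ℝ) ^ (-s)) := by ring
          _ = L := by
            rw [h3, hc]
            field_simp)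
    rw [rpow_neg_eq_inv hd, ← hD] at h2
    have h3 := hshell k (le_max_left _ _) d σ (ε₀ / M * D⁻¹) (ε₁ / M * D⁻¹) (by positivity)
      (by positivity) h2
    have hae : ε₀' ≤ 2 ^ k * (ε₀ / M * D⁻¹) := by
      calc ε₀' ≤ A * (ε₀ * D⁻¹) := he.1
        _ = A * M * (ε₀ / M * D⁻¹) := by field_simp
        _ ≤ _ := by gcongr
    have hab : 2 ^ k * (ε₀ / M * D⁻¹) ≤ 2 ^ k * (ε₁ / M * D⁻¹) := by
      have := hεg.trans hε₁.le
      gcongr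
    have h4 : G ≤ 2 ^ k * (ε₁ / M * D⁻¹) :=
      gsCritical_le_of_hasTest hβ (hae.trans hab)
        (h3.mono (fun v hv => hv.trans hae) (fun v hv => hv) le_rfl le_rfl)
    have h5 : G * D ≤ 2 ^ k / M * ε₁ := by
      calc G * D ≤ 2 ^ k * (ε₁ / M * D⁻¹) * D := by gcongr
        _ = 2 ^ k / M * ε₁ := by field_simp
    have : 0 ≤ A / c * ε₁ := by positivity
    linarith

end CriticalComparison

/-! ### Moderate tolerance -/

section Moderate

variable {α β p s L : ℝ} {r : ℕ} {q : ℝ≥0∞}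

/-- The convexity estimate that bounds increments of x^p by the derivative at the right end, from
Bernoulli's inequality for a/(a+h). -/
theorem add_rpow_le_rpow_add_mul {p a h : ℝ} (hp : 1 ≤ p) (ha : 0 ≤ a) (hh : 0 < h) :
    (a + h) ^ p ≤ a ^ p + p * (a + h) ^ (p - 1) * h := by
  have hb : 0 < a + h := by linarith
  have h1 := one_add_mul_self_le_rpow_one_add (s := -(h / (a + h)))
    (by rw [neg_le_neg_iff, div_le_one hb]; linarith) hp
  have h2 : 1 + -(h / (a + h)) = a / (a + h) := by
    field_simp
    ring
  rw [h2, Real.div_rpow ha hb.le, le_div_iff₀ (by positivity)] at h1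
  have h3 : (a + h) ^ p = (a + h) ^ (p - 1) * (a + h) := by
    rw [← Real.rpow_add_one hb.ne', sub_add_cancel]
  have h4 : (1 + p * -(h / (a + h))) * (a + h) ^ p =
      (a + h) ^ p - p * (a + h) ^ (p - 1) * h := by
    rw [h3]
    field_simp
    ring
  linarith

/-- If the difference were below c times the rescaled separation g, take ε₁ = ε₀ + cg and tune ρ,
ρ₀, ρ₁ so that ρ^p + ρ₀^p = ε₀^p and ρ^p + ρ₁^p = ε₁^p. The resulting sequence test has null radius
ε₀', so g^p ≤ R·ρ₁^p = R·ρ₀^p + R(ε₁^p - ε₀^p). The first term is at most l·g^p with l < 1 by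
moderate tolerance, the second at most (1-l)/2·g^p, a contradiction. -/
theorem exists_mul_le_gwCritical_sub (hs : 0 < s) (hr : s < r) (hp : 1 ≤ p) (hq : 1 ≤ q)
    (hL : 0 < L) (hα : 0 < α) (hβ : 0 < β) (hαβ : β < 1 - α) {A K : ℝ} (hA : 1 ≤ A)
    (hK : 0 ≤ K) :
    ∃ c τ : ℝ, 0 < c ∧ 0 < τ ∧ ∀ {Ω : Type*} [MeasurableSpace Ω] {P : Measure Ω}
      {W : ℝ≥0 → Ω → ℝ}, IsPreBrownianReal W P → (∀ t, Measurable (W t)) →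
      ∀ (σ ε₀ ε₀' : ℝ) (d : ℕ), 0 ≤ ε₀ → 0 ≤ ε₀' → 1 ≤ d →
        EquivUpTo A ε₀' (ε₀ * (d : ℝ) ^ (1 / p - 1 / 2)) →
        EquivUpTo A ((d : ℝ) ^ (-s)) (gsCritical α β p d σ ε₀' * (d : ℝ) ^ (1 / 2 - 1 / p)) →
        ε₀' ≤ K * (gsCritical α β p d σ ε₀' - ε₀') → (d : ℝ) ^ (-s) ≤ τ →
        c * (gsCritical α β p d σ ε₀' * (d : ℝ) ^ (1 / 2 - 1 / p)) ≤
          gwCritical P W α β r s p q L σ ε₀ - ε₀ := by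
  obtain ⟨M, C, hM, hC, hgs⟩ := exists_hasTest_gaussianSequence (q := q) hs hr hp hq
  obtain ⟨k₁, hshell⟩ := exists_hasTest_shell (p := p) hp hα hβ hαβ
  have hA0 : 0 < A := by linarith
  have hp0 : 0 < p := by linarith
  -- With ρ₁ ≤ θg and g ≤ A·d^{-s} the bumps use at most half of L; the threshold τ below keeps ε₀ ≤
  -- L/(2C), so ρw uses at most the other half.
  set θ := L * M / (4 * C * A) with hθ
  have hθ0 : 0 < θ := by positivity
  obtain ⟨k₂, hk₂⟩ := pow_unbounded_of_one_lt (max (A * M) (2 * M / θ)) (one_lt_two (α := ℝ))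
  set k := max k₁ k₂ with hk
  have hk2 : (2 : ℝ) ^ k₂ ≤ 2 ^ k := pow_le_pow_right₀ one_le_two (le_max_right _ _)
  have hkM : A * M ≤ 2 ^ k := ((le_max_left _ _).trans hk₂.le).trans hk2
  have hkθ : 2 * M / θ ≤ 2 ^ k := ((le_max_right _ _).trans hk₂.le).trans hk2
  set Q := p * (A + 1) ^ (p - 1) with hQ
  have hQ0 : 0 < Q := by positivity
  set R := (2 ^ k / M) ^ p with hR
  have hR0 : 0 < R := by positivity
  set l := (K / (K + 1)) ^ p with hl
  have hl1 : l < 1 :=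
    Real.rpow_lt_one (by positivity) (by rw [div_lt_one (by linarith)]; linarith) hp0
  -- The entries ensure, in turn, ε₁ ≤ (A+1)g, the bound ρ₁ ≤ θg, and the final contradiction.
  set c := min 1 (min (θ ^ p / (2 * Q)) ((1 - l) / (2 * R * Q))) with hc
  have hc0 : 0 < c := lt_min one_pos (lt_min (by positivity)
    (div_pos (by linarith) (by positivity)))
  have hc1 : c ≤ 1 := min_le_left _ _
  have hc2 : c * Q ≤ θ ^ p / 2 := by
    have : c ≤ θ ^ p / (2 * Q) := (min_le_right _ _).trans (min_le_left _ _)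
    rw [le_div_iff₀ (by positivity)] at this
    linarith
  have hc3 : R * (c * Q) ≤ (1 - l) / 2 := by
    have : c ≤ (1 - l) / (2 * R * Q) := (min_le_right _ _).trans (min_le_right _ _)
    rw [le_div_iff₀ (by positivity)] at this
    linarith
  refine ⟨c, L / (2 * C * A ^ 2), hc0, by positivity, fun {Ω} _ {P W} hW hWm σ ε₀ ε₀' d hε₀ hε₀'
    hd he hg hmod hτ => ?_⟩
  have hd' : (0 : ℝ) < d := by exact_mod_cast hd
  rw [rpow_neg_eq_inv hd] at he
  set D := (d : ℝ) ^ (1 / 2 - 1 / p) with hD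
  have hD0 : 0 < D := by positivity
  set G := gsCritical α β p d σ ε₀' with hG
  have hGε : ε₀' ≤ G := le_gsCritical _
  have hg0 : 0 < G * D := pos_of_mul_pos_right ((by positivity : 0 < (d : ℝ) ^ (-s)).trans_le hg.1)
    hA0.le
  set g := G * D with hgdef
  by_contra! hlt
  set ε₁ := ε₀ + c * g with hε₁
  have hε01 : ε₀ < ε₁ := lt_add_of_pos_right _ (by positivity)
  set x := ε₀' * D with hx
  have hx0 : 0 ≤ x := by positivity
  have hxg : x ≤ g := by rw [hx, hgdef]; gcongr
  have hxK : x ≤ K / (K + 1) * g := by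
    have : ε₀' ≤ K / (K + 1) * G := by
      rw [div_mul_eq_mul_div, le_div_iff₀ (by linarith)]
      linarith
    calc x ≤ K / (K + 1) * G * D := by rw [hx]; gcongr
      _ = _ := by rw [hgdef]; ring
  have hxε : x ≤ A * ε₀ := by
    calc x ≤ A * (ε₀ * D⁻¹) * D := by rw [hx]; have := he.1; gcongr
      _ = A * ε₀ := by field_simp
  have hεx : ε₀ ≤ A * x := by
    have := he.2
    rw [← div_eq_mul_inv, div_le_iff₀ hD0] at this
    rw [hx]
    linarith
  have hεg : ε₀ ≤ A * g := hεx.trans (by gcongr)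
  have hgd : g ≤ A * (d : ℝ) ^ (-s) := hg.2
  -- Chosen so that, after the factor 2^k from passing from the shell to the exterior, the null
  -- radius is exactly ε₀'. A large k makes ρ₀ at most ε₀ and at most θg/2.
  set ρ₀ := M * x / 2 ^ k with hρ₀
  have hρ₀0 : 0 ≤ ρ₀ := by positivity
  have hρ₀ε : ρ₀ ≤ ε₀ := by
    rw [hρ₀, div_le_iff₀ (by positivity)]
    calc M * x ≤ M * (A * ε₀) := by gcongr
      _ = ε₀ * (A * M) := by ring
      _ ≤ ε₀ * 2 ^ k := by gcongr
  have hρ₀θ : ρ₀ ≤ θ / 2 * g := by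
    rw [div_le_iff₀ hθ0] at hkθ
    rw [hρ₀, div_le_iff₀ (by positivity)]
    calc M * x ≤ M * g := by gcongr
      _ ≤ 2 ^ k * θ / 2 * g := by gcongr; linarith
      _ = _ := by ring
  have hpp : ρ₀ ^ p ≤ ε₀ ^ p := Real.rpow_le_rpow hρ₀0 hρ₀ε hp0.le
  have hpl : ε₀ ^ p < ε₁ ^ p := Real.rpow_lt_rpow hε₀ hε01 hp0
  have hρp0 : 0 ≤ ρ₀ ^ p := by positivity
  have hgp : 0 < g ^ p := by positivity
  have hdiff : ε₁ ^ p - ε₀ ^ p ≤ c * Q * g ^ p := by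
    have h1 : ε₁ ^ p ≤ ε₀ ^ p + p * ε₁ ^ (p - 1) * (c * g) :=
      add_rpow_le_rpow_add_mul hp hε₀ (by positivity)
    have h2 : ε₁ ≤ (A + 1) * g := by
      have : c * g ≤ 1 * g := by gcongr
      rw [hε₁, add_mul]
      exact add_le_add hεg this
    have h3 : ε₁ ^ (p - 1) ≤ (A + 1) ^ (p - 1) * g ^ (p - 1) := by
      rw [← Real.mul_rpow (by linarith) hg0.le]
      exact Real.rpow_le_rpow (hε₀.trans hε01.le) h2 (by linarith)
    have h4 : g ^ p = g ^ (p - 1) * g := by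
      rw [← Real.rpow_add_one hg0.ne', sub_add_cancel]
    have h5 : p * ε₁ ^ (p - 1) * (c * g) ≤
        p * ((A + 1) ^ (p - 1) * g ^ (p - 1)) * (c * g) := by gcongr
    have h6 : p * ((A + 1) ^ (p - 1) * g ^ (p - 1)) * (c * g) = c * Q * g ^ p := by
      rw [hQ, h4]
      ring
    linarith
  have hroot : ∀ y : ℝ, 0 ≤ y → (y ^ (1 / p)) ^ p = y := fun y hy => by
    rw [← Real.rpow_mul hy, one_div_mul_cancel hp0.ne', Real.rpow_one]
  set ρ := (ε₀ ^ p - ρ₀ ^ p) ^ (1 / p) with hρ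
  have hρ0 : 0 ≤ ρ := Real.rpow_nonneg (by linarith) _
  have hρp : ρ ^ p = ε₀ ^ p - ρ₀ ^ p := hroot _ (by linarith)
  set ρ₁ := (ε₁ ^ p - ε₀ ^ p + ρ₀ ^ p) ^ (1 / p) with hρ₁
  have hρ₁0 : 0 < ρ₁ := Real.rpow_pos_of_pos (by linarith) _
  have hρ₁p : ρ₁ ^ p = ε₁ ^ p - ε₀ ^ p + ρ₀ ^ p := hroot _ (by linarith)
  have hρε : ρ ≤ ε₀ := (Real.rpow_le_rpow_iff hρ0 hε₀ hp0).1 (by linarith)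
  have hρρ : ρ₀ ≤ ρ₁ := (Real.rpow_le_rpow_iff hρ₀0 hρ₁0.le hp0).1 (by linarith)
  have hρ₁θ : ρ₁ ≤ θ * g := by
    refine (Real.rpow_le_rpow_iff hρ₁0.le (by positivity) hp0).1 ?_
    have h1 : ρ₀ ^ p ≤ θ ^ p / 2 * g ^ p := by
      calc ρ₀ ^ p ≤ (θ / 2 * g) ^ p := Real.rpow_le_rpow hρ₀0 hρ₀θ hp0.le
        _ = θ ^ p / 2 ^ p * g ^ p := by
          rw [Real.mul_rpow (by positivity) hg0.le, Real.div_rpow hθ0.le (by norm_num)]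
        _ ≤ θ ^ p / 2 * g ^ p := by
          gcongr
          exact Real.self_le_rpow_of_one_le (by norm_num) hp
    have h2 : c * Q * g ^ p ≤ θ ^ p / 2 * g ^ p := by gcongr
    rw [hρ₁p, Real.mul_rpow hθ0.le hg0.le]
    linarith
  have hB : C * (ρ + (d : ℝ) ^ s * (2 * ρ₁ / M)) ≤ L := by
    have h3 : (d : ℝ) ^ s * (d : ℝ) ^ (-s) = 1 := by
      rw [← Real.rpow_add hd', add_neg_cancel, Real.rpow_zero]
    have h4 : ε₀ ≤ L / (2 * C) := by
      calc ε₀ ≤ A * (A * (L / (2 * C * A ^ 2))) := by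
            refine hεg.trans ?_
            gcongr
            exact hgd.trans (by gcongr)
        _ = L / (2 * C) := by field_simp
    have h5 : ρ₁ ≤ θ * (A * (d : ℝ) ^ (-s)) := hρ₁θ.trans (by gcongr)
    calc C * (ρ + (d : ℝ) ^ s * (2 * ρ₁ / M)) ≤
          C * (L / (2 * C) + (d : ℝ) ^ s * (2 * (θ * (A * (d : ℝ) ^ (-s))) / M)) := by
          have := hρε.trans h4
          gcongr
      _ = C * (L / (2 * C) + 2 * θ * A / M * ((d : ℝ) ^ s * (d : ℝ) ^ (-s))) := by ring
      _ = L := by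
        rw [h3, hθ]
        field_simp
        ring
  have h1 := hasTest_of_gwCritical_lt (α := α) (b := ε₁) hβ hL (by rw [hε₁]; linarith)
  have h2 := hgs hW hWm L d σ ρ ρ₀ ρ₁ ε₀ ε₁ _ _ hd hρ0 hρ₀0 hρ₁0.le hε₀ (hε₀.trans hε01.le) h1
    (by rw [hρp]; linarith) (by rw [hρp, hρ₁p]; linarith) hB
  rw [rpow_neg_eq_inv hd, ← hD] at h2
  have h3 := hshell k (le_max_left _ _) d σ (ρ₀ / M * D⁻¹) (ρ₁ / M * D⁻¹) (by positivity)
    (by positivity) h2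
  have hnull : 2 ^ k * (ρ₀ / M * D⁻¹) = ε₀' := by
    rw [hρ₀, hx]
    field_simp
  have h4 : G ≤ 2 ^ k * (ρ₁ / M * D⁻¹) := by
    refine gsCritical_le_of_hasTest hβ ?_ (by rwa [hnull] at h3)
    rw [← hnull]
    gcongr
  have h5 : g ≤ 2 ^ k / M * ρ₁ := by
    calc g ≤ 2 ^ k * (ρ₁ / M * D⁻¹) * D := by rw [hgdef]; gcongr
      _ = 2 ^ k / M * ρ₁ := by field_simp
  have h6 : g ^ p ≤ R * ρ₁ ^ p := by
    rw [hR, ← Real.mul_rpow (by positivity) hρ₁0.le]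
    exact Real.rpow_le_rpow hg0.le h5 hp0.le
  have h7 : R * ρ₀ ^ p ≤ l * g ^ p := by
    rw [hR, hl, ← Real.mul_rpow (by positivity) hρ₀0, ← Real.mul_rpow (by positivity) hg0.le]
    refine Real.rpow_le_rpow (by positivity) (le_of_eq_of_le ?_ hxK) hp0.le
    rw [hρ₀]
    field_simp
  have h8 : R * (ε₁ ^ p - ε₀ ^ p) ≤ (1 - l) / 2 * g ^ p := by
    calc R * (ε₁ ^ p - ε₀ ^ p) ≤ R * (c * Q * g ^ p) := by gcongr
      _ = R * (c * Q) * g ^ p := by ring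
      _ ≤ _ := by gcongr
  rw [hρ₁p, mul_add] at h6
  have h9 : 0 < (1 - l) / 2 * g ^ p := mul_pos (by linarith) hgp
  linarith

/-- If d^{-s} > τ, the dimension is bounded, and there a separation of order σ beyond the tolerance
suffices. With moderate tolerance the whole separation is then of order σ, so for small σ the
balance condition forces d^{-s} ≤ τ after all. -/
theorem exists_rpow_neg_le (hs : 0 < s) (hp : 1 ≤ p) (hα : 0 < α) (hβ : 0 < β) {A K τ : ℝ}
    (hA : 1 ≤ A) (hK : 0 ≤ K) (hτ : 0 < τ) :
    ∃ σ₀ : ℝ, 0 < σ₀ ∧ ∀ (σ ε : ℝ) (d : ℕ), 0 < σ → σ ≤ σ₀ → 1 ≤ d →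
      (d : ℝ) ^ (-s) ≤ A * (gsCritical α β p d σ ε * (d : ℝ) ^ (1 / 2 - 1 / p)) →
      ε ≤ K * (gsCritical α β p d σ ε - ε) → (d : ℝ) ^ (-s) ≤ τ := by
  obtain ⟨η, hη, hle⟩ := exists_gsCritical_le (α := α) hp hα hβ
  have hA0 : 0 < A := by linarith
  set N := τ ^ (-s⁻¹) with hN
  have hN0 : 0 < N := by positivity
  set B := A * ((K + 1) * (2 * (N * √(N / η))) * N) with hB
  have hB0 : 0 < B := by positivity
  refine ⟨τ / B, by positivity, fun σ ε d hσ hσ0 hd hg hmod => ?_⟩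
  by_contra! hlt
  have hd1 : (1 : ℝ) ≤ d := by exact_mod_cast hd
  have hd' : (0 : ℝ) < d := by linarith
  have hdN : (d : ℝ) ≤ N := by
    have h1 := Real.rpow_le_rpow_of_nonpos hτ hlt.le (z := -s⁻¹) (by
      rw [neg_nonpos]; positivity)
    rwa [← Real.rpow_mul hd'.le, neg_mul_neg, mul_inv_cancel₀ hs.ne', Real.rpow_one] at h1
  have hDN : (d : ℝ) ^ (1 / 2 - 1 / p) ≤ N := by
    refine le_trans ?_ hdN
    conv_rhs => rw [← Real.rpow_one (d : ℝ)]
    refine Real.rpow_le_rpow_of_exponent_le hd1 ?_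
    have : 0 < 1 / p := by positivity
    linarith
  have hG : gsCritical α β p d σ ε ≤ (K + 1) * (2 * (N * √(N / η))) * σ := by
    have h1 := hle d σ ε hd hσ
    have h2 : (d : ℝ) * (√(d / η) * σ) ≤ N * (√(N / η) * σ) := by gcongr
    have h3 : gsCritical α β p d σ ε - ε ≤ 2 * (N * (√(N / η) * σ)) := by linarith
    calc gsCritical α β p d σ ε ≤ (K + 1) * (gsCritical α β p d σ ε - ε) := by linarith
      _ ≤ (K + 1) * (2 * (N * (√(N / η) * σ))) := by gcongr
      _ = _ := by ring
  have h1 : (d : ℝ) ^ (-s) ≤ τ := by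
    calc (d : ℝ) ^ (-s) ≤ A * (gsCritical α β p d σ ε * (d : ℝ) ^ (1 / 2 - 1 / p)) := hg
      _ ≤ A * ((K + 1) * (2 * (N * √(N / η))) * σ * N) := by gcongr
      _ = B * σ := by rw [hB]; ring
      _ ≤ B * (τ / B) := by gcongr
      _ = τ := by field_simp
  linarith

end Moderate

/-! ### The balancing dimension -/

section Balance

variable {α β p s L : ℝ}

/-- Two blocks: applying the test in dimension d to each half of a vector in dimension 2d costs a
constant. The factor R accounts for the change of the rescaled tolerance. -/
theorem exists_gsCritical_two_mul_le (hp : 1 ≤ p) (hα : 0 < α) (hβ : 0 < β) (hαβ : β < 1 - α) :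
    ∃ C : ℝ, 1 ≤ C ∧ ∀ (d : ℕ) (σ ε b : ℝ), 0 < σ → 1 ≤ d → 0 ≤ ε →
      gsCritical α β p d σ (ε * (d : ℝ) ^ (1 / p - 1 / 2)) * (d : ℝ) ^ (1 / 2 - 1 / p) < b →
      gsCritical α β p (2 * d) σ (ε * ((2 * d : ℕ) : ℝ) ^ (1 / p - 1 / 2)) *
        ((2 * d : ℕ) : ℝ) ^ (1 / 2 - 1 / p) ≤ C * b := by
  set R := (2 : ℝ) ^ (1 / p - 1 / 2) with hR
  have hR0 : 0 < R := by positivity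
  obtain ⟨C, hC, hblock⟩ := exists_hasTest_block (p := p) hp hα hβ hαβ (m := 2) (by norm_num) R
  have hCR : 0 < max C R := lt_max_of_lt_right hR0
  refine ⟨max 1 (max C R * (2 : ℝ) ^ (1 / 2 - 1 / p)), le_max_left _ _,
    fun d σ ε b hσ hd hε h => ?_⟩
  have hd' : (0 : ℝ) < d := by exact_mod_cast hd
  have hcast : ∀ e : ℝ, (((2 * d : ℕ) : ℝ)) ^ e = 2 ^ e * (d : ℝ) ^ e := fun e => by
    rw [Nat.cast_mul, Nat.cast_two, Real.mul_rpow (by norm_num) hd'.le]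
  rw [hcast, hcast, ← hR]
  rw [rpow_neg_eq_inv hd] at h ⊢
  set D := (d : ℝ) ^ (1 / 2 - 1 / p) with hD
  have hD0 : 0 < D := by positivity
  have hlt : gsCritical α β p d σ (ε * D⁻¹) < b * D⁻¹ := by
    rwa [← div_eq_mul_inv b, lt_div_iff₀ hD0]
  have hεb : ε * D⁻¹ ≤ b * D⁻¹ := (le_gsCritical _).trans hlt.le
  have hb0 : 0 ≤ b := by
    exact nonneg_of_mul_nonneg_left ((by positivity : 0 ≤ ε * D⁻¹).trans hεb) (by positivity)
  have htest := hblock d σ _ _ (by positivity : 0 ≤ ε * D⁻¹) (by positivity : 0 ≤ b * D⁻¹)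
    (hasTest_of_gsCritical_lt hp hα hβ hσ hd hlt)
  have hG : gsCritical α β p (2 * d) σ (R * (ε * D⁻¹)) ≤ max C R * (b * D⁻¹) := by
    refine gsCritical_le_of_hasTest hβ (by gcongr; exact le_max_right _ _)
      (htest.mono (fun v hv => hv) (fun v hv => le_trans ?_ hv) le_rfl le_rfl)
    gcongr
    exact le_max_left _ _
  have he : ε * (R * D⁻¹) = R * (ε * D⁻¹) := by ring
  rw [he]
  calc gsCritical α β p (2 * d) σ (R * (ε * D⁻¹)) * (2 ^ (1 / 2 - 1 / p) * D)
      ≤ max C R * (b * D⁻¹) * (2 ^ (1 / 2 - 1 / p) * D) := by gcongr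
    _ = max C R * (2 : ℝ) ^ (1 / 2 - 1 / p) * b := by field_simp
    _ ≤ _ := by gcongr; exact le_max_right _ _

/-- Take the least k at which 2^{-ks} falls below the rescaled separation. Minimality and doubling
bound the separation from above at that k. -/
theorem exists_equivUpTo_gsCritical (hs : 0 < s) (hp : 1 ≤ p) (hα : 0 < α)
    (hβ : 0 < β) (hαβ : β < 1 - α) :
    ∃ A : ℝ, 1 ≤ A ∧ ∀ σ ε₀ : ℝ, 0 < σ → σ ≤ 1 → 0 ≤ ε₀ → ε₀ ≤ L →
      ∃ d : ℕ, 1 ≤ d ∧ EquivUpTo A ((d : ℝ) ^ (-s))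
        (gsCritical α β p d σ (ε₀ * (d : ℝ) ^ (1 / p - 1 / 2)) *
          (d : ℝ) ^ (1 / 2 - 1 / p)) := by
  obtain ⟨C, hC, hdouble⟩ := exists_gsCritical_two_mul_le (p := p) hp hα hβ hαβ
  obtain ⟨η, hη, hone⟩ := exists_gsCritical_le (α := α) hp hα hβ
  refine ⟨max (C * 2 ^ s) (L + 2 * √(1 / η)),
    (one_le_mul_of_one_le_of_one_le hC (Real.one_le_rpow one_le_two hs.le)).trans
      (le_max_left _ _), fun σ ε₀ hσ hσ1 hε₀ hεL => ?_⟩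
  set A := max (C * 2 ^ s) (L + 2 * √(1 / η)) with hA
  have hA1 : 1 ≤ A := (one_le_mul_of_one_le_of_one_le hC (Real.one_le_rpow one_le_two hs.le)).trans
    (le_max_left _ _)
  set h : ℕ → ℝ := fun d => gsCritical α β p d σ (ε₀ * (d : ℝ) ^ (1 / p - 1 / 2)) *
    (d : ℝ) ^ (1 / 2 - 1 / p) with hh
  obtain ⟨δ, hδ, hpos⟩ := exists_le_of_hasTest (p := p) hp hα hβ hαβ hσ
  have hδh : ∀ d : ℕ, 1 ≤ d → δ ≤ h d := fun d hd => by
    have hd' : (0 : ℝ) < d := by exact_mod_cast hd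
    have hD : (0 : ℝ) < (d : ℝ) ^ (1 / 2 - 1 / p) := by positivity
    refine (div_le_iff₀ hD).1 (le_of_forall_gt_imp_ge_of_dense fun b hb => ?_)
    exact (div_le_iff₀ hD).2 (hpos d _ b hd (by positivity)
      (hasTest_of_gsCritical_lt hp hα hβ hσ hd hb))
  -- The bound δ may depend on σ; it only serves to make the search terminate and does not enter the
  -- constant A.
  have hex : ∃ k : ℕ, ((2 ^ k : ℕ) : ℝ) ^ (-s) ≤ h (2 ^ k) := by
    have ht : Filter.Tendsto (fun k : ℕ => ((2 ^ k : ℕ) : ℝ) ^ (-s)) Filter.atTop (nhds 0) :=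
      (tendsto_rpow_neg_atTop hs).comp (tendsto_natCast_atTop_atTop.comp
        (tendsto_pow_atTop_atTop_of_one_lt one_lt_two))
    obtain ⟨k, hk⟩ := (ht.eventually (eventually_lt_nhds hδ)).exists
    exact ⟨k, hk.le.trans (hδh _ Nat.one_le_two_pow)⟩
  classical
  refine ⟨2 ^ Nat.find hex, Nat.one_le_two_pow, ?_, ?_⟩
  · have h1 := Nat.find_spec hex
    have h2 : 0 ≤ h (2 ^ Nat.find hex) := (by positivity : (0 : ℝ) ≤ _).trans h1
    exact h1.trans (le_mul_of_one_le_left h2 hA1)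
  · change h (2 ^ Nat.find hex) ≤ _
    have hmin := fun j => Nat.find_min hex (m := j)
    revert hmin
    cases Nat.find hex with
    | zero =>
      -- There is no previous scale when k = 0: the separation in dimension one is at most L +
      -- 2√(1/η), which explains the second entry of A.
      intro _
      have h1 := hone 1 σ ε₀ le_rfl hσ
      have h2 : √(1 / η) * σ ≤ √(1 / η) * 1 := by gcongr
      simp only [Nat.cast_one, one_mul] at h1
      simp only [hh, pow_zero, Nat.cast_one, Real.one_rpow, mul_one]
      exact le_trans (by linarith) (le_max_right (C * 2 ^ s) _)
    | succ j =>
      intro hmin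
      have h1 := hmin j (Nat.lt_succ_self j)
      push Not at h1
      have h2 := hdouble (2 ^ j) σ ε₀ _ hσ Nat.one_le_two_pow hε₀ h1
      rw [← pow_succ'] at h2
      refine h2.trans ?_
      have h3 : ((2 ^ j : ℕ) : ℝ) ^ (-s) = 2 ^ s * ((2 ^ (j + 1) : ℕ) : ℝ) ^ (-s) := by
        rw [pow_succ', Nat.cast_mul, Nat.cast_two, Real.mul_rpow (by norm_num) (by positivity),
          ← mul_assoc, ← Real.rpow_add two_pos, add_neg_cancel, Real.rpow_zero, one_mul]
      rw [h3, ← mul_assoc]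
      gcongr
      exact le_max_left _ _

end Balance

end TolerantTesting

/-! ### The comparison theorem -/

theorem mainTheorem6 (s p L α β : ℝ) (q : ℝ≥0∞) (r : ℕ)
    (hs : 0 < s) (hr : s < r) (hp : 1 ≤ p) (hq : 1 ≤ q) (hL : 0 < L)
    (hα : 0 < α) (hβ : 0 < β) (hαβ : β < 1 - α) :
    -- a dimension balancing `d^{-s}` with the rescaled critical separation exists
    (∃ A : ℝ, 1 ≤ A ∧ ∀ σ ε₀ : ℝ, 0 < σ → σ ≤ 1 → 0 ≤ ε₀ → ε₀ ≤ L →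
      ∃ d : ℕ, 1 ≤ d ∧
        TolerantTesting.EquivUpTo A ((d : ℝ) ^ (-s))
          (TolerantTesting.gsCritical α β p d σ (ε₀ * (d : ℝ) ^ (1 / p - 1 / 2)) *
            (d : ℝ) ^ (1 / 2 - 1 / p))) ∧
    -- for every such choice, with arbitrary hidden constants, the critical separations agree
    (∀ A K : ℝ, 1 ≤ A → 0 ≤ K → ∃ C σ₀ : ℝ, 1 ≤ C ∧ 0 < σ₀ ∧
      ∀ (Ω : Type*) [MeasurableSpace Ω] (P : Measure Ω) (W : ℝ≥0 → Ω → ℝ), IsBrownianReal W P →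
      ∀ (σ ε₀ ε₀' : ℝ) (d : ℕ), 0 < σ → σ ≤ 1 → 0 ≤ ε₀ → 0 ≤ ε₀' → 1 ≤ d →
        TolerantTesting.EquivUpTo A ε₀' (ε₀ * (d : ℝ) ^ (1 / p - 1 / 2)) →
        TolerantTesting.EquivUpTo A ((d : ℝ) ^ (-s))
          (TolerantTesting.gsCritical α β p d σ ε₀' * (d : ℝ) ^ (1 / 2 - 1 / p)) →
        TolerantTesting.EquivUpTo C
          (TolerantTesting.gwCritical P W α β r s p q L σ ε₀)
          (TolerantTesting.gsCritical α β p d σ ε₀' * (d : ℝ) ^ (1 / 2 - 1 / p)) ∧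
        (σ ≤ σ₀ → ε₀' ≤ K * (TolerantTesting.gsCritical α β p d σ ε₀' - ε₀') →
          TolerantTesting.EquivUpTo C
            (TolerantTesting.gwCritical P W α β r s p q L σ ε₀ - ε₀)
            ((TolerantTesting.gsCritical α β p d σ ε₀' - ε₀') *
              (d : ℝ) ^ (1 / 2 - 1 / p)))) := by
  refine ⟨TolerantTesting.exists_equivUpTo_gsCritical hs hp hα hβ hαβ, fun A K hA hK => ?_⟩
  obtain ⟨C₁, hC₁, hupper⟩ :=
    TolerantTesting.exists_gwCritical_le (q := q) hs hr hp hq hL hα hβ hαβ hA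
  obtain ⟨C₂, hC₂, hlower⟩ :=
    TolerantTesting.exists_le_gwCritical (q := q) hs hr hp hq hL hα hβ hαβ hA
  obtain ⟨c, τ, hc, hτ, hmoderate⟩ :=
    TolerantTesting.exists_mul_le_gwCritical_sub (q := q) hs hr hp hq hL hα hβ hαβ hA hK
  obtain ⟨σ₀, hσ₀, hnoise⟩ := TolerantTesting.exists_rpow_neg_le hs hp hα hβ hA hK hτ
  refine ⟨max (max 1 (C₁ * (K + 1))) (max C₂ c⁻¹), σ₀, (le_max_left _ _).trans (le_max_left _ _),
    hσ₀, ?_⟩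
  intro Ω _ P W hW σ ε₀ ε₀' d hσ hσ1 hε₀ hε₀' hd he hg
  obtain ⟨W', hmeas, hW', hlaw⟩ :=
    TolerantTesting.exists_measurable_whiteNoiseLaw_eq hW
  rw [TolerantTesting.gwCritical_congr hlaw]
  have h₁ := hupper hW' hmeas σ ε₀ ε₀' d hσ hε₀ hε₀' hd he hg
  have h₂ := hlower hW' hmeas σ ε₀ ε₀' d hε₀ hd he hg
  have h₃ := hmoderate hW' hmeas σ ε₀ ε₀' d hε₀ hε₀' hd he hg
  have hε₀G : ε₀' ≤ TolerantTesting.gsCritical α β p d σ ε₀' := TolerantTesting.le_gsCritical _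
  have hεg : ε₀ ≤ TolerantTesting.gwCritical P W' α β r s p q L σ ε₀ :=
    TolerantTesting.le_gwCritical _
  have hd' : (0 : ℝ) < d := by exact_mod_cast hd
  have hnoise' := hnoise σ ε₀' d hσ
  have hle := hg.1
  clear hupper hlower hmoderate hnoise he hg
  set G := TolerantTesting.gsCritical α β p d σ ε₀'
  set g := TolerantTesting.gwCritical P W' α β r s p q L σ ε₀
  have hD : (0 : ℝ) < (d : ℝ) ^ (1 / 2 - 1 / p) := by positivity
  set D := (d : ℝ) ^ (1 / 2 - 1 / p)
  have hG : 0 ≤ G := hε₀'.trans hε₀G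
  have hg : 0 ≤ g := hε₀.trans hεg
  have hK1 : C₁ ≤ C₁ * (K + 1) := le_mul_of_one_le_right hC₁.le (by linarith)
  refine ⟨⟨h₁.trans ?_, h₂.trans ?_⟩, fun hσσ hmod => ⟨?_, ?_⟩⟩
  · gcongr
    exact hK1.trans ((le_max_right _ _).trans (le_max_left _ _))
  · gcongr
    exact (le_max_left _ _).trans (le_max_right _ _)
  -- Moderate tolerance makes G comparable to G - ε₀', so the crude bound g - ε₀ ≤ g already
  -- suffices in this direction.
  · have h₄ : G ≤ (K + 1) * (G - ε₀') := by linarith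
    have h₅ : 0 ≤ (G - ε₀') * D := mul_nonneg (by linarith) hD.le
    calc g - ε₀ ≤ C₁ * (G * D) := by linarith
      _ ≤ C₁ * ((K + 1) * (G - ε₀') * D) := by gcongr
      _ = C₁ * (K + 1) * ((G - ε₀') * D) := by ring
      _ ≤ _ := by
        gcongr
        exact (le_max_right _ _).trans (le_max_left _ _)
  · have h₄ := h₃ hmod (hnoise' hσσ hd hle hmod)
    have h₅ : 0 ≤ g - ε₀ := by linarith
    calc (G - ε₀') * D ≤ c⁻¹ * (c * (G * D)) := by
          rw [inv_mul_cancel_left₀ hc.ne']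
          gcongr
          linarith
      _ ≤ c⁻¹ * (g - ε₀) := by gcongr
      _ ≤ _ := by
        gcongr
        exact (le_max_right _ _).trans (le_max_right _ _)
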